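/- Let $\Bbbk$ be an algebraically closed field and let $A$ be a finite dimensional unital associative $\Bbbk$-algebra of finite global dimension. Write $A\text{-mod}$ for the category of finite dimensional left $A$-modules, $A^*=\operatorname{Hom}_\Bbbk(A,\Bbbk)$ for the dual $A$-bimodule, and $D^b(A)$ for the bounded derived category of $A\text{-mod}$. Let $Q\in A\text{-mod}$ be a basic projective-injective module, i.e. a direct sum of pairwise non-isomorphic indecomposable projective-injective modules in which every indecomposable projective-injective module occurs up to isomorphism. Assume that $Q$ is good, i.e. its socle is isomorphic to its head, and that both $A$ and $A^{opp}$ have the double centraliser property with respect to some projective-injective module; for $A$ this means that there is a projective-injective $X\in A\text{-mod}$ such that the canonical map $A\to\operatorname{End}_{\operatorname{End}_A(X)}(X)$ is an isomorphism, and similarly for $A^{opp}$. Consider the functors $\mathbb{V}=\operatorname{Hom}_A(Q,-)$ from $A\text{-mod}$ to right $\operatorname{End}_A(Q)$-modules, $H=A^*\otimes_A-:A\text{-mod}\to A\text{-mod}$, and the partial coapproximation $\operatorname{Coapp}_Q:A\text{-mod}\to A\text{-mod}$, i.e. the right exact functor, unique up to isomorphism, that sends a projective module $P$ to $P_Q$,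 the sum of the images of all morphisms $Q\to P$, and sends a morphism of projective modules to its restriction. Then the following are equivalent: (i) $\mathbb{V}\cong\mathbb{V}H$ as functors; (ii) $H\cong(\operatorname{Coapp}_Q)^2$ as functors; (iii) the algebra $B=\operatorname{End}_A(Q)$ is symmetric, i.e. $B\cong B^*=\operatorname{Hom}_\Bbbk(B,\Bbbk)$ as $B$-bimodules. If these conditions hold, then the total left derived functor $\mathcal{L}\big((\operatorname{Coapp}_Q)^2\big):D^b(A)\to D^b(A)$ exists and is a Serre functor of $D^b(A)$, i.e. it is an additive auto-equivalence $\mathbb{S}$ admitting $\Bbbk$-linear isomorphisms $\operatorname{Hom}(X,\mathbb{S}Y)\cong\operatorname{Hom}(Y,X)^*$ natural in $X$ and $Y$. -/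

import Mathlib

open CategoryTheory

universe w u

namespace SerreCoapp

open Limits TensorProduct

noncomputable section

/-! ### The category `A-mod` of finite dimensional left modules -/

section FinDimMod

open scoped ModuleCat

variable (k A : Type u) [Field k] [Ring A] [Algebra k A]

/-- A left `A`-module is finite dimensional if it is so over `k` (acting through `A`). -/
def isFinDim : ObjectProperty (ModuleCat.{u} A) := fun M => Module.Finite k M

/-- `A-mod`: the category of finite dimensional left `A`-modules. -/
abbrev FinDimMod := (isFinDim k A).FullSubcategory

variable {A} in
theorem isFinDim_of_surjective {M N : ModuleCat.{u} A} (f : M →ₗ[A] N)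
    (hf : Function.Surjective f) (hM : isFinDim k A M) : isFinDim k A N := by
  have : Module.Finite k M := hM
  exact Module.Finite.of_surjective (f.restrictScalars k) hf

variable {A} in
theorem isFinDim_of_injective {M N : ModuleCat.{u} A} (f : M →ₗ[A] N)
    (hf : Function.Injective f) (hN : isFinDim k A N) : isFinDim k A M := by
  have : Module.Finite k N := hN
  exact Module.Finite.of_injective (f.restrictScalars k) hf

/-- Finite dimensionality does not depend on how the scalar action of `k` is presented. -/
theorem isFinDim_of (M : Type u) [AddCommGroup M] [Module A M] [i : Module k M]
    [IsScalarTower k A M] [h : Module.Finite k M] : isFinDim k A (ModuleCat.of A M) := by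
  have e : (ModuleCat.moduleOfAlgebraModule (ModuleCat.of A M) : Module k M) = i := by
    refine Module.ext' _ _ fun c x => ?_
    exact algebraMap_smul A c x
  change @Module.Finite k M _ _ (ModuleCat.moduleOfAlgebraModule (ModuleCat.of A M))
  rw [e]
  exact h

instance : (isFinDim k A).IsClosedUnderSubobjects where
  prop_of_mono f _ hY :=
    isFinDim_of_injective k f.hom ((ModuleCat.mono_iff_injective f).1 inferInstance) hY

instance : (isFinDim k A).IsClosedUnderQuotients where
  prop_of_epi f _ hX :=
    isFinDim_of_surjective k f.hom ((ModuleCat.epi_iff_surjective f).1 inferInstance) hX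

instance : (isFinDim k A).ContainsZero where
  exists_zero := ⟨ModuleCat.of A PUnit, ModuleCat.isZero_of_subsingleton _,
    isFinDim_of k A PUnit⟩

instance : (isFinDim k A).IsClosedUnderFiniteProducts where
  isClosedUnderLimitsOfShape J _ := ⟨by
    rintro X ⟨p⟩
    have h : ∀ j, Module.Finite k (p.diag.obj j) := fun j => p.prop_diag_obj j
    let f : X →ₗ[A] (∀ j, p.diag.obj j) := LinearMap.pi fun j => (p.π.app j).hom
    have hf : Function.Injective f := fun x y hxy =>
      Concrete.isLimit_ext p.diag p.isLimit x y fun j => congrFun hxy j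
    exact Module.Finite.of_injective (f.restrictScalars k) hf⟩

instance : HasFiniteBiproducts (FinDimMod k A) := Abelian.hasFiniteBiproducts

variable {k A}

instance (M : FinDimMod k A) : Module.Finite k M.obj := M.property

instance (M : FinDimMod k A) : Module.Finite A M.obj :=
  Module.Finite.of_restrictScalars_finite k A M.obj

theorem surjective_of_epi {M N : FinDimMod k A} (f : M ⟶ N) [Epi f] :
    Function.Surjective f.hom.hom := by
  have := (isFinDim k A).preservesEpimorphisms_ι_of_isNormalMonoCategory
  exact (ModuleCat.epi_iff_surjective f.hom).1 (inferInstanceAs (Epi ((isFinDim k A).ι.map f)))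

theorem epi_of_surjective {M N : FinDimMod k A} (f : M ⟶ N)
    (hf : Function.Surjective f.hom.hom) : Epi f := by
  have : Epi ((isFinDim k A).ι.map f) := (ModuleCat.epi_iff_surjective f.hom).2 hf
  exact (isFinDim k A).ι.epi_of_epi_map this

/-- If `A` is finite dimensional, `A-mod` has enough projectives: free modules of finite rank. -/
instance [Module.Finite k A] : EnoughProjectives (FinDimMod k A) where
  presentation M := by
    obtain ⟨n, f, hf⟩ := Module.Finite.exists_fin' A M.obj
    let P : FinDimMod k A := ⟨ModuleCat.of A (Fin n → A), isFinDim_of k A (Fin n → A)⟩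
    have hP : Projective P := ⟨fun {E X} g e _ => by
      obtain ⟨h, hh⟩ := Module.projective_lifting_property e.hom.hom g.hom.hom
        (surjective_of_epi e)
      let h' : P ⟶ E := ObjectProperty.homMk (ModuleCat.ofHom h)
      exact Exists.intro h' (ObjectProperty.hom_ext _ (ModuleCat.hom_ext hh))⟩
    let π : P ⟶ M := ObjectProperty.homMk (ModuleCat.ofHom f)
    exact ⟨{ p := P, projective := hP, f := π, epi := epi_of_surjective π hf }⟩

end FinDimMod

/-! ### Hypotheses on the algebra and on the module -/

section Hypotheses

open scoped ModuleCat

variable (k A : Type u) [Field k] [Ring A] [Algebra k A]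

/-- Finite global dimension: the projective dimensions of all modules in `A-mod` are bounded. -/
def HasFiniteGlobalDimension : Prop :=
  ∃ n : ℕ, ∀ M : FinDimMod k A, HasProjectiveDimensionLT M n

variable {k A}

/-- Projective-injective modules. -/
def IsProjInj (M : FinDimMod k A) : Prop := Projective M ∧ Injective M

/-- `Q` is a basic projective-injective module: a direct sum of pairwise non-isomorphic
indecomposable projective-injective modules, in which every indecomposable
projective-injective module occurs. -/
def IsBasicProjInj (Q : FinDimMod k A) : Prop :=
  ∃ (n : ℕ) (N : Fin n → FinDimMod k A),
    (∀ i, Indecomposable (N i) ∧ IsProjInj (N i)) ∧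
    (∀ i j, Nonempty (N i ≅ N j) → i = j) ∧
    (∀ M : FinDimMod k A, Indecomposable M → IsProjInj M → ∃ i, Nonempty (M ≅ N i)) ∧
    Nonempty (Q ≅ ⨁ N)

/-- The socle of a module: the sum of its simple submodules. -/
def socle (R M : Type*) [Ring R] [AddCommGroup M] [Module R M] : Submodule R M :=
  sSup {S | IsSimpleModule R S}

/-- The head (top) of a module: its quotient by the radical, the intersection of its maximal
submodules. -/
abbrev head (R M : Type*) [Ring R] [AddCommGroup M] [Module R M] : Type _ :=
  M ⧸ Module.jacobson R M

/-- `Q` is good: its socle is isomorphic to its head. -/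
def IsGood (Q : FinDimMod k A) : Prop :=
  Nonempty (socle A Q.obj ≃ₗ[A] head A Q.obj)

variable (k A) in
/-- `A` has the double centraliser property with respect to some projective-injective module `X`:
the canonical map `A → End_{End_A(X)}(X)` is an isomorphism. -/
def HasDoubleCentraliser : Prop :=
  ∃ X : FinDimMod k A, IsProjInj X ∧
    Function.Bijective
      (Module.toModuleEnd (Module.End A X.obj) (S := A) X.obj)

variable (k) in
/-- A `k`-algebra `B` is symmetric: `B ≅ B^* = Hom_k(B, k)` as `B`-bimodules, where
`(a f b)(y) = f (b y a)`. -/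
def IsSymmetricAlgebra (B : Type*) [Ring B] [Algebra k B] : Prop :=
  ∃ φ : B ≃ₗ[k] Module.Dual k B, ∀ a x b y : B, φ (a * x * b) y = φ x (b * y * a)

end Hypotheses

/-! ### The Nakayama functor `H = A^* ⊗_A -` -/

section Nakayama

variable (k A : Type u) [Field k] [Ring A] [Algebra k A]

/-- `A^* = Hom_k(A, k)`, as an `A`-bimodule. -/
def DualBimodule : Type u := Module.Dual k A

namespace DualBimodule

instance : AddCommGroup (DualBimodule k A) := inferInstanceAs (AddCommGroup (Module.Dual k A))

instance : Module k (DualBimodule k A) := inferInstanceAs (Module k (Module.Dual k A))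

instance [Module.Finite k A] : Module.Finite k (DualBimodule k A) :=
  inferInstanceAs (Module.Finite k (Module.Dual k A))

/-- The left action `(a f)(x) = f (x a)`. -/
instance : Module A (DualBimodule k A) where
  smul a f := LinearMap.comp (show Module.Dual k A from f) (LinearMap.mulRight k a)
  one_smul f := LinearMap.ext fun x => congrArg (show Module.Dual k A from f) (mul_one x)
  mul_smul a b f :=
    LinearMap.ext fun x => congrArg (show Module.Dual k A from f) (mul_assoc x a b).symm
  smul_zero _ := rfl
  smul_add _ _ _ := rfl
  add_smul a b f := LinearMap.ext fun x =>
    (congrArg (show Module.Dual k A from f) (mul_add x a b)).trans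
      ((show Module.Dual k A from f).map_add _ _)
  zero_smul f := LinearMap.ext fun x =>
    (congrArg (show Module.Dual k A from f) (mul_zero x)).trans
      ((show Module.Dual k A from f).map_zero)

variable {k A}

/-- The right action `(f a)(x) = f (a x)`. -/
def rightSMul (f : DualBimodule k A) (a : A) : DualBimodule k A :=
  LinearMap.comp (show Module.Dual k A from f) (LinearMap.mulLeft k a)

instance : IsScalarTower k A (DualBimodule k A) where
  smul_assoc c a f := LinearMap.ext fun x =>
    (congrArg (show Module.Dual k A from f) (mul_smul_comm c x a)).trans
      ((show Module.Dual k A from f).map_smul c _)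

instance : SMulCommClass k A (DualBimodule k A) where
  smul_comm _ _ _ := rfl

end DualBimodule

open scoped ModuleCat

variable {k A}

/-- The relations `(f a) ⊗ m = f ⊗ (a m)`, as a left `A`-submodule of `A^* ⊗_k M`. -/
def balancing (M : ModuleCat.{u} A) : Submodule A (DualBimodule k A ⊗[k] M) :=
  Submodule.span A
    {t | ∃ (f : DualBimodule k A) (a : A) (m : M), t = f.rightSMul a ⊗ₜ[k] m - f ⊗ₜ[k] (a • m)}

variable (k) in
/-- The left `A`-module `A^* ⊗_A M`. -/
abbrev NakayamaObj (M : ModuleCat.{u} A) : Type u :=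
  (DualBimodule k A ⊗[k] M) ⧸ balancing (k := k) M

/-- The map `A^* ⊗_k M → A^* ⊗_k N`, `f ⊗ m ↦ f ⊗ g m`. -/
def dualTensorMap {M N : ModuleCat.{u} A} (g : M ⟶ N) :
    DualBimodule k A ⊗[k] M →ₗ[A] DualBimodule k A ⊗[k] N :=
  TensorProduct.AlgebraTensorModule.map LinearMap.id (g.hom.restrictScalars k)

theorem balancing_le {M N : ModuleCat.{u} A} (g : M ⟶ N) :
    balancing (k := k) M ≤ (balancing N).comap (dualTensorMap g) := by
  refine Submodule.span_le.2 ?_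
  rintro _ ⟨f, a, m, rfl⟩
  refine Submodule.subset_span ⟨f, a, g.hom m, ?_⟩
  simp [dualTensorMap]

theorem isFinDim_nakayamaObj [Module.Finite k A] (M : FinDimMod k A) :
    isFinDim k A (ModuleCat.of A (NakayamaObj k M.obj)) := by
  have h : isFinDim k A (ModuleCat.of A (DualBimodule k A ⊗[k] M.obj)) :=
    isFinDim_of k A (DualBimodule k A ⊗[k] M.obj)
  exact isFinDim_of_surjective (N := ModuleCat.of A (NakayamaObj k M.obj)) k
    (balancing (k := k) M.obj).mkQ (Submodule.mkQ_surjective _) h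

variable (k A) in
/-- The functor `H = A^* ⊗_A - : A-mod ⥤ A-mod`. -/
def nakayama [Module.Finite k A] : FinDimMod k A ⥤ FinDimMod k A where
  obj M := ⟨ModuleCat.of A (NakayamaObj k M.obj), isFinDim_nakayamaObj M⟩
  map g := ObjectProperty.homMk (ModuleCat.ofHom
    (Submodule.mapQ _ _ (dualTensorMap g.hom) (balancing_le g.hom)))
  map_id M := by
    refine ObjectProperty.hom_ext _ (ModuleCat.hom_ext ?_)
    refine Submodule.linearMap_qext _ (LinearMap.ext fun t => ?_)
    change Submodule.Quotient.mk (dualTensorMap (𝟙 M.obj) t) = Submodule.Quotient.mk t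
    congr 1
    induction t with
    | zero => simp
    | add x y hx hy => rw [map_add, hx, hy]
    | tmul f m => rfl
  map_comp {M N L} g h := by
    refine ObjectProperty.hom_ext _ (ModuleCat.hom_ext ?_)
    refine Submodule.linearMap_qext _ (LinearMap.ext fun t => ?_)
    change Submodule.Quotient.mk (dualTensorMap (g.hom ≫ h.hom) t) =
      Submodule.Quotient.mk (dualTensorMap h.hom (dualTensorMap g.hom t))
    congr 1
    induction t with
    | zero => simp
    | add x y hx hy => rw [map_add, hx, hy, map_add, map_add]
    | tmul f m => rfl

end Nakayama

/-! ### Partial coapproximation -/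

section Coapp

variable {k A : Type u} [Field k] [Ring A] [Algebra k A]

/-- The trace `M_Q` of `Q` in `M`: the sum of the images of all morphisms `Q ⟶ M`. -/
def trace (Q M : FinDimMod k A) : Submodule A M.obj :=
  ⨆ f : Q ⟶ M, LinearMap.range f.hom.hom

theorem trace_le_comap (Q : FinDimMod k A) {M N : FinDimMod k A} (g : M ⟶ N) :
    trace Q M ≤ (trace Q N).comap g.hom.hom := by
  refine iSup_le fun f => ?_
  rintro _ ⟨x, rfl⟩
  exact Submodule.mem_iSup_of_mem (f ≫ g) ⟨x, rfl⟩

/-- The functor `M ↦ M_Q`; morphisms are restricted. -/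
def traceFunctor (Q : FinDimMod k A) : FinDimMod k A ⥤ FinDimMod k A where
  obj M := ⟨ModuleCat.of A (trace Q M),
    isFinDim_of_injective (N := M.obj) k (trace Q M).subtype (Submodule.subtype_injective _)
      M.property⟩
  map g := ObjectProperty.homMk (ModuleCat.ofHom (g.hom.hom.restrict (trace_le_comap Q g)))

instance (Q : FinDimMod k A) : (traceFunctor Q).Additive where

theorem leftDerived_additive [Module.Finite k A] (F : FinDimMod k A ⥤ FinDimMod k A)
    [F.Additive] : (F.leftDerived 0).Additive where
  map_add {M N f g} := by
    let PM := projectiveResolution M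
    let PN := projectiveResolution N
    rw [F.leftDerived_map_eq 0 (f + g)
        (ProjectiveResolution.lift f PM PN + ProjectiveResolution.lift g PM PN) (by simp),
      F.leftDerived_map_eq 0 f (ProjectiveResolution.lift f PM PN) (by simp),
      F.leftDerived_map_eq 0 g (ProjectiveResolution.lift g PM PN) (by simp)]
    simp only [Functor.comp_map, Functor.map_add, Preadditive.add_comp, Preadditive.comp_add]

/-- The partial coapproximation `Coapp_Q`: the right exact functor determined by `P ↦ P_Q` on
projective modules, i.e. the zeroth left derived functor of the trace functor: if
`P₁ ⟶ P₀ ⟶ M ⟶ 0` is a projective presentation, then `Coapp_Q M` is the cokernel of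
`(P₁)_Q ⟶ (P₀)_Q`. -/
def coapp [Module.Finite k A] (Q : FinDimMod k A) : FinDimMod k A ⥤ FinDimMod k A :=
  (traceFunctor Q).leftDerived 0

instance [Module.Finite k A] (Q : FinDimMod k A) : (coapp Q).Additive :=
  leftDerived_additive (traceFunctor Q)

/-- On a projective module `P`, the functor `Coapp_Q` takes the value `P_Q`, naturally in `P`. -/
theorem isIso_coapp_to_trace [Module.Finite k A] (Q P : FinDimMod k A) [Projective P] :
    IsIso ((traceFunctor Q).fromLeftDerivedZero.app P : (coapp Q).obj P ⟶ _) :=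
  inferInstanceAs (IsIso ((traceFunctor Q).fromLeftDerivedZero.app P))

end Coapp

/-! ### Bounded derived categories, left derived functors and Serre functors -/

section Derived

variable (C : Type*) [Category* C] [Abelian C]

/-- A bounded cochain complex. -/
def boundedComplex : ObjectProperty (CochainComplex C ℤ) :=
  fun K => ∃ a b : ℤ, K.IsStrictlyGE a ∧ K.IsStrictlyLE b

/-- The bounded complexes, in the homotopy category of complexes. -/
def boundedHomotopy : ObjectProperty (HomotopyCategory C (ComplexShape.up ℤ)) :=
  (boundedComplex C).strictMap (HomotopyCategory.quotient C (ComplexShape.up ℤ))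

/-- `K^b(C)`: the homotopy category of bounded cochain complexes. -/
abbrev Kb := (boundedHomotopy C).FullSubcategory

/-- The localization functor `K^b(C) ⥤ D^b(C)`. -/
def Kb.toDb [HasDerivedCategory C] : Kb C ⥤ DerivedCategory.Bounded C :=
  ObjectProperty.lift _ ((boundedHomotopy C).ι ⋙ DerivedCategory.Qh) (by
    rintro ⟨_, ⟨K, a, b, ha, hb⟩⟩
    exact ⟨⟨a, ⟨K, Iso.refl _, ha⟩⟩, ⟨b, ⟨K, Iso.refl _, hb⟩⟩⟩)

variable {C}

/-- The functor `K^b(C) ⥤ K^b(C)` induced by an additive functor `F : C ⥤ C`. -/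
def mapKb (F : C ⥤ C) [F.Additive] : Kb C ⥤ Kb C :=
  ObjectProperty.lift _
    ((boundedHomotopy C).ι ⋙ F.mapHomotopyCategory (ComplexShape.up ℤ)) (by
    rintro ⟨_, ⟨K, a, b, ha, hb⟩⟩
    refine ⟨(F.mapHomologicalComplex _).obj K, a, b, ?_, ?_⟩
    · exact inferInstance
    · exact inferInstance)

/-- `LF : D^b(C) ⥤ D^b(C)` is a (total) left derived functor of `F : C ⥤ C`: with a suitable
natural transformation, it is the right Kan extension along `K^b(C) ⥤ D^b(C)` of
`K^b(C) ⥤ K^b(C) ⥤ D^b(C)`, the first arrow being induced by `F`. -/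
def IsLeftDerived [HasDerivedCategory C] (F : C ⥤ C) [F.Additive]
    (LF : DerivedCategory.Bounded C ⥤ DerivedCategory.Bounded C) : Prop :=
  ∃ α : Kb.toDb C ⋙ LF ⟶ mapKb F ⋙ Kb.toDb C, LF.IsRightKanExtension α

end Derived

section Serre

/-- A Serre functor on a `k`-linear category: an additive auto-equivalence `S` with `k`-linear
isomorphisms `Hom(X, S Y) ≅ Hom(Y, X)^*`, natural in `X` and in `Y`. -/
structure IsSerreFunctor (k : Type*) [Field k] {D : Type*} [Category* D] [Preadditive D]
    [Linear k D] (S : D ⥤ D) : Prop where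
  additive : S.Additive
  isEquivalence : S.IsEquivalence
  duality : ∃ Ψ : ∀ X Y : D, (X ⟶ S.obj Y) ≃ₗ[k] Module.Dual k (Y ⟶ X),
    (∀ (X X' Y : D) (f : X' ⟶ X) (φ : X ⟶ S.obj Y) (g : Y ⟶ X'),
      Ψ X' Y (f ≫ φ) g = Ψ X Y φ (g ≫ f)) ∧
    (∀ (X Y Y' : D) (h : Y ⟶ Y') (φ : X ⟶ S.obj Y) (g : Y' ⟶ X),
      Ψ X Y' (φ ≫ S.map h) g = Ψ X Y φ (h ≫ g))

end Serre

end

end SerreCoapp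

/-! Write B = End Q and V = Hom(Q, -). Call X presented by Q if morphisms X ⟶ N are the same as
B-linear maps V X → V N, for every N (`IsPresented`). A functor with presented values is determined
by its composite with V (`IsPresented.nonempty_iso`), so (i) ⇔ (ii) follows once both functors in
(ii) are seen to have presented values and V Coapp² ≅ V is known.

The canonical map Coapp_Q M ⟶ M becomes bijective under V (`coappCounit_bijective`), which gives V
Coapp² ≅ V. The module Coapp_Q M is always generated by Q, and Coapp_Q of a generated module is a
cokernel of a map from a generated module to some Q^n, hence presented (`isPresented_coapp`). For H,
the double centraliser property of the opposite algebra gives an exact sequence 0 → A → X^n → X^m of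
right modules with X projective-injective. Its linear dual is a presentation of A^* = H(A) by
projective-injective left modules, and right exactness of H carries this to all H(M)
(`isPresented_nakayama`).

The link between (i) and (iii) is the natural duality Hom(M, H P) ≅ Hom(P, M)^* for P projective
(`nakayamaDuality`). For M = P = Q it turns an isomorphism V ≅ V H into a bimodule isomorphism B ≅
B^*. Conversely, a projective presentation of M extends Hom(Q, H M) ≅ Hom(M, Q)^* to every M. Since
Q is good, projective and injective, Hom(M, Q) is the space of B-linear maps Hom(Q, M) → B
(`exists_hom_of_linear`), and a symmetrizing form on B identifies this space with Hom(Q, M)^*.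
Dualising gives V M ≅ V H M.

For the Serre functor, finite global dimension provides bounded projective resolutions. They form a
left adjoint of K^b ⥤ D^b, through which left derived functors are computed. The alternating sum of
the degreewise dualities is a perfect pairing on homotopy classes (`exists_kbDuality`), so LH
satisfies Serre duality and is therefore fully faithful. It is essentially surjective because every
injective is H of a projective and bounded injective resolutions exist. Finally, (ii) replaces H by
Coapp². -/

namespace SerreCoapp
open Limits
noncomputable section

/-! ### Bounded injective and projective resolutions of bounded complexes. -/

section Resolutions

variable {C : Type*} [Category* C] [Abelian C]

/-- Deep cycles of a complex of injectives which is exact in high degrees have small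
injective dimension, measured by any `P` that drops along cosyzygies. -/
theorem prop_cycles_of_exactAt (P : ℕ → ObjectProperty C)
    (hs : ∀ n (S : ShortComplex C), S.ShortExact → Injective S.X₂ → P (n + 1) S.X₁ → P n S.X₃)
    (n : ℕ) (hn : ∀ X, P n X) (L : CochainComplex C ℤ) (hL : ∀ i, Injective (L.X i))
    (b : ℤ) (hb : ∀ i, b < i → L.ExactAt i) (m : ℕ) (hm : m ≤ n) (i : ℤ)
    (hi : i = b + 1 + m) : P (n - m) (L.cycles i) := by
  induction m generalizing i with
  | zero => exact hn _
  | succ m ih =>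
    -- Dimension shift: exactness at `i` makes 0 → Z^{i-1} → L^{i-1} → Z^i → 0 short exact, with
    -- injective middle term.
    have h₁ := ih (by lia) (i - 1) (by push_cast at hi; lia)
    have e : n - m = (n - (m + 1)) + 1 := by lia
    rw [e] at h₁
    have hex : L.ExactAt i := hb i (by push_cast at hi; lia)
    have : Epi (L.toCycles (i - 1) i) :=
      Preadditive.epi_of_isZero_cokernel' _ (L.homologyIsCokernel (i - 1) i (by simp))
        hex.isZero_homology
    refine hs _ (ShortComplex.mk (L.iCycles (i - 1)) (L.toCycles (i - 1) i)
      (by rw [← cancel_mono (L.iCycles i)]; simp)) ?_ (hL _) h₁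
    have : Mono (L.iCycles (i - 1)) := inferInstance
    refine { exact := ?_, mono_f := ‹_›, epi_g := ‹_› }
    have hn : (ComplexShape.up ℤ).next (i - 1) = i := by simp
    have hk {T : C} (g : T ⟶ L.X (i - 1)) (hg : g ≫ L.toCycles (i - 1) i = 0) :
        g ≫ L.d (i - 1) i = 0 := by
      rw [← L.toCycles_i (i - 1) i, reassoc_of% hg, zero_comp]
    exact ShortComplex.exact_of_f_is_kernel _ (KernelFork.IsLimit.ofι _ _
      (fun g hg => L.liftCycles g i hn (hk g hg)) (fun g hg => by simp)
      (fun g hg m hm => by rw [← cancel_mono (L.iCycles (i - 1))]; simpa using hm))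

/-- A bounded complex is quasi-isomorphic to a bounded complex of injectives, if there are enough
injectives and the injective dimension is bounded. -/
theorem exists_bounded_injective [EnoughInjectives C] (P : ℕ → ObjectProperty C)
    (h0 : ∀ X, P 0 X → Injective X)
    (hs : ∀ n (S : ShortComplex C), S.ShortExact → Injective S.X₂ → P (n + 1) S.X₁ → P n S.X₃)
    (n : ℕ) (hn : ∀ X, P n X) (K : CochainComplex C ℤ) (a b : ℤ)
    [K.IsStrictlyGE a] [K.IsStrictlyLE b] :
    ∃ (L I : CochainComplex C ℤ) (i : K ⟶ L) (j : I ⟶ L) (c : ℤ), QuasiIso i ∧ QuasiIso j ∧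
      (∀ n, Injective (I.X n)) ∧ I.IsStrictlyGE a ∧ I.IsStrictlyLE c := by
  obtain ⟨L, i, _, hL, _⟩ :=
    CochainComplex.Plus.modelCategoryQuillen.exists_quasiIso_injective K a
  have hb : ∀ q, b < q → L.ExactAt q := fun q hq => by
    rw [← quasiIsoAt_iff_exactAt i q (K.exactAt_of_isLE b q hq)]
    infer_instance
  -- After `n` shifts beyond degree `b + 1` the remaining dimension is 0, so truncating `L` at `b +
  -- 1 + n` leaves only injective terms.
  have hc : Injective (L.cycles (b + 1 + n)) := h0 _ (by
    simpa using prop_cycles_of_exactAt P hs n hn L hL b hb n le_rfl _ rfl)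
  have : L.IsLE (b + 1 + n) := by
    rw [CochainComplex.isLE_iff]
    exact fun q hq => hb q (by lia)
  refine ⟨L, L.truncLE (b + 1 + n), i, L.ιTruncLE _, b + 1 + n, ‹_›, inferInstance, fun q => ?_,
    ?_, inferInstance⟩
  · obtain h | rfl | h := lt_trichotomy q (b + 1 + n)
    · exact Injective.of_iso (L.truncLEXIso _ q h).symm (hL q)
    · exact Injective.of_iso (L.truncLEXIsoCycles _).symm hc
    · exact (CochainComplex.isZero_of_isStrictlyLE _ (b + 1 + n) _ h).injective
  · rw [CochainComplex.isStrictlyGE_iff]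
    intro q hq
    have : Mono ((L.ιTruncLE (b + 1 + n)).f q) := by
      dsimp [CochainComplex.ιTruncLE]
      infer_instance
    exact IsZero.of_mono ((L.ιTruncLE (b + 1 + n)).f q) (L.isZero_of_isStrictlyGE a q hq)

open Opposite CochainComplex

/-- Passing to the opposite category sends degree `i` to `-i` and reverses the short complexes that
compute homology. -/
theorem quasiIso_opEquivalence_inverse {K L : CochainComplex Cᵒᵖ ℤ} (f : K ⟶ L) [QuasiIso f] :
    QuasiIso ((opEquivalence C).inverse.map f).unop where
  quasiIsoAt i := by
    have h : QuasiIsoAt f (-i) := inferInstance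
    rw [quasiIsoAt_iff' f (-(i + 1)) (-i) (-(i - 1)) (by simp; lia) (by simp; lia)] at h
    rw [quasiIsoAt_iff' _ (i - 1) i (i + 1) (by simp) (by simp),
      ← ShortComplex.quasiIso_opMap_iff]
    exact h

/-- A bounded complex is quasi-isomorphic to a bounded complex of projectives, if there are enough
projectives and the projective dimension is bounded. -/
theorem exists_bounded_projective [EnoughProjectives C]
    (n : ℕ) (hn : ∀ X : C, HasProjectiveDimensionLT X (n + 1)) (K : CochainComplex C ℤ) (a b : ℤ)
    [K.IsStrictlyGE a] [K.IsStrictlyLE b] :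
    ∃ (L P : CochainComplex C ℤ) (i : L ⟶ K) (j : L ⟶ P) (a' b' : ℤ), QuasiIso i ∧ QuasiIso j ∧
      (∀ n, Projective (P.X n)) ∧ P.IsStrictlyGE a' ∧ P.IsStrictlyLE b' := by
  let K' := (opEquivalence C).functor.obj (op K)
  have : K'.IsStrictlyGE (-b) := by
    rw [isStrictlyGE_iff]
    intro i hi
    exact (K.isZero_of_isStrictlyLE b (-i) (by lia)).op
  have : K'.IsStrictlyLE (-a) := by
    rw [isStrictlyLE_iff]
    intro i hi
    exact (K.isZero_of_isStrictlyGE a (-i) (by lia)).op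
  obtain ⟨L, I, i, j, c, _, _, hI, _, _⟩ := exists_bounded_injective
    -- The injective dimension of an object of `Cᵒᵖ` is measured by its projective dimension in `C`;
    -- the shift by one makes index 0 mean projective in `C`.
    (fun m (X : Cᵒᵖ) => HasProjectiveDimensionLT X.unop (m + 1))
    (fun X (h : HasProjectiveDimensionLT X.unop 1) => by
      have := projective_iff_hasProjectiveDimensionLT_one.2 h
      exact inferInstanceAs (Injective (op X.unop)))
    (fun m S hS (_ : Injective S.X₂) (h₁ : HasProjectiveDimensionLT S.X₁.unop (m + 2)) =>
      hS.unop.hasProjectiveDimensionLT_X₁ (m + 1)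
        (have : Projective S.X₂.unop := inferInstance
         inferInstanceAs (HasProjectiveDimensionLT S.X₂.unop (m + 1))) h₁)
    n (fun X => hn X.unop) K' (-b) (-a)
  have := quasiIso_opEquivalence_inverse i
  have := quasiIso_opEquivalence_inverse j
  refine ⟨((opEquivalence C).inverse.obj L).unop, ((opEquivalence C).inverse.obj I).unop,
    ((opEquivalence C).inverse.map i).unop ≫ ((opEquivalence C).unitIso.hom.app (op K)).unop,
    ((opEquivalence C).inverse.map j).unop, -c, b, ?_, this, ?_, ?_, ?_⟩
  · infer_instance
  · intro m
    have := hI (-m)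
    exact (inferInstance : Projective (I.X (-m)).unop)
  · rw [isStrictlyGE_iff]
    intro i hi
    exact (I.isZero_of_isStrictlyLE c (-i) (by lia)).unop
  · rw [isStrictlyLE_iff]
    intro i hi
    exact (I.isZero_of_isStrictlyGE (-b) (-i) (by lia)).unop

end Resolutions
end
end SerreCoapp

namespace SerreCoapp
open Limits
noncomputable section

/-! ### Right Kan extensions along a right adjoint. -/

section KanExtension

variable {C D E : Type*} [Category* C] [Category* D] [Category* E]

/-- If `j` is left adjoint to `p`, then precomposition with `j` computes right Kan extensions
along `p`. -/
theorem isRightKanExtension_of_adjunction {j : D ⥤ C} {p : C ⥤ D} (adj : j ⊣ p) (G : C ⥤ E) :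
    (j ⋙ G).IsRightKanExtension (L := p) (F := G) ((adj.whiskerLeft E).counit.app G) where
  -- Terminality is the transposition Hom(p ⋙ X, G) ≅ Hom(X, j ⋙ G) of the whiskered adjunction.
  nonempty_isUniversal := ⟨IsTerminal.ofUniqueHom
    (fun X => CostructuredArrow.homMk ((adj.whiskerLeft E).homEquiv X.left G X.hom)
      (((adj.whiskerLeft E).homEquiv_counit _ _ _).symm.trans
        (((adj.whiskerLeft E).homEquiv X.left G).symm_apply_apply X.hom)))
    (fun X m => by
      ext1
      apply ((adj.whiskerLeft E).homEquiv X.left G).symm.injective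
      refine Eq.trans ?_ (((adj.whiskerLeft E).homEquiv X.left G).symm_apply_apply X.hom).symm
      refine ((adj.whiskerLeft E).homEquiv_counit _ _ _).trans ?_
      exact CostructuredArrow.w m)⟩

end KanExtension

/-! ### The bounded homotopy category and left derived functors by projective resolutions. -/

section Kb

variable {C : Type*} [Category* C] [Abelian C]

/-- The complex underlying an object of `K^b(C)`. -/
def Kb.complex (K : Kb C) : CochainComplex C ℤ := K.obj.as

theorem Kb.boundedComplex_complex (K : Kb C) : boundedComplex C K.complex := by
  obtain ⟨_, ⟨K, hK⟩⟩ := K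
  exact hK

/-- A bounded complex, as an object of `K^b(C)`. -/
def Kb.of (K : CochainComplex C ℤ) (hK : boundedComplex C K) : Kb C :=
  ⟨(HomotopyCategory.quotient C (ComplexShape.up ℤ)).obj K, ⟨K, hK⟩⟩

/-- The morphism of `K^b(C)` given by a morphism of complexes. -/
def Kb.homMk {K L : Kb C} (f : K.complex ⟶ L.complex) : K ⟶ L :=
  ObjectProperty.homMk ((HomotopyCategory.quotient C (ComplexShape.up ℤ)).map f)

theorem Kb.homMk_surjective {K L : Kb C} (f : K ⟶ L) :
    ∃ g : K.complex ⟶ L.complex, Kb.homMk g = f := by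
  obtain ⟨g, hg⟩ := (HomotopyCategory.quotient C (ComplexShape.up ℤ)).map_surjective
    (X := K.complex) (Y := L.complex) f.hom
  exact ⟨g, ObjectProperty.hom_ext _ hg⟩

theorem Kb.homMk_comp {K L M : Kb C} (f : K.complex ⟶ L.complex) (g : L.complex ⟶ M.complex) :
    (Kb.homMk (f ≫ g) : K ⟶ M) = (Kb.homMk f : K ⟶ L) ≫ Kb.homMk g :=
  ObjectProperty.hom_ext _ ((HomotopyCategory.quotient C (ComplexShape.up ℤ)).map_comp f g)

theorem Kb.homMk_eq_iff {K L : Kb C} (f g : K.complex ⟶ L.complex) :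
    (Kb.homMk f : K ⟶ L) = Kb.homMk g ↔ Nonempty (Homotopy f g) := by
  refine ⟨fun h => ⟨HomotopyCategory.homotopyOfEq _ _ (congrArg (fun u => u.hom) h)⟩,
    fun ⟨h⟩ => ObjectProperty.hom_ext _ (HomotopyCategory.eq_of_homotopy _ _ h)⟩

/-- The object of `K^b(C)` consists of projective objects. -/
abbrev Kb.IsProj (K : Kb C) : Prop := ∀ n, Projective (K.complex.X n)

variable [HasDerivedCategory C]

/-- A bounded complex of projectives is K-projective, so no fractions are needed to describe
morphisms out of it in the derived category. -/
theorem Kb.toDb_map_bijective {P : Kb C} (hP : P.IsProj) (K : Kb C) :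
    Function.Bijective ((Kb.toDb C).map : (P ⟶ K) → _) := by
  obtain ⟨a, b, _, _⟩ := P.boundedComplex_complex
  have : ∀ n, Projective (P.complex.X n) := hP
  have := CochainComplex.isKProjective_of_projective P.complex b
  have h := CochainComplex.IsKProjective.Qh_map_bijective P.complex K.obj
  refine ⟨fun f g hfg => ObjectProperty.hom_ext _ (h.1 ?_), fun g => ?_⟩
  · exact congrArg (fun u => u.hom) hfg
  · obtain ⟨f, hf⟩ := h.2 g.hom
    exact ⟨ObjectProperty.homMk f, ObjectProperty.hom_ext _ hf⟩

theorem exists_isStrictly_iso (X : DerivedCategory.Bounded C) :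
    ∃ (K : CochainComplex C ℤ) (a b : ℤ) (_ : K.IsStrictlyGE a) (_ : K.IsStrictlyLE b),
      Nonempty (X.obj ≅ DerivedCategory.Q.obj K) := by
  obtain ⟨X, ⟨a, ha⟩, ⟨b, hb⟩⟩ := X
  have : X.IsGE a := ha
  have : X.IsLE b := hb
  obtain ⟨K, h, h', e⟩ := DerivedCategory.exists_iso_Q_obj_of_isGE_of_isLE X a b
  exact ⟨K, a, b, h, h', e⟩

theorem exists_isProj_iso [EnoughProjectives C]
    (n : ℕ) (hn : ∀ X : C, HasProjectiveDimensionLT X (n + 1)) (X : DerivedCategory.Bounded C) :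
    ∃ P : Kb C, P.IsProj ∧ Nonempty ((Kb.toDb C).obj P ≅ X) := by
  obtain ⟨K, a, b, _, _, ⟨e⟩⟩ := exists_isStrictly_iso X
  obtain ⟨L, P, i, j, a', b', _, _, hP, h, h'⟩ := exists_bounded_projective n hn K a b
  refine ⟨Kb.of P ⟨a', b', h, h'⟩, hP, ⟨ObjectProperty.isoMk _ ?_⟩⟩
  exact (e ≪≫ (asIso (DerivedCategory.Q.map i)).symm ≪≫ asIso (DerivedCategory.Q.map j)).symm

theorem exists_injective_iso [EnoughInjectives C]
    (n : ℕ) (hn : ∀ X : C, HasInjectiveDimensionLT X (n + 1)) (X : DerivedCategory.Bounded C) :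
    ∃ I : Kb C, (∀ n, Injective (I.complex.X n)) ∧ Nonempty ((Kb.toDb C).obj I ≅ X) := by
  obtain ⟨K, a, b, _, _, ⟨e⟩⟩ := exists_isStrictly_iso X
  obtain ⟨L, I, i, j, c, _, _, hI, h, h'⟩ := exists_bounded_injective
    (fun m (X : C) => HasInjectiveDimensionLT X (m + 1))
    (fun X h => injective_iff_hasInjectiveDimensionLT_one.2 h)
    (fun m S hS h₂ h₁ => (hS.hasInjectiveDimensionLT_X₃_iff m h₂).2 h₁) n hn K a b
  refine ⟨Kb.of I ⟨a, c, h, h'⟩, hI, ⟨ObjectProperty.isoMk _ ?_⟩⟩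
  exact (e ≪≫ asIso (DerivedCategory.Q.map i) ≪≫ (asIso (DerivedCategory.Q.map j)).symm).symm

/-- A choice of bounded projective resolutions of the objects of `D^b(C)`. -/
structure ProjRes (C : Type*) [Category* C] [Abelian C] [HasDerivedCategory C] where
  obj (X : DerivedCategory.Bounded C) : Kb C
  isProj (X : DerivedCategory.Bounded C) : (obj X).IsProj
  iso (X : DerivedCategory.Bounded C) : (Kb.toDb C).obj (obj X) ≅ X

theorem nonempty_projRes [EnoughProjectives C]
    (n : ℕ) (hn : ∀ X : C, HasProjectiveDimensionLT X (n + 1)) : Nonempty (ProjRes C) :=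
  ⟨{  obj X := (exists_isProj_iso n hn X).choose
      isProj X := (exists_isProj_iso n hn X).choose_spec.1
      iso X := (exists_isProj_iso n hn X).choose_spec.2.some }⟩

namespace ProjRes

variable (R : ProjRes C)

/-- Morphisms from the projective resolution are morphisms in the derived category. -/
def homEquiv (X : DerivedCategory.Bounded C) (K : Kb C) :
    (R.obj X ⟶ K) ≃ (X ⟶ (Kb.toDb C).obj K) :=
  (Equiv.ofBijective _ (Kb.toDb_map_bijective (R.isProj X) K)).trans
    ((R.iso X).homCongr (Iso.refl _))

theorem homEquiv_apply (X : DerivedCategory.Bounded C) (K : Kb C) (f : R.obj X ⟶ K) :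
    R.homEquiv X K f = (R.iso X).inv ≫ (Kb.toDb C).map f := by
  simp [homEquiv]

theorem homEquiv_comp (X : DerivedCategory.Bounded C) (K L : Kb C) (g : K ⟶ L)
    (f : R.obj X ⟶ K) : R.homEquiv X L (f ≫ g) = R.homEquiv X K f ≫ (Kb.toDb C).map g := by
  simp [homEquiv_apply]

/-- The functor `D^b(C) ⥤ K^b(C)` given by projective resolutions. -/
def functor : DerivedCategory.Bounded C ⥤ Kb C :=
  Adjunction.leftAdjointOfEquiv R.homEquiv R.homEquiv_comp

/-- Projective resolution is left adjoint to localization. -/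
def adj : R.functor ⊣ Kb.toDb C := Adjunction.adjunctionOfEquivLeft R.homEquiv R.homEquiv_comp

/-- The unit is the inverse of the chosen isomorphism from the resolution; its invertibility makes
the resolution functor fully faithful. -/
instance : IsIso R.adj.unit := by
  have : ∀ X, IsIso (R.adj.unit.app X) := fun X => by
    have : R.adj.unit.app X = (R.iso X).inv := by
      change R.homEquiv X (R.obj X) (𝟙 _) = _
      simp [homEquiv_apply]
    rw [this]
    exact (R.iso X).symm.isIso_hom
  exact NatIso.isIso_of_isIso_app _

instance : R.functor.Full := R.adj.fullyFaithfulLOfIsIsoUnit.full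

instance : R.functor.Faithful := R.adj.fullyFaithfulLOfIsIsoUnit.faithful

/-- The left derived functor computed by projective resolutions. -/
def derived (F : C ⥤ C) [F.Additive] : DerivedCategory.Bounded C ⥤ DerivedCategory.Bounded C :=
  R.functor ⋙ mapKb F ⋙ Kb.toDb C

theorem isLeftDerived (F : C ⥤ C) [F.Additive] : IsLeftDerived F (R.derived F) :=
  ⟨_, isRightKanExtension_of_adjunction R.adj (mapKb F ⋙ Kb.toDb C)⟩

end ProjRes

theorem IsLeftDerived.nonempty_iso {F : C ⥤ C} [F.Additive]
    {S T : DerivedCategory.Bounded C ⥤ DerivedCategory.Bounded C}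
    (hS : IsLeftDerived F S) (hT : IsLeftDerived F T) : Nonempty (S ≅ T) := by
  obtain ⟨α, _⟩ := hS
  obtain ⟨β, _⟩ := hT
  exact ⟨Functor.rightKanExtensionUnique S α T β⟩

/-- Isomorphic functors induce isomorphic functors on homotopy categories. -/
def mapHomotopyCategoryIso {F G : C ⥤ C} [F.Additive] [G.Additive] (e : F ≅ G) :
    F.mapHomotopyCategory (ComplexShape.up ℤ) ≅ G.mapHomotopyCategory (ComplexShape.up ℤ) where
  hom := NatTrans.mapHomotopyCategory e.hom _
  inv := NatTrans.mapHomotopyCategory e.inv _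
  hom_inv_id := by
    rw [← NatTrans.mapHomotopyCategory_comp, e.hom_inv_id, NatTrans.mapHomotopyCategory_id]
  inv_hom_id := by
    rw [← NatTrans.mapHomotopyCategory_comp, e.inv_hom_id, NatTrans.mapHomotopyCategory_id]

/-- Isomorphic functors induce isomorphic functors on `K^b(C)`. -/
def mapKbIso {F G : C ⥤ C} [F.Additive] [G.Additive] (e : F ≅ G) : mapKb F ≅ mapKb G :=
  NatIso.ofComponents (fun K => ObjectProperty.isoMk _ ((mapHomotopyCategoryIso e).app K.obj))
    (fun f => ObjectProperty.hom_ext _ ((mapHomotopyCategoryIso e).hom.naturality f.hom))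

theorem IsLeftDerived.of_iso {F G : C ⥤ C} [F.Additive] [G.Additive] (e : F ≅ G)
    {S : DerivedCategory.Bounded C ⥤ DerivedCategory.Bounded C} (hS : IsLeftDerived F S) :
    IsLeftDerived G S := by
  obtain ⟨α, _⟩ := hS
  let e' := Functor.isoWhiskerRight (mapKbIso e) (Kb.toDb C)
  exact ⟨α ≫ e'.hom, (Functor.isRightKanExtension_iff_of_iso₂ α _ e' (Iso.refl S) (by simp)).1 ‹_›⟩

end Kb

end
end SerreCoapp

namespace SerreCoapp
open Limits
noncomputable section

/-! ### Serre-type duality on a class of objects. -/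

section Duality

variable (k : Type*) [Field k] {C : Type*} [Category* C] [Preadditive C] [Linear k C]

/-- Isomorphisms `Hom(M, F P) ≅ Hom(P, M)^*` for all `P` in a class `W` of objects and all `M`,
natural in both variables. -/
structure RelativeSerreDuality (F : C ⥤ C) (W : ObjectProperty C) where
  equiv (M P : C) (hP : W P) : (M ⟶ F.obj P) ≃ₗ[k] Module.Dual k (P ⟶ M)
  comp_left {M M' P : C} (hP : W P) (f : M' ⟶ M) (φ : M ⟶ F.obj P) (g : P ⟶ M') :
    equiv M' P hP (f ≫ φ) g = equiv M P hP φ (g ≫ f)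
  comp_right {M P P' : C} (hP : W P) (hP' : W P') (φ : M ⟶ F.obj P)
    (h : P ⟶ P') (g : P' ⟶ M) : equiv M P' hP' (φ ≫ F.map h) g = equiv M P hP φ (h ≫ g)

/-- Natural isomorphisms `Hom(M, F P) ≅ Hom(P, M)^*` for all projective `P` and all `M`. -/
abbrev NakayamaDuality (F : C ⥤ C) := RelativeSerreDuality k F fun P => Projective P

variable {k} in
/-- Duality makes `F` fully faithful on the given class of objects. -/
theorem RelativeSerreDuality.map_bijective {F : C ⥤ C} {W : ObjectProperty C}
    (D : RelativeSerreDuality k F W) {X Y : C} (hX : W X) (hY : W Y) [Module.Finite k (X ⟶ Y)] :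
    Function.Bijective (F.map : (X ⟶ Y) → (F.obj X ⟶ F.obj Y)) := by
  -- Both sides are the value at `f ≫ g` of the functional attached to the identity of `F.obj X`.
  have key (f : X ⟶ Y) (g : Y ⟶ F.obj X) :
      D.equiv _ _ hY (F.map f) g = D.equiv _ _ hX g f := by
    have h1 := D.comp_right hX hY (𝟙 (F.obj X)) f g
    have h2 := D.comp_left hX (f ≫ g) (𝟙 (F.obj X)) (𝟙 X)
    have h3 := D.comp_left hX f g (𝟙 X)
    simp only [Category.id_comp, Category.comp_id] at h1 h2 h3
    rw [h1, ← h2, h3]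
  -- Hom(X, Y) ≅ Hom(X, Y)^** ≅ Hom(Y, F X)^* ≅ Hom(F X, F Y); by `key` this composite is the action
  -- of `F`.
  let e := ((Module.evalEquiv k (X ⟶ Y)).trans (D.equiv Y X hX).dualMap).trans
    (D.equiv (F.obj X) Y hY).symm
  have he (f) : e f = F.map f := by
    apply (D.equiv (F.obj X) Y hY).injective
    ext g
    simp [e, key]
  convert e.bijective using 1
  funext f
  exact (he f).symm

end Duality

/-! ### The alternating pairing of chain maps R ⟶ F P and P ⟶ R. -/

section Complexes

variable {k : Type*} [Field k] {C : Type*} [Category* C] [Abelian C] [Linear k C]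

/-- The morphism homotopic to zero attached to a family of morphisms of degree `-1`. -/
def nullMap {P R : CochainComplex C ℤ} (h : ∀ i : ℤ, P.X (i + 1) ⟶ R.X i) : P ⟶ R :=
  Homotopy.nullHomotopicMap' (c := ComplexShape.up ℤ) fun p q hpq =>
    eqToHom (congrArg P.X (show p = q + 1 from hpq.symm)) ≫ h q

theorem nullMap_f {P R : CochainComplex C ℤ} (h : ∀ i : ℤ, P.X (i + 1) ⟶ R.X i) (j : ℤ) :
    (nullMap h).f (j + 1) = P.d (j + 1) (j + 1 + 1) ≫ h (j + 1) + h j ≫ R.d j (j + 1) := by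
  rw [nullMap, Homotopy.nullHomotopicMap'_f (show (ComplexShape.up ℤ).Rel j (j + 1) from rfl)
    (show (ComplexShape.up ℤ).Rel (j + 1) (j + 1 + 1) from rfl)]
  simp

/-- The map `nullMap h` is homotopic to zero. -/
def nullMapHomotopy {P R : CochainComplex C ℤ} (h : ∀ i : ℤ, P.X (i + 1) ⟶ R.X i) :
    Homotopy (nullMap h) 0 :=
  Homotopy.nullHomotopy' _

theorem hom_ext_succ {P R : CochainComplex C ℤ} {f g : P ⟶ R}
    (h : ∀ j, f.f (j + 1) = g.f (j + 1)) : f = g := by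
  ext i
  obtain ⟨j, rfl⟩ : ∃ j, i = j + 1 := ⟨i - 1, by simp⟩
  exact h j

theorem eq_nullMap {P R : CochainComplex C ℤ} {f : P ⟶ R} (H : Homotopy f 0) :
    f = nullMap fun i => H.hom (i + 1) i := by
  refine hom_ext_succ fun j => ?_
  rw [nullMap_f, H.comm, dNext_eq _ (show (ComplexShape.up ℤ).Rel (j + 1) (j + 1 + 1) from rfl),
    prevD_eq _ (show (ComplexShape.up ℤ).Rel j (j + 1) from rfl)]
  simp

/-- The sign `(-1) ^ i`. -/
def sgn (k : Type*) [Field k] (i : ℤ) : k := ((i.negOnePow : ℤ) : k)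

theorem sgn_succ (i : ℤ) : sgn k (i + 1) = - sgn k i := by
  simp [sgn, Int.negOnePow_succ]

theorem sgn_mul_self (i : ℤ) : sgn k i * sgn k i = 1 := by
  rw [sgn, ← Int.cast_mul, ← Units.val_mul, ← Int.negOnePow_add, ← two_mul,
    Int.negOnePow_two_mul]
  simp

variable {F : C ⥤ C} (D : NakayamaDuality k F)
variable {P R : CochainComplex C ℤ} (hP : ∀ i, Projective (P.X i))

/-- A bounded complex vanishes outside of a finite set. -/
theorem exists_finset_isZero (hb : boundedComplex C P) :
    ∃ s : Finset ℤ, ∀ i ∉ s, IsZero (P.X i) := by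
  obtain ⟨a, b, _, _⟩ := hb
  refine ⟨Finset.Icc a b, fun i hi => ?_⟩
  rw [Finset.mem_Icc, not_and_or, not_le, not_le] at hi
  rcases hi with hi | hi
  · exact P.isZero_of_isStrictlyGE a i hi
  · exact P.isZero_of_isStrictlyLE b i hi

/-- The alternating pairing between families of morphisms `R ⟶ F P` and `P ⟶ R`. -/
def pairing (φ : ∀ i, R.X i ⟶ F.obj (P.X i)) (g : ∀ i, P.X i ⟶ R.X i) : k :=
  ∑ᶠ i, sgn k i * D.equiv _ _ (hP i) (φ i) (g i)

theorem pairing_eq_sum (φ : ∀ i, R.X i ⟶ F.obj (P.X i)) (g : ∀ i, P.X i ⟶ R.X i)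
    (s : Finset ℤ) (hs : ∀ i ∉ s, IsZero (P.X i)) :
    pairing D hP φ g = ∑ i ∈ s, sgn k i * D.equiv _ _ (hP i) (φ i) (g i) := by
  refine finsum_eq_sum_of_support_subset _ fun i hi => ?_
  by_contra h
  rw [Function.mem_support, (hs i h).eq_of_src (g i) 0, map_zero, mul_zero] at hi
  exact hi rfl

/-- A telescoping sum. It is used to show that the pairing vanishes on null-homotopic maps. -/
theorem finsum_sub_shift {v : ℤ → k} (s : Finset ℤ) (hv : ∀ i ∉ s, v i = 0) :
    ∑ᶠ i, (v i - v (i - 1)) = 0 := by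
  have h1 : v.support.Finite := s.finite_toSet.subset fun i hi => by
    by_contra h
    exact hi (hv i h)
  have h2 : (fun i => v (i - 1)) = v ∘ (Equiv.subRight (1 : ℤ)) := rfl
  rw [finsum_sub_distrib h1, h2]
  · change _ - ∑ᶠ i, v (Equiv.subRight (1 : ℤ) i) = 0
    rw [finsum_comp_equiv (Equiv.subRight (1 : ℤ)) (f := v), sub_self]
  · rw [h2]
    exact h1.preimage (Equiv.subRight (1 : ℤ)).injective.injOn

/-- The alternating pairing as a bilinear map, for `P` supported in a finite set. -/
def pairingLinear (s : Finset ℤ) : (∀ i, R.X i ⟶ F.obj (P.X i)) →ₗ[k]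
    Module.Dual k (∀ i, P.X i ⟶ R.X i) :=
  ∑ i ∈ s, sgn k i • (LinearMap.proj (R := k) (φ := fun i => P.X i ⟶ R.X i) i).dualMap ∘ₗ
    (D.equiv _ _ (hP i)).toLinearMap ∘ₗ LinearMap.proj i

theorem pairingLinear_apply (s : Finset ℤ) (hs : ∀ i ∉ s, IsZero (P.X i))
    (φ : ∀ i, R.X i ⟶ F.obj (P.X i)) (g : ∀ i, P.X i ⟶ R.X i) :
    pairingLinear D hP s φ g = pairing D hP φ g := by
  rw [pairing_eq_sum D hP φ g s hs]
  simp [pairingLinear, LinearMap.sum_apply]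

variable (P R) in
/-- The failure of a family of morphisms to be a morphism of complexes. -/
def commDefect : (∀ i, P.X i ⟶ R.X i) →ₗ[k] (∀ i, P.X i ⟶ R.X (i + 1)) where
  toFun g i := g i ≫ R.d i (i + 1) - P.d i (i + 1) ≫ g (i + 1)
  map_add' g g' := by
    funext i
    simp only [Pi.add_apply, Preadditive.add_comp, Preadditive.comp_add]
    abel
  map_smul' c g := by
    funext i
    simp [smul_sub]

/-- A family of morphisms without defect is a morphism of complexes. -/
def homOfCommDefect {P R : CochainComplex C ℤ} (g : ∀ i, P.X i ⟶ R.X i)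
    (hg : ∀ i, g i ≫ R.d i (i + 1) = P.d i (i + 1) ≫ g (i + 1)) : P ⟶ R where
  f := g
  comm' := by
    rintro i j rfl
    exact hg i

theorem commDefect_single [DecidableEq ℤ] (j : ℤ) (x : P.X (j + 1) ⟶ R.X (j + 1)) :
    commDefect (k := k) P R (Pi.single (j + 1) x) =
      Pi.single (M := fun i => P.X i ⟶ R.X (i + 1)) (j + 1) (x ≫ R.d (j + 1) (j + 1 + 1)) -
        Pi.single (M := fun i => P.X i ⟶ R.X (i + 1)) j (P.d j (j + 1) ≫ x) := by
  funext i
  by_cases h1 : i = j + 1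
  · subst h1
    simp [commDefect]
  · by_cases h2 : i = j
    · subst h2
      simp [commDefect]
    · simp [commDefect, Pi.single_eq_of_ne h1, Pi.single_eq_of_ne h2,
        Pi.single_eq_of_ne (show i + 1 ≠ j + 1 by lia)]

theorem nullMap_single [DecidableEq ℤ] (j : ℤ) (x : P.X (j + 1) ⟶ R.X j) :
    (nullMap (Pi.single j x : ∀ i, P.X (i + 1) ⟶ R.X i)).f =
      Pi.single (M := fun i => P.X i ⟶ R.X i) (j + 1) (x ≫ R.d j (j + 1)) +
        Pi.single (M := fun i => P.X i ⟶ R.X i) j (P.d j (j + 1) ≫ x) := by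
  funext i
  obtain ⟨i, rfl⟩ : ∃ i', i = i' + 1 := ⟨i - 1, by simp⟩
  rw [nullMap_f]
  by_cases h1 : i = j
  · subst h1
    simp
  · by_cases h2 : i + 1 = j
    · subst h2
      simp
    · simp [Pi.single_eq_of_ne h1, Pi.single_eq_of_ne h2,
        Pi.single_eq_of_ne (show i + 1 ≠ j + 1 by lia)]

theorem pairing_single [DecidableEq ℤ] (φ : ∀ i, R.X i ⟶ F.obj (P.X i)) (i : ℤ)
    (x : P.X i ⟶ R.X i) :
    pairing D hP φ (Pi.single i x) = sgn k i * D.equiv _ _ (hP i) (φ i) x := by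
  rw [pairing, finsum_eq_single _ i]
  · simp
  · intro j hj
    simp [Pi.single_eq_of_ne hj]

variable [F.Additive]

/-- The components of a morphism into the complex `F P`. -/
def components (φ : R ⟶ (F.mapHomologicalComplex (ComplexShape.up ℤ)).obj P) (i : ℤ) :
    R.X i ⟶ F.obj (P.X i) := φ.f i

theorem components_comm (φ : R ⟶ (F.mapHomologicalComplex (ComplexShape.up ℤ)).obj P) (j : ℤ) :
    components φ j ≫ F.map (P.d j (j + 1)) = R.d j (j + 1) ≫ components φ (j + 1) :=
  φ.comm j (j + 1)

/-- The null-homotopic morphism `R ⟶ F P` attached to a family of morphisms of degree `-1`. -/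
def nullMapTo (h : ∀ i, R.X (i + 1) ⟶ F.obj (P.X i)) :
    R ⟶ (F.mapHomologicalComplex (ComplexShape.up ℤ)).obj P :=
  nullMap (R := (F.mapHomologicalComplex _).obj P) h

theorem components_nullMapTo (h : ∀ i, R.X (i + 1) ⟶ F.obj (P.X i)) (j : ℤ) :
    components (nullMapTo h) (j + 1) =
      R.d (j + 1) (j + 1 + 1) ≫ h (j + 1) + h j ≫ F.map (P.d j (j + 1)) :=
  nullMap_f (R := (F.mapHomologicalComplex _).obj P) h j

/-- Each summand of the pairing splits into two terms. Naturality of the duality and `g` being a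
chain map make the second, up to the alternating sign, the first one a degree lower, so the sum
telescopes. -/
theorem pairing_nullMapTo (hb : boundedComplex C P)
    (h : ∀ i, R.X (i + 1) ⟶ F.obj (P.X i)) (g : P ⟶ R) :
    pairing D hP (components (nullMapTo h)) g.f = 0 := by
  obtain ⟨s, hs⟩ := exists_finset_isZero hb
  let v (i : ℤ) : k := sgn k i * D.equiv _ _ (hP i) (h i) (g.f i ≫ R.d i (i + 1))
  refine Eq.trans (finsum_congr fun i => ?_) (finsum_sub_shift (v := v) s fun i hi => ?_)
  · obtain ⟨j, rfl⟩ : ∃ j, i = j + 1 := ⟨i - 1, by simp⟩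
    rw [add_sub_cancel_right, components_nullMapTo]
    have h1 := D.comp_left (hP (j + 1)) (R.d (j + 1) (j + 1 + 1)) (h (j + 1)) (g.f (j + 1))
    have h2 := D.comp_right (hP j) (hP (j + 1)) (h j) (P.d j (j + 1)) (g.f (j + 1))
    rw [← g.comm] at h2
    rw [map_add, LinearMap.add_apply]
    rw [h1, h2]
    simp only [v, sgn_succ]
    ring
  · simp only [v, (hs i hi).eq_of_src (g.f i) 0, zero_comp, map_zero, mul_zero]

theorem pairing_nullMap_right (hb : boundedComplex C P)
    (φ : R ⟶ (F.mapHomologicalComplex _).obj P) (h : ∀ i, P.X (i + 1) ⟶ R.X i) :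
    pairing D hP (components φ) (nullMap h).f = 0 := by
  obtain ⟨s, hs⟩ := exists_finset_isZero hb
  let v (i : ℤ) : k := sgn k i * D.equiv _ _ (hP i) (components φ i) (P.d i (i + 1) ≫ h i)
  refine Eq.trans (finsum_congr fun i => ?_) (finsum_sub_shift (v := v) s fun i hi => ?_)
  · obtain ⟨j, rfl⟩ : ∃ j, i = j + 1 := ⟨i - 1, by simp⟩
    rw [add_sub_cancel_right, nullMap_f]
    have h1 := D.comp_left (hP (j + 1)) (R.d j (j + 1)) (components φ (j + 1)) (h j)
    have h2 := D.comp_right (hP j) (hP (j + 1)) (components φ j) (P.d j (j + 1)) (h j)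
    rw [components_comm, h1] at h2
    rw [map_add, h2]
    simp only [v, sgn_succ]
    ring
  · simp only [v, (hs i hi).eq_of_src (P.d i (i + 1)) 0, zero_comp, map_zero, mul_zero]

/-- Among graded families P → R, the chain maps are the kernel of `commDefect`. A functional
vanishing on this kernel factors through `commDefect`, and the degreewise duality turns the factor
into a homotopy, up to signs. -/
theorem homotopy_of_pairing_eq_zero (hb : boundedComplex C P)
    (φ : R ⟶ (F.mapHomologicalComplex _).obj P)
    (h : ∀ g : P ⟶ R, pairing D hP (components φ) g.f = 0) : Nonempty (Homotopy φ 0) := by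
  classical
  obtain ⟨s, hs⟩ := exists_finset_isZero hb
  have h1 : pairingLinear D hP s (components φ) ∈ (LinearMap.ker (commDefect (k := k) P R)).dualAnnihilator := by
    rw [Submodule.mem_dualAnnihilator]
    intro g hg
    rw [pairingLinear_apply D hP s hs]
    exact h (homOfCommDefect g fun i => sub_eq_zero.1 (congrFun hg i))
  rw [← LinearMap.range_dualMap_eq_dualAnnihilator_ker] at h1
  obtain ⟨m, hm⟩ := h1
  -- The degree `i` part of the factor `m`, represented by a morphism through the duality.
  let H (i : ℤ) : R.X (i + 1) ⟶ F.obj (P.X i) := (D.equiv _ _ (hP i)).symm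
    (m ∘ₗ LinearMap.single k (fun i => P.X i ⟶ R.X (i + 1)) i)
  have hH (i : ℤ) (y) : D.equiv _ _ (hP i) (H i) y = m (Pi.single i y) := by
    simp [H]
  have key (j : ℤ) : sgn k (j + 1) • components φ (j + 1) =
      R.d (j + 1) (j + 1 + 1) ≫ H (j + 1) - H j ≫ F.map (P.d j (j + 1)) := by
    apply (D.equiv _ _ (hP (j + 1))).injective
    ext x
    rw [map_smul, map_sub, LinearMap.smul_apply, LinearMap.sub_apply, D.comp_left,
      D.comp_right (hP j), hH, hH, ← map_sub, ← commDefect_single (k := k), smul_eq_mul]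
    refine (pairing_single D hP (components φ) (j + 1) x).symm.trans ?_
    rw [← pairingLinear_apply D hP s hs, ← hm]
    rfl
  -- The sign `sgn k (i + 1)` and the minus turn the difference in `key` into the sum occurring in a
  -- null-homotopic map.
  have e : φ = nullMapTo fun i => sgn k (i + 1) • - H i := by
    refine hom_ext_succ fun j => ?_
    change components φ (j + 1) = components (nullMapTo _) (j + 1)
    rw [components_nullMapTo]
    have := congrArg (fun u => sgn k (j + 1) • u) (key j)
    simp only [smul_smul, sgn_mul_self, one_smul] at this
    refine this.trans ?_
    rw [sgn_succ (j + 1)]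
    simp [sub_eq_add_neg]
  exact ⟨(Homotopy.ofEq e).trans (nullMapHomotopy _)⟩

/-- Extend the functional arbitrarily to all graded families and represent it degree by degree. Its
vanishing on null-homotopic maps is exactly what makes the representing family a chain map. -/
theorem exists_pairing_eq (hb : boundedComplex C P) (l : Module.Dual k (P ⟶ R))
    (hl : ∀ h, l (nullMap h) = 0) :
    ∃ φ : R ⟶ (F.mapHomologicalComplex _).obj P, ∀ g, pairing D hP (components φ) g.f = l g := by
  classical
  obtain ⟨s, hs⟩ := exists_finset_isZero hb
  let ι : (P ⟶ R) →ₗ[k] (∀ i, P.X i ⟶ R.X i) :=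
    { toFun g := g.f
      map_add' _ _ := rfl
      map_smul' _ _ := rfl }
  have hι : Function.Injective ι := fun f g h => HomologicalComplex.Hom.ext h
  obtain ⟨l', hl'⟩ := LinearMap.dualMap_surjective_of_injective hι l
  have hl'' (g : P ⟶ R) : l' g.f = l g := LinearMap.congr_fun hl' g
  let φ (i : ℤ) : R.X i ⟶ F.obj (P.X i) := (D.equiv _ _ (hP i)).symm
    (sgn k i • l' ∘ₗ LinearMap.single k (fun i => P.X i ⟶ R.X i) i)
  have hφ (i : ℤ) (x) : D.equiv _ _ (hP i) (φ i) x = sgn k i * l' (Pi.single i x) := by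
    simp [φ]
  refine ⟨homOfCommDefect (R := (F.mapHomologicalComplex _).obj P) φ fun j => ?_, fun g => ?_⟩
  · apply (D.equiv _ _ (hP (j + 1))).injective
    ext x
    refine (D.comp_right (hP j) (hP (j + 1)) (φ j) (P.d j (j + 1)) x).trans ?_
    refine Eq.trans ?_ (D.comp_left (hP (j + 1)) (R.d j (j + 1)) (φ (j + 1)) x).symm
    rw [hφ, hφ, sgn_succ]
    -- Testing on a homotopy concentrated in one degree isolates one commuting square; the two terms
    -- carry opposite signs because `sgn` alternates.
    have := hl (Pi.single j x)
    rw [← hl'', nullMap_single, map_add] at this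
    linear_combination sgn k j * this
  · refine (pairing_eq_sum D hP φ g.f s hs).trans ?_
    have e : g.f = ∑ i ∈ s, Pi.single i (g.f i) := by
      funext j
      rw [Finset.sum_apply]
      by_cases hj : j ∈ s
      · rw [Finset.sum_eq_single_of_mem j hj (fun b _ hb => Pi.single_eq_of_ne hb.symm _)]
        simp
      · exact (hs j hj).eq_of_src _ _
    rw [← hl'', e, map_sum]
    refine Finset.sum_congr rfl fun i _ => ?_
    rw [← e, hφ, ← mul_assoc, sgn_mul_self, one_mul]

end Complexes
end
end SerreCoapp

namespace SerreCoapp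
open Limits
noncomputable section

/-! ### Duality in the bounded homotopy category. -/

section KbDuality

variable {k : Type*} [Field k] {C : Type*} [Category* C] [Abelian C] [Linear k C]

variable (k) in
/-- Passage to homotopy classes, as a linear map. -/
def Kb.homMkLinear (K L : Kb C) : (K.complex ⟶ L.complex) →ₗ[k] (K ⟶ L) where
  toFun := Kb.homMk
  map_add' _ _ := ObjectProperty.hom_ext _
    ((HomotopyCategory.quotient C (ComplexShape.up ℤ)).map_add)
  map_smul' c f := ObjectProperty.hom_ext _
    ((HomotopyCategory.quotient C (ComplexShape.up ℤ)).map_smul c f)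

theorem Kb.homMkLinear_surjective (K L : Kb C) : Function.Surjective (Kb.homMkLinear k K L) :=
  fun f => Kb.homMk_surjective f

/-- A linear choice of representatives of homotopy classes. -/
theorem Kb.exists_section (K L : Kb C) :
    ∃ σ : (K ⟶ L) →ₗ[k] (K.complex ⟶ L.complex), ∀ f, Kb.homMk (σ f) = f := by
  obtain ⟨σ, hσ⟩ := (Kb.homMkLinear k K L).exists_rightInverse_of_surjective
    (LinearMap.range_eq_top.2 (Kb.homMkLinear_surjective K L))
  exact ⟨σ, fun f => LinearMap.congr_fun hσ f⟩

instance Kb.finite_hom [∀ X Y : C, Module.Finite k (X ⟶ Y)] (K L : Kb C) :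
    Module.Finite k (K ⟶ L) := by
  obtain ⟨s, hs⟩ := exists_finset_isZero K.boundedComplex_complex
  have : Module.Finite k (K.complex ⟶ L.complex) := by
    let ι : (K.complex ⟶ L.complex) →ₗ[k] (∀ i : s, K.complex.X i ⟶ L.complex.X i) :=
      { toFun g i := g.f i
        map_add' _ _ := rfl
        map_smul' _ _ := rfl }
    refine Module.Finite.of_injective ι fun f g h => ?_
    ext i
    by_cases hi : i ∈ s
    · exact congrFun h ⟨i, hi⟩
    · exact (hs i hi).eq_of_src _ _
  exact Module.Finite.of_surjective (Kb.homMkLinear k K L) (Kb.homMkLinear_surjective K L)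

variable {F : C ⥤ C} [F.Additive] (D : NakayamaDuality k F)

/-- The morphism of `K^b(C)` given by a morphism of complexes `R ⟶ F P`. -/
def Kb.homMkTo {R P : Kb C}
    (φ : R.complex ⟶ (F.mapHomologicalComplex (ComplexShape.up ℤ)).obj P.complex) :
    R ⟶ (mapKb F).obj P :=
  Kb.homMk (L := (mapKb F).obj P) φ

theorem Kb.homMkTo_surjective {R P : Kb C} (φ : R ⟶ (mapKb F).obj P) :
    ∃ ψ, Kb.homMkTo ψ = φ :=
  Kb.homMk_surjective φ

theorem Kb.homMkTo_comp_left {R R' P : Kb C} (f : R'.complex ⟶ R.complex)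
    (φ : R.complex ⟶ (F.mapHomologicalComplex (ComplexShape.up ℤ)).obj P.complex) :
    Kb.homMkTo (f ≫ φ) = (Kb.homMk f : R' ⟶ R) ≫ Kb.homMkTo φ :=
  Kb.homMk_comp (M := (mapKb F).obj P) f φ

theorem Kb.homMkTo_comp_right {R P P' : Kb C}
    (φ : R.complex ⟶ (F.mapHomologicalComplex (ComplexShape.up ℤ)).obj P.complex)
    (h : P.complex ⟶ P'.complex) :
    (Kb.homMkTo (φ ≫ (F.mapHomologicalComplex (ComplexShape.up ℤ)).map h) :
      R ⟶ (mapKb F).obj P') = Kb.homMkTo φ ≫ (mapKb F).map (Kb.homMk h) :=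
  Kb.homMk_comp (L := (mapKb F).obj P) (M := (mapKb F).obj P') φ _

theorem Kb.homMkTo_eq_iff {R P : Kb C}
    (φ ψ : R.complex ⟶ (F.mapHomologicalComplex (ComplexShape.up ℤ)).obj P.complex) :
    (Kb.homMkTo φ : R ⟶ (mapKb F).obj P) = Kb.homMkTo ψ ↔ Nonempty (Homotopy φ ψ) :=
  Kb.homMk_eq_iff (L := (mapKb F).obj P) φ ψ

/-- The pairing only depends on homotopy classes. -/
theorem pairing_congr {R P : Kb C} (hP : P.IsProj)
    {φ φ' : R.complex ⟶ (F.mapHomologicalComplex (ComplexShape.up ℤ)).obj P.complex}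
    {g g' : P.complex ⟶ R.complex} (hφ : Kb.homMkTo φ = Kb.homMkTo φ')
    (hg : (Kb.homMk g : P ⟶ R) = Kb.homMk g') :
    pairing D hP (components φ) g.f = pairing D hP (components φ') g'.f := by
  obtain ⟨s, hs⟩ := exists_finset_isZero P.boundedComplex_complex
  obtain ⟨H⟩ := (Kb.homMkTo_eq_iff φ φ').1 hφ
  obtain ⟨H'⟩ := (Kb.homMk_eq_iff g g').1 hg
  obtain ⟨u, hu⟩ : ∃ u : ∀ i, R.complex.X (i + 1) ⟶ F.obj (P.complex.X i), φ - φ' = nullMapTo u :=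
    ⟨_, eq_nullMap (Homotopy.equivSubZero H)⟩
  obtain ⟨v, hv⟩ : ∃ v : ∀ i, P.complex.X (i + 1) ⟶ R.complex.X i, g - g' = nullMap v :=
    ⟨_, eq_nullMap (Homotopy.equivSubZero H')⟩
  have h3 := pairing_nullMapTo D hP P.boundedComplex_complex u g
  have h4 := pairing_nullMap_right D hP P.boundedComplex_complex φ' v
  have e1 : components φ = components φ' + components (nullMapTo u) :=
    congrArg components (sub_eq_iff_eq_add'.1 hu)
  have e2 : g.f = g'.f + (nullMap v).f :=
    congrArg (fun u : P.complex ⟶ R.complex => u.f) (sub_eq_iff_eq_add'.1 hv)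
  rw [← pairingLinear_apply D hP s hs] at h3 h4
  rw [← pairingLinear_apply D hP s hs, ← pairingLinear_apply D hP s hs, e1, map_add,
    LinearMap.add_apply, h3, add_zero, e2, map_add, h4, add_zero]

/-- The pairing is transported along linear sections of the passage to homotopy classes, and
`pairing_congr` removes the dependence on them. Its kernel consists of null-homotopic maps, and
every functional on homotopy classes is attained. -/
theorem exists_kbDuality {P : Kb C} (hP : P.IsProj) (R : Kb C) :
    ∃ Φ : (R ⟶ (mapKb F).obj P) ≃ₗ[k] Module.Dual k (P ⟶ R), ∀ φ g,
      Φ (Kb.homMkTo φ) (Kb.homMk g) = pairing D hP (components φ) g.f := by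
  obtain ⟨s, hs⟩ := exists_finset_isZero P.boundedComplex_complex
  obtain ⟨σ, hσ⟩ := Kb.exists_section (k := k) P R
  obtain ⟨τ, hτ⟩ := Kb.exists_section (k := k) R ((mapKb F).obj P)
  let comp : (R.complex ⟶ (F.mapHomologicalComplex (ComplexShape.up ℤ)).obj P.complex) →ₗ[k]
      ∀ i, R.complex.X i ⟶ F.obj (P.complex.X i) :=
    { toFun := components
      map_add' _ _ := rfl
      map_smul' _ _ := rfl }
  let fam : (P.complex ⟶ R.complex) →ₗ[k] ∀ i, P.complex.X i ⟶ R.complex.X i :=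
    { toFun g := g.f
      map_add' _ _ := rfl
      map_smul' _ _ := rfl }
  let Φ : (R ⟶ (mapKb F).obj P) →ₗ[k] Module.Dual k (P ⟶ R) :=
    (fam ∘ₗ σ).dualMap ∘ₗ pairingLinear D hP s ∘ₗ comp ∘ₗ τ
  have hΦ (φ g) : Φ (Kb.homMkTo φ) (Kb.homMk g) = pairing D hP (components φ) g.f :=
    (pairingLinear_apply D hP s hs _ _).trans (pairing_congr D hP (hτ _) (hσ _))
  refine ⟨LinearEquiv.ofBijective Φ ⟨?_, fun l => ?_⟩, hΦ⟩
  · rw [injective_iff_map_eq_zero]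
    intro φ hφ
    obtain ⟨φ, rfl⟩ := Kb.homMkTo_surjective φ
    obtain ⟨H⟩ := homotopy_of_pairing_eq_zero D hP P.boundedComplex_complex φ fun g => by
      rw [← hΦ]
      exact LinearMap.congr_fun hφ _
    exact ((Kb.homMkTo_eq_iff φ 0).2 ⟨H⟩).trans
      (show _ = _ from (Kb.homMkLinear k R ((mapKb F).obj P)).map_zero)
  · obtain ⟨φ, hφ⟩ := exists_pairing_eq D hP P.boundedComplex_complex
      (l ∘ₗ Kb.homMkLinear k P R) fun h => by
        have e : (Kb.homMk (nullMap h) : P ⟶ R) = Kb.homMk 0 :=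
          (Kb.homMk_eq_iff _ _).2 ⟨nullMapHomotopy h⟩
        exact (congrArg l e).trans ((l ∘ₗ Kb.homMkLinear k P R).map_zero)
    refine ⟨Kb.homMkTo φ, LinearMap.ext fun g => ?_⟩
    obtain ⟨g, rfl⟩ := Kb.homMk_surjective g
    exact (hΦ φ g).trans (show _ = _ from hφ g)

/-- The duality between `Hom(R, F P)` and `Hom(P, R)` in `K^b(C)`, for `P` consisting of
projectives. -/
def kbDuality {P : Kb C} (hP : P.IsProj) (R : Kb C) :
    (R ⟶ (mapKb F).obj P) ≃ₗ[k] Module.Dual k (P ⟶ R) :=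
  (exists_kbDuality D hP R).choose

theorem kbDuality_homMk {P : Kb C} (hP : P.IsProj) (R : Kb C) (φ) (g) :
    kbDuality D hP R (Kb.homMkTo φ) (Kb.homMk g) = pairing D hP (components φ) g.f :=
  (exists_kbDuality D hP R).choose_spec φ g

theorem kbDuality_comp_left {P : Kb C} (hP : P.IsProj) {R R' : Kb C} (f : R' ⟶ R)
    (φ : R ⟶ (mapKb F).obj P) (g : P ⟶ R') :
    kbDuality D hP R' (f ≫ φ) g = kbDuality D hP R φ (g ≫ f) := by
  obtain ⟨f, rfl⟩ := Kb.homMk_surjective f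
  obtain ⟨φ, rfl⟩ := Kb.homMkTo_surjective φ
  obtain ⟨g, rfl⟩ := Kb.homMk_surjective g
  rw [← Kb.homMkTo_comp_left, ← Kb.homMk_comp]
  refine (kbDuality_homMk D hP R' (f ≫ φ) g).trans ?_
  refine Eq.trans ?_ (kbDuality_homMk D hP R φ (g ≫ f)).symm
  exact finsum_congr fun i => congrArg _ (D.comp_left (hP i) (f.f i) (components φ i) (g.f i))

theorem kbDuality_comp_right {P P' : Kb C} (hP : P.IsProj) (hP' : P'.IsProj) {R : Kb C}
    (φ : R ⟶ (mapKb F).obj P) (h : P ⟶ P') (g : P' ⟶ R) :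
    kbDuality D hP' R (φ ≫ (mapKb F).map h) g = kbDuality D hP R φ (h ≫ g) := by
  obtain ⟨h, rfl⟩ := Kb.homMk_surjective h
  obtain ⟨φ, rfl⟩ := Kb.homMkTo_surjective φ
  obtain ⟨g, rfl⟩ := Kb.homMk_surjective g
  rw [← Kb.homMkTo_comp_right, ← Kb.homMk_comp]
  refine (kbDuality_homMk D hP' R (φ ≫ (F.mapHomologicalComplex (ComplexShape.up ℤ)).map h)
    g).trans ?_
  refine Eq.trans ?_ (kbDuality_homMk D hP R φ (h ≫ g)).symm
  exact finsum_congr fun i =>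
    congrArg _ (D.comp_right (hP i) (hP' i) (components φ i) (h.f i) (g.f i))

end KbDuality
end
end SerreCoapp

namespace SerreCoapp
open Limits
noncomputable section

/-! ### Serre duality for the derived functor. -/

section Serre

variable {k : Type*} [Field k] {C : Type*} [Category* C] [Abelian C] [Linear k C]
  [HasDerivedCategory C]

instance : (Kb.toDb C).Additive where
  map_add := ObjectProperty.hom_ext _ (DerivedCategory.Qh.map_add)

instance : (Kb.toDb C).Linear k where
  map_smul f c := ObjectProperty.hom_ext _ (DerivedCategory.Qh.map_smul c f.hom)

instance (F : C ⥤ C) [F.Additive] : (mapKb F).Additive where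
  map_add := ObjectProperty.hom_ext _ ((F.mapHomotopyCategory _).map_add)

namespace ProjRes

variable (R : ProjRes C)

instance : R.functor.Additive := R.adj.left_adjoint_additive

instance (F : C ⥤ C) [F.Additive] : (R.derived F).Additive :=
  inferInstanceAs (R.functor ⋙ mapKb F ⋙ Kb.toDb C).Additive

variable (k) in
/-- The adjunction, linearly. -/
def adjLinear (X : DerivedCategory.Bounded C) (K : Kb C) :
    (R.functor.obj X ⟶ K) ≃ₗ[k] (X ⟶ (Kb.toDb C).obj K) where
  __ := R.adj.homEquiv X K
  map_add' f g := by simp [Adjunction.homEquiv_unit]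
  map_smul' c f := by simp [Adjunction.homEquiv_unit]

instance : R.functor.Linear k where
  map_smul {X Y} f c := by
    apply (R.adjLinear k X (R.functor.obj Y)).injective
    rw [map_smul]
    simp [adjLinear, Adjunction.homEquiv_unit]

variable (k) in
/-- The projective resolution functor is fully faithful, linearly. -/
def mapLinear (X Y : DerivedCategory.Bounded C) :
    (X ⟶ Y) ≃ₗ[k] (R.functor.obj X ⟶ R.functor.obj Y) :=
  LinearEquiv.ofBijective (R.functor.mapLinearMap k)
    ⟨R.functor.map_injective, R.functor.map_surjective⟩

include R in
theorem finite_hom [∀ X Y : C, Module.Finite k (X ⟶ Y)] (X Y : DerivedCategory.Bounded C) :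
    Module.Finite k (X ⟶ Y) :=
  Module.Finite.equiv (R.mapLinear k X Y).symm

/-- Serre duality for the left derived functor of `F`. -/
def serreDuality {F : C ⥤ C} [F.Additive] (D : NakayamaDuality k F) :
    RelativeSerreDuality k (R.derived F) (⊤ : ObjectProperty (DerivedCategory.Bounded C)) where
  -- With PX, PY the resolutions: Hom(X, LF Y) ≅ Hom(PX, F PY) by adjunction, then ≅ Hom(PY, PX)^*
  -- by duality in K^b, then ≅ Hom(Y, X)^* by full faithfulness.
  equiv X Y _ := (R.adjLinear k X _).symm.trans
    ((kbDuality D (R.isProj Y) (R.functor.obj X)).trans (R.mapLinear k Y X).dualMap)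
  comp_left {X X' Y} _ f φ g := by
    have h : (R.adjLinear k X' _).symm (f ≫ φ) = R.functor.map f ≫ (R.adjLinear k X _).symm φ :=
      R.adj.homEquiv_naturality_left_symm f φ
    have h' : R.mapLinear k Y X (g ≫ f) = R.mapLinear k Y X' g ≫ R.functor.map f :=
      R.functor.map_comp g f
    refine (congrArg (fun u => kbDuality D (R.isProj Y) _ u (R.mapLinear k Y X' g)) h).trans ?_
    refine (kbDuality_comp_left D (R.isProj Y) _ _ _).trans ?_
    exact congrArg (kbDuality D (R.isProj Y) _ _) h'.symm
  comp_right {X Y Y'} _ _ φ f g := by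
    have h : (R.adjLinear k X _).symm (φ ≫ (R.derived F).map f) =
        (R.adjLinear k X _).symm φ ≫ (mapKb F).map (R.functor.map f) :=
      R.adj.homEquiv_naturality_right_symm φ _
    have h' : R.mapLinear k Y X (f ≫ g) = R.functor.map f ≫ R.mapLinear k Y' X g :=
      R.functor.map_comp f g
    refine (congrArg (fun u => kbDuality D (R.isProj Y') _ u (R.mapLinear k Y' X g)) h).trans ?_
    refine (kbDuality_comp_right D (R.isProj Y) (R.isProj Y') _ _ _).trans ?_
    exact congrArg (kbDuality D (R.isProj Y) _ _) h'.symm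

end ProjRes

end Serre

/-! ### Injectives as images of projectives, and essential surjectivity. -/

section Injectives

variable {k : Type*} [Field k] {C : Type*} [Category* C] [Abelian C] [Linear k C]

/-- Both bounds express the vanishing of Ext^i(Y, X) for i ≥ n; only the quantified variable
changes. -/
theorem hasInjectiveDimensionLT_of_forall (n : ℕ) (hn : ∀ X : C, HasProjectiveDimensionLT X n)
    (X : C) : HasInjectiveDimensionLT X n := by
  let := HasExt.standard C
  rw [hasInjectiveDimensionLT_iff]
  exact fun i hi Y e => have := hn Y; e.eq_zero_of_hasProjectiveDimensionLT n hi

variable {F : C ⥤ C} (D : NakayamaDuality k F)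

-- A monomorphism X ⟶ Y induces an injection Hom(P, X) → Hom(P, Y), whose dual is the restriction
-- map Hom(Y, F P) → Hom(X, F P); this is therefore surjective.
include D in
theorem NakayamaDuality.injective {P : C} (hP : Projective P) : Injective (F.obj P) where
  factors {X Y} g f _ := by
    have hinj : Function.Injective (Linear.rightComp k P f) := fun a b h =>
      (cancel_mono f).1 h
    obtain ⟨l, hl⟩ := LinearMap.dualMap_surjective_of_injective hinj (D.equiv X P hP g)
    refine ⟨(D.equiv Y P hP).symm l, (D.equiv X P hP).injective (LinearMap.ext fun x => ?_)⟩
    rw [D.comp_left, LinearEquiv.apply_symm_apply, ← hl]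
    rfl

include D in
/-- If every object embeds in some `F P` with `P` projective, then every injective is of this
form. -/
theorem NakayamaDuality.exists_iso_of_injective [∀ X Y : C, Module.Finite k (X ⟶ Y)]
    (hF : ∀ M : C, ∃ (P : C) (_ : Projective P) (i : M ⟶ F.obj P), Mono i)
    (I : C) (hI : Injective I) : ∃ (P : C) (_ : Projective P), Nonempty (F.obj P ≅ I) := by
  obtain ⟨P, hP, i, _⟩ := hF I
  let r := Injective.factorThru (𝟙 I) i
  have hr : i ≫ r = 𝟙 I := Injective.comp_factorThru _ _
  -- The idempotent of F P cutting out `I` lifts to an idempotent of P because `F` is fully faithful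
  -- on projectives. The summand of P that it cuts out is sent to `I`.
  obtain ⟨e, he⟩ := (D.map_bijective hP hP).2 (r ≫ i)
  have hee : e ≫ e = e := (D.map_bijective hP hP).1 (by
    rw [F.map_comp, he, Category.assoc, reassoc_of% hr])
  obtain ⟨Q, j, q, hjq, hqj⟩ := IsIdempotentComplete.idempotents_split P e hee
  have hQ : Projective Q := Retract.projective ⟨j, q, hjq⟩
  refine ⟨Q, hQ, ⟨⟨F.map j ≫ r, i ≫ F.map q, ?_, ?_⟩⟩⟩
  · have : r ≫ i = F.map q ≫ F.map j := by rw [← he, ← hqj, F.map_comp]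
    rw [Category.assoc, reassoc_of% this, ← F.map_comp, ← F.map_comp_assoc, hjq]
    simp
  · have : F.map q ≫ F.map j = r ≫ i := by rw [← he, ← hqj, F.map_comp]
    rw [Category.assoc, reassoc_of% this, hr, Category.comp_id, hr]

include D in
/-- A bounded complex of injectives is the image under `F` of a bounded complex of projectives. -/
theorem NakayamaDuality.exists_complex_iso [F.Additive] [∀ X Y : C, Module.Finite k (X ⟶ Y)]
    (hF : ∀ M : C, ∃ (P : C) (_ : Projective P) (i : M ⟶ F.obj P), Mono i)
    (I : Kb C) (hI : ∀ n, Injective (I.complex.X n)) :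
    ∃ P : Kb C, P.IsProj ∧ Nonempty ((mapKb F).obj P ≅ I) := by
  choose P hP e using fun n => D.exists_iso_of_injective hF (I.complex.X n) (hI n)
  replace e := fun n => (e n).some
  have hmap (i j : ℤ) := D.map_bijective (hP i) (hP j)
  -- Full faithfulness on projectives lifts the differentials, and faithfulness lifts their
  -- relations.
  choose d hd using fun i j => (hmap i j).2 ((e i).hom ≫ I.complex.d i j ≫ (e j).inv)
  let K : CochainComplex C ℤ :=
    { X := P
      d := d
      shape := fun i j hij => (hmap i j).1 (by rw [hd, I.complex.shape i j hij]; simp)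
      d_comp_d' := fun i j l _ _ => (hmap i l).1 (by rw [F.map_comp, hd, hd]; simp) }
  obtain ⟨a, b, _, _⟩ := I.boundedComplex_complex
  have hz (n : ℤ) (h : IsZero (I.complex.X n)) : IsZero (K.X n) := by
    rw [IsZero.iff_id_eq_zero]
    exact (hmap n n).1 ((h.of_iso (e n)).eq_of_src _ _)
  have hK : boundedComplex C K := by
    refine ⟨a, b, ?_, ?_⟩
    · rw [CochainComplex.isStrictlyGE_iff]
      exact fun i hi => hz i (I.complex.isZero_of_isStrictlyGE a i hi)
    · rw [CochainComplex.isStrictlyLE_iff]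
      exact fun i hi => hz i (I.complex.isZero_of_isStrictlyLE b i hi)
  let ε : (F.mapHomologicalComplex (ComplexShape.up ℤ)).obj K ≅ I.complex :=
    HomologicalComplex.Hom.isoOfComponents e fun i j _ => by
      change (e i).hom ≫ I.complex.d i j = F.map (d i j) ≫ (e j).hom
      rw [hd]
      simp
  exact ⟨Kb.of K hK, hP, ⟨ObjectProperty.isoMk _
    ((HomotopyCategory.quotient C (ComplexShape.up ℤ)).mapIso ε)⟩⟩

variable [HasDerivedCategory C]

/-- Bounded complexes of projectives isomorphic in `D^b(C)` are isomorphic in `K^b(C)`. -/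
theorem Kb.nonempty_iso_of_isProj {P P' : Kb C} (hP : P.IsProj) (hP' : P'.IsProj)
    (e : (Kb.toDb C).obj P ≅ (Kb.toDb C).obj P') : Nonempty (P ≅ P') := by
  obtain ⟨f, hf⟩ := (Kb.toDb_map_bijective hP P').2 e.hom
  obtain ⟨g, hg⟩ := (Kb.toDb_map_bijective hP' P).2 e.inv
  refine ⟨⟨f, g, (Kb.toDb_map_bijective hP P).1 ?_, (Kb.toDb_map_bijective hP' P').1 ?_⟩⟩
  · rw [CategoryTheory.Functor.map_comp, hf, hg, e.hom_inv_id, CategoryTheory.Functor.map_id]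
  · rw [CategoryTheory.Functor.map_comp, hf, hg, e.inv_hom_id, CategoryTheory.Functor.map_id]

-- Duality and finite-dimensional Homs give full faithfulness. Essential surjectivity follows by
-- replacing an object with a bounded complex of injectives, which is F applied to a bounded complex
-- of projectives.
include D in
theorem NakayamaDuality.isSerreFunctor_derived [F.Additive] [∀ X Y : C, Module.Finite k (X ⟶ Y)]
    [EnoughProjectives C] (n : ℕ) (hn : ∀ X : C, HasProjectiveDimensionLT X (n + 1))
    (hF : ∀ M : C, ∃ (P : C) (_ : Projective P) (i : M ⟶ F.obj P), Mono i) (R : ProjRes C) :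
    IsSerreFunctor k (R.derived F) := by
  have E := R.serreDuality D
  have hfin := R.finite_hom (k := k)
  have : EnoughInjectives C := ⟨fun M => by
    obtain ⟨P, hP, i, hi⟩ := hF M
    exact ⟨{ J := F.obj P, injective := NakayamaDuality.injective D hP, f := i, mono := hi }⟩⟩
  have h1 : (R.derived F).Faithful := ⟨fun {X Y} => (E.map_bijective (X := X) (Y := Y) ⟨⟩ ⟨⟩).1⟩
  have h2 : (R.derived F).Full := ⟨fun {X Y} => (E.map_bijective (X := X) (Y := Y) ⟨⟩ ⟨⟩).2⟩
  have h3 : (R.derived F).EssSurj := ⟨fun X => by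
    obtain ⟨I, hI, ⟨e⟩⟩ := exists_injective_iso n (hasInjectiveDimensionLT_of_forall _ hn) X
    obtain ⟨P, hP, ⟨e'⟩⟩ := NakayamaDuality.exists_complex_iso D hF I hI
    -- The derived functor uses the chosen resolution of P rather than P itself; the two are
    -- isomorphic already in K^b.
    obtain ⟨e''⟩ := Kb.nonempty_iso_of_isProj (R.isProj _) hP (R.iso ((Kb.toDb C).obj P))
    exact ⟨(Kb.toDb C).obj P, ⟨(mapKb F ⋙ Kb.toDb C).mapIso e'' ≪≫
      (Kb.toDb C).mapIso e' ≪≫ e⟩⟩⟩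
  exact {
    additive := inferInstance
    isEquivalence := { }
    duality := ⟨fun X Y => E.equiv X Y ⟨⟩, fun X X' Y f φ g => E.comp_left ⟨⟩ f φ g,
      fun X Y Y' h φ g => E.comp_right ⟨⟩ ⟨⟩ φ h g⟩ }

theorem IsSerreFunctor.of_iso {E : Type*} [Category* E] [Preadditive E] [Linear k E]
    {S T : E ⥤ E} (e : S ≅ T) (hS : IsSerreFunctor k S) : IsSerreFunctor k T := by
  have := hS.additive
  have := hS.isEquivalence
  obtain ⟨Ψ, h1, h2⟩ := hS.duality
  refine ⟨Functor.additive_of_iso e, Functor.isEquivalence_of_iso e,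
    fun X Y => (Linear.homCongr k (Iso.refl X) (e.symm.app Y)).trans (Ψ X Y), ?_, ?_⟩
  · intro X X' Y f φ g
    simpa [Linear.homCongr_apply] using h1 X X' Y f (φ ≫ e.inv.app Y) g
  · intro X Y Y' h φ g
    simpa [Linear.homCongr_apply] using h2 X Y Y' h (φ ≫ e.inv.app Y) g

include D in
/-- In an abelian category of finite global dimension, the left derived functor of a functor with
Nakayama duality is a Serre functor. -/
theorem NakayamaDuality.isLeftDerived_isSerreFunctor [F.Additive]
    [∀ X Y : C, Module.Finite k (X ⟶ Y)]
    [EnoughProjectives C] (n : ℕ) (hn : ∀ X : C, HasProjectiveDimensionLT X n)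
    (hF : ∀ M : C, ∃ (P : C) (_ : Projective P) (i : M ⟶ F.obj P), Mono i)
    {G : C ⥤ C} [G.Additive] (e : F ≅ G) :
    (∃ S, IsLeftDerived G S) ∧ ∀ S, IsLeftDerived G S → IsSerreFunctor k S := by
  have hn' (X : C) : HasProjectiveDimensionLT X (n + 1) :=
    hasProjectiveDimensionLT_of_ge X n (n + 1) (by lia)
  obtain ⟨R⟩ := nonempty_projRes n hn'
  have h := (R.isLeftDerived F).of_iso e
  refine ⟨⟨_, h⟩, fun S hS => ?_⟩
  obtain ⟨e'⟩ := h.nonempty_iso hS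
  exact (NakayamaDuality.isSerreFunctor_derived D n hn' hF R).of_iso e'

end Injectives
end
end SerreCoapp

namespace SerreCoapp

open Limits TensorProduct

noncomputable section

open scoped ModuleCat

variable {k A : Type u} [Field k] [Ring A] [Algebra k A]

/-! ### Morphisms of finite dimensional modules -/

namespace FinDimMod

/-- The underlying linear map of a morphism. -/
abbrev lin {M N : FinDimMod k A} (f : M ⟶ N) : M.obj →ₗ[A] N.obj := f.hom.hom

/-- The morphism with a given underlying linear map. -/
def homOf {M N : FinDimMod k A} (f : M.obj →ₗ[A] N.obj) : M ⟶ N :=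
  ObjectProperty.homMk (ModuleCat.ofHom f)

theorem ext {M N : FinDimMod k A} {f g : M ⟶ N} (h : ∀ x, lin f x = lin g x) : f = g :=
  ObjectProperty.hom_ext _ (ModuleCat.hom_ext (LinearMap.ext h))

theorem lin_comp {L M N : FinDimMod k A} (f : L ⟶ M) (g : M ⟶ N) (x : L.obj) :
    lin (f ≫ g) x = lin g (lin f x) := rfl

theorem lin_id (M : FinDimMod k A) (x : M.obj) : lin (𝟙 M) x = x := rfl

theorem lin_add {M N : FinDimMod k A} (f g : M ⟶ N) (x : M.obj) :
    lin (f + g) x = lin f x + lin g x := rfl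

theorem lin_smul {M N : FinDimMod k A} (c : k) (f : M ⟶ N) (x : M.obj) :
    lin (c • f) x = c • lin f x := rfl

/-- Taking underlying linear maps is `k`-linear into the `k`-linear maps. -/
def linHom (M N : FinDimMod k A) : (M ⟶ N) →ₗ[k] M.obj →ₗ[k] N.obj where
  toFun f := (lin f).restrictScalars k
  map_add' _ _ := rfl
  map_smul' _ _ := rfl

instance (M N : FinDimMod k A) : Module.Finite k (M ⟶ N) :=
  Module.Finite.of_injective (linHom M N) fun _ _ h => ext fun x => LinearMap.congr_fun h x

theorem lin_sum {M N : FinDimMod k A} {ι : Type*} (s : Finset ι) (f : ι → (M ⟶ N)) (x : M.obj) :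
    lin (∑ i ∈ s, f i) x = ∑ i ∈ s, lin (f i) x := by
  refine (LinearMap.congr_fun (map_sum (linHom M N) f s) x).trans ?_
  exact LinearMap.sum_apply _ _ _

/-- A submodule, as an object. -/
def ofSubmodule {M : FinDimMod k A} (S : Submodule A M.obj) : FinDimMod k A :=
  ⟨ModuleCat.of A S, isFinDim_of_injective (N := M.obj) k S.subtype S.subtype_injective M.property⟩

theorem mono_iff {M N : FinDimMod k A} (f : M ⟶ N) : Mono f ↔ Function.Injective (lin f) := by
  constructor
  · intro h
    let i : ofSubmodule (LinearMap.ker (lin f)) ⟶ M := homOf (LinearMap.ker (lin f)).subtype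
    have hi : i = 0 := by
      rw [← cancel_mono f, zero_comp]
      exact ext fun x => x.2
    refine (injective_iff_map_eq_zero _).2 fun x hx => ?_
    exact congrArg (fun g => lin g (⟨x, hx⟩ : LinearMap.ker (lin f))) hi
  · intro h
    have : Mono ((isFinDim k A).ι.map f) := (ModuleCat.mono_iff_injective f.hom).2 h
    exact (isFinDim k A).ι.mono_of_mono_map this

variable (k A) in
/-- The free module of rank `n`. -/
def free [Module.Finite k A] (n : ℕ) : FinDimMod k A :=
  ⟨ModuleCat.of A (Fin n → A), isFinDim_of k A (Fin n → A)⟩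

variable (k A) in
/-- The regular module. -/
def regular [Module.Finite k A] : FinDimMod k A := ⟨ModuleCat.of A A, isFinDim_of k A A⟩

theorem projective_of_module (P : FinDimMod k A) [Module.Projective A P.obj] : Projective P where
  factors {E X} g e _ := by
    obtain ⟨h, hh⟩ := Module.projective_lifting_property (lin e) (lin g) (surjective_of_epi e)
    exact ⟨homOf h, ext fun x => LinearMap.congr_fun hh x⟩

instance [Module.Finite k A] (n : ℕ) : Projective (free k A n) :=
  have : Module.Projective A (free k A n).obj := inferInstanceAs (Module.Projective A (Fin n → A))
  projective_of_module _

instance [Module.Finite k A] : Projective (regular k A) :=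
  have : Module.Projective A (regular k A).obj := inferInstanceAs (Module.Projective A A)
  projective_of_module _

/-- A dual basis of `P`. -/
structure DualBasis (P : FinDimMod k A) where
  card : ℕ
  elem : Fin card → P.obj
  coord : Fin card → (P.obj →ₗ[A] A)
  sum_smul : ∀ x, ∑ i, coord i x • elem i = x

/-- A section of a finite free cover gives the coordinates, and the images of the standard basis
vectors give the elements. -/
theorem nonempty_dualBasis [Module.Finite k A] (P : FinDimMod k A) [Projective P] :
    Nonempty (DualBasis P) := by
  obtain ⟨n, f, hf⟩ := Module.Finite.exists_fin' A P.obj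
  let π : free k A n ⟶ P := homOf f
  have : Epi π := epi_of_surjective π hf
  let s := Projective.factorThru (𝟙 P) π
  have hs : s ≫ π = 𝟙 P := Projective.factorThru_comp _ _
  refine ⟨⟨n, fun i => f (Pi.single i 1), fun i => (LinearMap.proj i).comp (lin s), fun x => ?_⟩⟩
  have hx : f (lin s x) = x := congrArg (fun g => lin g x) hs
  refine Eq.trans ?_ hx
  refine Eq.trans ?_ (congrArg f (LinearMap.sum_single_apply (φ := fun _ : Fin n => A) (lin s x)))
  rw [map_sum]
  refine Finset.sum_congr rfl fun i _ => ?_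
  rw [← map_smul]
  congr 1
  ext j
  by_cases h : i = j
  · subst h
    simp only [Pi.smul_apply, Pi.single_eq_same, smul_eq_mul, mul_one]
    rfl
  · simp [Ne.symm h]

theorem DualBasis.sum_mul {P : FinDimMod k A} (b : DualBasis P) (χ : P.obj →ₗ[A] A) (x : P.obj) :
    ∑ i, b.coord i x * χ (b.elem i) = χ x := by
  conv_rhs => rw [← b.sum_smul x, map_sum]
  simp

end FinDimMod

end

end SerreCoapp

namespace SerreCoapp

open Limits TensorProduct

noncomputable section

open scoped ModuleCat

variable {k A : Type u} [Field k] [Ring A] [Algebra k A]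

/-! ### Duality for the Nakayama functor -/

namespace NakayamaObj

variable {M N : ModuleCat.{u} A}

/-- The element `f ⊗ m` of `A^* ⊗_A M`. -/
def pure (f : Module.Dual k A) (m : M) : NakayamaObj k M :=
  Submodule.Quotient.mk ((show DualBimodule k A from f) ⊗ₜ[k] m)

theorem pure_add_left (f g : Module.Dual k A) (m : M) : pure (f + g) m = pure f m + pure g m :=
  congrArg Submodule.Quotient.mk (TensorProduct.add_tmul _ _ _)

theorem pure_add_right (f : Module.Dual k A) (m n : M) : pure f (m + n) = pure f m + pure f n :=
  congrArg Submodule.Quotient.mk (TensorProduct.tmul_add _ _ _)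

theorem pure_zero_left (m : M) : pure (0 : Module.Dual k A) m = 0 :=
  congrArg Submodule.Quotient.mk (TensorProduct.zero_tmul _ _)

theorem pure_zero_right (f : Module.Dual k A) : pure f (0 : M) = 0 :=
  congrArg Submodule.Quotient.mk (TensorProduct.tmul_zero _ _)

theorem pure_sum_right {ι : Type*} (s : Finset ι) (f : Module.Dual k A) (m : ι → M) :
    pure f (∑ i ∈ s, m i) = ∑ i ∈ s, pure f (m i) :=
  map_sum (⟨⟨fun m => pure f m, pure_zero_right f⟩, fun m n => pure_add_right f m n⟩ :
    M →+ NakayamaObj k M) m s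

theorem pure_mulLeft (f : Module.Dual k A) (a : A) (m : M) :
    pure (f ∘ₗ LinearMap.mulLeft k a) m = pure f (a • m) :=
  (Submodule.Quotient.eq _).2 (Submodule.subset_span ⟨f, a, m, rfl⟩)

theorem smul_pure (a : A) (f : Module.Dual k A) (m : M) :
    a • pure f m = pure (f ∘ₗ LinearMap.mulRight k a) m := rfl

theorem induction_on {motive : NakayamaObj k M → Prop} (t : NakayamaObj k M)
    (pure : ∀ f m, motive (pure f m)) (add : ∀ s t, motive s → motive t → motive (s + t)) :
    motive t := by
  obtain ⟨t, rfl⟩ := Submodule.Quotient.mk_surjective _ t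
  induction t with
  | zero => simpa [pure_zero_left] using pure 0 0
  | add x y hx hy => exact add _ _ hx hy
  | tmul f m => exact pure f m

/-- Maps out of `A^* ⊗_A M` from balanced bilinear maps. -/
def lift {V : Type*} [AddCommGroup V] [Module k V] (β : Module.Dual k A →ₗ[k] M →ₗ[k] V)
    (hβ : ∀ f a m, β (f ∘ₗ LinearMap.mulLeft k a) m = β f (a • m)) :
    NakayamaObj k M →ₗ[k] V :=
  ((balancing (k := k) M).restrictScalars k).liftQ
    (TensorProduct.lift (show DualBimodule k A →ₗ[k] M →ₗ[k] V from β)) (by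
    intro t ht
    -- `balancing` is an A-span while the map is only k-linear, so the induction runs on the
    -- stronger claim that every A-multiple lies in the kernel.
    suffices h : ∀ a : A, a • t ∈ LinearMap.ker
        (TensorProduct.lift (show DualBimodule k A →ₗ[k] M →ₗ[k] V from β)) by
      simpa only [one_smul] using h 1
    refine Submodule.span_induction (p := fun t _ => ∀ a : A, a • t ∈ LinearMap.ker
      (TensorProduct.lift (show DualBimodule k A →ₗ[k] M →ₗ[k] V from β))) ?_ ?_ ?_ ?_ ht
    · rintro _ ⟨f, a, m, rfl⟩ b
      rw [smul_sub, TensorProduct.smul_tmul', TensorProduct.smul_tmul', LinearMap.mem_ker, map_sub]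
      have h : (show Module.Dual k A from b • f.rightSMul a) =
          (show Module.Dual k A from b • f) ∘ₗ LinearMap.mulLeft k a :=
        LinearMap.ext fun x => congrArg (show Module.Dual k A from f) (mul_assoc a x b).symm
      refine sub_eq_zero.2 (Eq.trans ?_ (hβ (show Module.Dual k A from b • f) a m))
      exact congrArg (fun l => β l m) h
    · intro a; rw [smul_zero]; exact zero_mem _
    · intro x y _ _ hx hy a; rw [smul_add]; exact add_mem (hx a) (hy a)
    · intro b x _ hx a; rw [← mul_smul]; exact hx _)

/-- The evaluation map `A^* ⊗_A M → Hom_A(M, A)^*`, `f ⊗ m ↦ (χ ↦ f (χ m))`. -/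
def ev (M : ModuleCat.{u} A) : NakayamaObj k M →ₗ[k] Module.Dual k (M →ₗ[A] A) :=
  lift (LinearMap.mk₂ k (fun f m =>
      { toFun := fun χ => f (χ m)
        map_add' := fun _ _ => by simp
        map_smul' := fun _ _ => by simp })
      (fun _ _ _ => rfl) (fun _ _ _ => rfl)
      (fun _ _ _ => LinearMap.ext fun _ => by simp)
      (fun _ _ _ => LinearMap.ext fun _ => by simp)) (fun _ _ _ => LinearMap.ext fun _ => by simp)

/-- The right action of `A` on `Hom_A(M, A)`. -/
def mulRight (χ : M →ₗ[A] A) (a : A) : M →ₗ[A] A where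
  toFun m := χ m * a
  map_add' _ _ := by simp [add_mul]
  map_smul' _ _ := by simp [mul_assoc]

theorem ev_smul (a : A) (t : NakayamaObj k M) (χ : M →ₗ[A] A) :
    ev M (a • t) χ = ev M t (mulRight χ a) := by
  induction t using induction_on with
  | pure f m => rfl
  | add s t hs ht => rw [smul_add, map_add, map_add, LinearMap.add_apply, hs, ht]; rfl

end NakayamaObj

namespace FinDimMod

variable [Module.Finite k A]

theorem nakayama_map_pure {M N : FinDimMod k A} (g : M ⟶ N) (f : Module.Dual k A) (m : M.obj) :
    lin ((nakayama k A).map g) (NakayamaObj.pure f m) = NakayamaObj.pure f (lin g m) := rfl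

theorem nakayama_ext {M N : FinDimMod k A} {g h : (nakayama k A).obj M ⟶ N}
    (w : ∀ f m, lin g (NakayamaObj.pure f m) = lin h (NakayamaObj.pure f m)) : g = h := by
  refine ext fun t => ?_
  induction t using NakayamaObj.induction_on with
  | pure f m => exact w f m
  | add s t hs ht =>
    exact (map_add (lin g) s t).trans ((congrArg₂ (fun x y => x + y) hs ht).trans
      (map_add (lin h) s t).symm)

instance : (nakayama k A).Additive where
  map_add := nakayama_ext fun _ _ => NakayamaObj.pure_add_right _ _ _

/-- `A^* ⊗_A M → Hom_A(M, A)^*`. -/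
abbrev ev (M : FinDimMod k A) (t : ((nakayama k A).obj M).obj) (χ : M.obj →ₗ[A] A) : k :=
  NakayamaObj.ev M.obj t χ

theorem ev_smul' (M : FinDimMod k A) (c : k) (t : ((nakayama k A).obj M).obj)
    (χ : M.obj →ₗ[A] A) : ev M (c • t) χ = c * ev M t χ := by
  have h : (c • t : ((nakayama k A).obj M).obj) = (c • (show NakayamaObj k M.obj from t)) :=
    algebraMap_smul A c (show NakayamaObj k M.obj from t)
  rw [h]
  exact congrArg (fun l => l χ)
    (map_smul (NakayamaObj.ev M.obj) c (show NakayamaObj k M.obj from t))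

theorem ev_add (M : FinDimMod k A) (s t : ((nakayama k A).obj M).obj)
    (χ : M.obj →ₗ[A] A) : ev M (s + t) χ = ev M s χ + ev M t χ :=
  congrArg (fun l => l χ) (map_add (NakayamaObj.ev M.obj) s t)

theorem ev_smul (M : FinDimMod k A) (a : A) (t : ((nakayama k A).obj M).obj)
    (χ : M.obj →ₗ[A] A) : ev M (a • t) χ = ev M t (NakayamaObj.mulRight χ a) :=
  NakayamaObj.ev_smul a t χ

theorem ev_sum {ι : Type*} (s : Finset ι) (M : FinDimMod k A) (t : ((nakayama k A).obj M).obj)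
    (χ : ι → (M.obj →ₗ[A] A)) : ev M t (∑ i ∈ s, χ i) = ∑ i ∈ s, ev M t (χ i) :=
  map_sum (NakayamaObj.ev M.obj t) χ s

theorem ev_map {M N : FinDimMod k A} (h : M ⟶ N) (t : ((nakayama k A).obj M).obj)
    (χ : N.obj →ₗ[A] A) : ev N (lin ((nakayama k A).map h) t) χ = ev M t (χ ∘ₗ lin h) := by
  induction t using NakayamaObj.induction_on with
  | pure f m => rfl
  | add s t hs ht =>
    refine Eq.trans ?_ ((congrArg₂ (· + ·) hs ht).trans (ev_add M s t _).symm)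
    exact (congrArg (fun x => ev N x χ) (map_add (lin ((nakayama k A).map h)) s t)).trans
      (ev_add N _ _ _)

namespace DualBasis

variable {P : FinDimMod k A} (b : DualBasis P)

/-- The inverse of the evaluation map. -/
def evInv (l : Module.Dual k (P.obj →ₗ[A] A)) : NakayamaObj k P.obj :=
  ∑ i, NakayamaObj.pure (M := P.obj)
    { toFun := fun a => l (NakayamaObj.mulRight (b.coord i) a)
      map_add' := fun a a' => by
        rw [← map_add]
        exact congrArg l (LinearMap.ext fun x => mul_add (b.coord i x) a a')
      map_smul' := fun c a => by
        rw [RingHom.id_apply, ← map_smul]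
        exact congrArg l (LinearMap.ext fun x => mul_smul_comm c (b.coord i x) a) } (b.elem i)

theorem ev_evInv (l : Module.Dual k (P.obj →ₗ[A] A)) (χ : P.obj →ₗ[A] A) :
    ev P (b.evInv l) χ = l χ := by
  refine (congrArg (fun l => l χ) (map_sum (NakayamaObj.ev (k := k) P.obj) _ _)).trans ?_
  rw [LinearMap.sum_apply]
  have : χ = ∑ i, NakayamaObj.mulRight (b.coord i) (χ (b.elem i)) := by
    ext x
    rw [LinearMap.sum_apply]
    exact (b.sum_mul χ x).symm
  conv_rhs => rw [this, map_sum]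
  rfl

/-- On a pure tensor, the balancing relation moves the coordinates of `m` across the tensor sign,
where the dual basis reassembles `m`. -/
theorem evInv_ev (t : NakayamaObj k P.obj) : b.evInv (NakayamaObj.ev P.obj t) = t := by
  induction t using NakayamaObj.induction_on with
  | pure f m =>
    have : ∀ i, NakayamaObj.pure (k := k) (M := P.obj)
        (f ∘ₗ LinearMap.mulLeft k (b.coord i m)) (b.elem i) =
        NakayamaObj.pure f (b.coord i m • b.elem i) := fun i => NakayamaObj.pure_mulLeft _ _ _
    refine (Finset.sum_congr rfl fun i _ => this i).trans ?_
    rw [← NakayamaObj.pure_sum_right, b.sum_smul]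
  | add s t hs ht =>
    refine Eq.trans ?_ (congrArg₂ (· + ·) hs ht)
    rw [evInv, evInv, evInv, ← Finset.sum_add_distrib]
    refine Finset.sum_congr rfl fun i _ => ?_
    refine Eq.trans ?_ (NakayamaObj.pure_add_left _ _ _)
    congr 1
    ext a
    exact ev_add P s t _

include b in
theorem ev_injective {s t : ((nakayama k A).obj P).obj} (h : ∀ χ, ev P s χ = ev P t χ) : s = t :=
  (b.evInv_ev s).symm.trans ((congrArg b.evInv (LinearMap.ext h)).trans (b.evInv_ev t))

/-- The trace of a morphism `P ⟶ H P`. -/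
def tr (u : P ⟶ (nakayama k A).obj P) : k := ∑ i, ev P (lin u (b.elem i)) (b.coord i)

/-- The cyclic property of the trace: expanding either side in the two dual bases gives the same
double sum. It yields naturality of the duality in `P`. -/
theorem tr_comp_map {P' : FinDimMod k A} (b' : DualBasis P') (u : P' ⟶ (nakayama k A).obj P)
    (h : P ⟶ P') : b'.tr (u ≫ (nakayama k A).map h) = b.tr (h ≫ u) := by
  have h1 (i) : ev P' (lin (u ≫ (nakayama k A).map h) (b'.elem i)) (b'.coord i) =
      ∑ j, ev P (lin u (b'.elem i)) (NakayamaObj.mulRight (b.coord j)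
        (b'.coord i (lin h (b.elem j)))) := by
    rw [← ev_sum]
    refine (ev_map h _ _).trans (congrArg (ev P (lin u (b'.elem i))) (LinearMap.ext fun x => ?_))
    rw [LinearMap.sum_apply]
    exact (b.sum_mul (b'.coord i ∘ₗ lin h) x).symm
  have h2 (j) : ev P (lin (h ≫ u) (b.elem j)) (b.coord j) =
      ∑ i, ev P (lin u (b'.elem i)) (NakayamaObj.mulRight (b.coord j)
        (b'.coord i (lin h (b.elem j)))) := by
    rw [lin_comp]
    conv_lhs => rw [← b'.sum_smul (lin h (b.elem j)), map_sum]
    refine (congrArg (fun l => l (b.coord j)) (map_sum (NakayamaObj.ev (k := k) P.obj) _ _)).trans ?_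
    rw [LinearMap.sum_apply]
    refine Finset.sum_congr rfl fun i _ => ?_
    rw [map_smul]
    exact ev_smul P _ _ _
  rw [tr, tr, Finset.sum_congr rfl fun i _ => h1 i, Finset.sum_congr rfl fun j _ => h2 j,
    Finset.sum_comm]

/-- The pairing of `M ⟶ H P` and `P ⟶ M`. -/
def pairing (M : FinDimMod k A) : (M ⟶ (nakayama k A).obj P) →ₗ[k] Module.Dual k (P ⟶ M) :=
  LinearMap.mk₂ k (fun φ g => b.tr (g ≫ φ))
    (fun φ φ' g => by
      simp only [tr, ← Finset.sum_add_distrib]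
      exact Finset.sum_congr rfl fun i _ => ev_add P _ _ _)
    (fun c φ g => by
      simp only [tr, smul_eq_mul, Finset.mul_sum]
      exact Finset.sum_congr rfl fun i _ => ev_smul' P c _ _)
    (fun φ g g' => by
      simp only [tr, ← Finset.sum_add_distrib]
      refine Finset.sum_congr rfl fun i _ => ?_
      rw [Preadditive.add_comp]
      exact ev_add P _ _ _)
    (fun c φ g => by
      simp only [tr, smul_eq_mul, Finset.mul_sum]
      refine Finset.sum_congr rfl fun i _ => ?_
      rw [Linear.smul_comp]
      exact ev_smul' P c _ _)

theorem pairing_apply {M : FinDimMod k A} (φ : M ⟶ (nakayama k A).obj P) (g : P ⟶ M) :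
    b.pairing M φ g = b.tr (g ≫ φ) := rfl

/-- The morphism `x ↦ χ x • m`. -/
def _root_.SerreCoapp.FinDimMod.rankOne {P M : FinDimMod k A} (χ : P.obj →ₗ[A] A) (m : M.obj) :
    P ⟶ M := homOf ((LinearMap.toSpanSingleton A M.obj m) ∘ₗ χ)

/-- Testing `φ` against morphisms of rank one recovers all evaluations of its values. With
injectivity of `ev` on projectives, this makes the trace pairing nondegenerate on the side of `φ`.
-/
theorem tr_rankOne {M : FinDimMod k A} (φ : M ⟶ (nakayama k A).obj P) (χ : P.obj →ₗ[A] A)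
    (m : M.obj) : b.tr (rankOne χ m ≫ φ) = ev P (lin φ m) χ := by
  have : χ = ∑ i, NakayamaObj.mulRight (b.coord i) (χ (b.elem i)) := by
    ext x
    rw [LinearMap.sum_apply]
    exact (b.sum_mul χ x).symm
  conv_rhs => rw [this, ev_sum]
  refine Finset.sum_congr rfl fun i _ => ?_
  refine Eq.trans ?_ (ev_smul P _ _ _)
  exact congrArg (fun x => ev P x (b.coord i)) (map_smul (lin φ) _ _)

/-- Rank-one morphisms detect `φ` and span Hom(P, M). A functional `l` is therefore realised by
sending `m` to the element of H P whose evaluation at `χ` is `l (rankOne χ m)`. -/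
theorem pairing_bijective (M : FinDimMod k A) : Function.Bijective (b.pairing M) := by
  constructor
  · refine (injective_iff_map_eq_zero _).2 fun φ hφ => ext fun m => ?_
    refine b.ev_injective fun χ => ?_
    rw [← tr_rankOne, ← pairing_apply, hφ]
    exact (congrArg (fun l => l χ) (map_zero (NakayamaObj.ev (k := k) P.obj))).symm
  · intro l
    let lm (m : M.obj) : Module.Dual k (P.obj →ₗ[A] A) :=
      { toFun := fun χ => l (rankOne χ m)
        map_add' := fun χ χ' => by
          rw [← map_add]
          exact congrArg l (ext fun x => add_smul _ _ _)
        map_smul' := fun c χ => by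
          rw [RingHom.id_apply, ← map_smul]
          exact congrArg l (ext fun x => smul_assoc _ _ _) }
    let φ : M ⟶ (nakayama k A).obj P := homOf
      { toFun := fun m => b.evInv (lm m)
        map_add' := fun m m' => b.ev_injective fun χ => by
          refine (b.ev_evInv _ χ).trans (Eq.trans ?_ ((congrArg₂ (fun x y => x + y)
            (b.ev_evInv (lm m) χ) (b.ev_evInv (lm m') χ)).symm.trans (ev_add P _ _ χ).symm))
          refine Eq.trans ?_ (map_add l _ _)
          exact congrArg l (ext fun x => smul_add _ _ _)
        map_smul' := fun a m => b.ev_injective fun χ => by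
          refine (b.ev_evInv _ χ).trans (Eq.trans ?_
            ((b.ev_evInv (lm m) _).symm.trans (ev_smul P _ _ χ).symm))
          exact congrArg l (ext fun x => (mul_smul _ _ _).symm) }
    refine ⟨φ, LinearMap.ext fun g => ?_⟩
    rw [pairing_apply]
    have : g = ∑ i, rankOne (b.coord i) (lin g (b.elem i)) := ext fun x => by
      rw [lin_sum]
      conv_lhs => rw [← b.sum_smul x, map_sum]
      exact Finset.sum_congr rfl fun i _ => map_smul (lin g) _ _
    conv_rhs => rw [this, map_sum]
    exact Finset.sum_congr rfl fun i _ => b.ev_evInv _ _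

end DualBasis

variable (k A) in
/-- The natural isomorphisms `Hom(M, H P) ≅ Hom(P, M)^*` for projective `P`. -/
def nakayamaDuality : NakayamaDuality k (nakayama k A) where
  equiv M P hP := LinearEquiv.ofBijective _
    ((@nonempty_dualBasis k A _ _ _ _ P hP).some.pairing_bijective M)
  comp_left {M M' P} hP f φ g :=
    congrArg (@nonempty_dualBasis k A _ _ _ _ P hP).some.tr (Category.assoc g f φ).symm
  comp_right {M P P'} hP hP' φ h g := by
    let b := (@nonempty_dualBasis k A _ _ _ _ P hP).some
    let b' := (@nonempty_dualBasis k A _ _ _ _ P' hP').some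
    refine (congrArg b'.tr (Category.assoc g φ _).symm).trans ?_
    refine (b.tr_comp_map b' _ _).trans ?_
    exact congrArg b.tr (Category.assoc h g φ).symm

end FinDimMod

end

end SerreCoapp

namespace SerreCoapp

open Limits TensorProduct

noncomputable section

open scoped ModuleCat

variable {k A : Type u} [Field k] [Ring A] [Algebra k A]

/-! ### Exactness and embeddings -/

namespace FinDimMod

theorem exists_desc {L M N X : FinDimMod k A} {f : L ⟶ M} {g : M ⟶ N}
    (hfg : Function.Exact (lin f) (lin g)) (hg : Function.Surjective (lin g)) (h : M ⟶ X)
    (w : f ≫ h = 0) : ∃ h' : N ⟶ X, g ≫ h' = h := by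
  have hk : LinearMap.ker (lin g) ≤ LinearMap.ker (lin h) := fun x hx => by
    obtain ⟨y, rfl⟩ := (hfg x).1 hx
    exact congrArg (fun e => lin e y) w
  let e := (lin g).quotKerEquivOfSurjective hg
  refine ⟨homOf (((LinearMap.ker (lin g)).liftQ (lin h) hk) ∘ₗ e.symm.toLinearMap), ext fun x => ?_⟩
  have : e.symm (lin g x) = Submodule.Quotient.mk x := by
    rw [LinearEquiv.symm_apply_eq]
    rfl
  exact (congrArg ((LinearMap.ker (lin g)).liftQ (lin h) hk) this).trans rfl

variable [Module.Finite k A]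

theorem exists_free_surjective (M : FinDimMod k A) :
    ∃ (n : ℕ) (f : free k A n ⟶ M), Function.Surjective (lin f) := by
  obtain ⟨n, f, hf⟩ := Module.Finite.exists_fin' A M.obj
  exact ⟨n, homOf f, hf⟩

theorem exists_presentation (M : FinDimMod k A) :
    ∃ (m n : ℕ) (f : free k A m ⟶ free k A n) (g : free k A n ⟶ M),
      Function.Exact (lin f) (lin g) ∧ Function.Surjective (lin g) := by
  obtain ⟨n, g, hg⟩ := exists_free_surjective M
  obtain ⟨m, f, hf⟩ := exists_free_surjective (ofSubmodule (LinearMap.ker (lin g)))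
  refine ⟨m, n, homOf ((LinearMap.ker (lin g)).subtype ∘ₗ lin f), g, fun x => ?_, hg⟩
  constructor
  · intro hx
    obtain ⟨y, hy⟩ := hf (⟨x, hx⟩ : LinearMap.ker (lin g))
    exact ⟨y, congrArg Subtype.val hy⟩
  · rintro ⟨y, rfl⟩
    exact (show LinearMap.ker (lin g) from lin f y).2

theorem nakayama_map_surjective {M N : FinDimMod k A} {g : M ⟶ N}
    (hg : Function.Surjective (lin g)) : Function.Surjective (lin ((nakayama k A).map g)) := by
  intro t
  induction t using NakayamaObj.induction_on with
  | pure f n =>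
    obtain ⟨m, rfl⟩ := hg n
    exact ⟨_, nakayama_map_pure g f m⟩
  | add s t hs ht =>
    obtain ⟨s, rfl⟩ := hs
    obtain ⟨t, rfl⟩ := ht
    exact ⟨s + t, map_add _ s t⟩

theorem nakayama_map_exact {L M N : FinDimMod k A} {f : L ⟶ M} {g : M ⟶ N}
    (hfg : Function.Exact (lin f) (lin g)) (hg : Function.Surjective (lin g)) :
    Function.Exact (lin ((nakayama k A).map f)) (lin ((nakayama k A).map g)) := by
  intro t
  constructor
  · intro ht
    obtain ⟨t, rfl⟩ := Submodule.Quotient.mk_surjective _ t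
    have ht' : dualTensorMap g.hom t ∈ balancing (k := k) N.obj :=
      (Submodule.Quotient.mk_eq_zero _).1 ht
    -- Balancing relations over N lift to balancing relations over M because `g` is onto; right
    -- exactness of the tensor product over k then suffices.
    have hb : balancing (k := k) N.obj ≤ (balancing M.obj).map (dualTensorMap g.hom) := by
      refine Submodule.span_le.2 ?_
      rintro _ ⟨f, a, n, rfl⟩
      obtain ⟨m, rfl⟩ := hg n
      refine ⟨_, Submodule.subset_span ⟨f, a, m, rfl⟩, ?_⟩
      simp [dualTensorMap]
    obtain ⟨b, hb, hbt⟩ := hb ht'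
    have hex := lTensor_exact (DualBimodule k A) (f := (lin f).restrictScalars k)
      (g := (lin g).restrictScalars k) hfg hg
    obtain ⟨s, hs⟩ := (hex (t - b)).1 ((map_sub (dualTensorMap g.hom) t b).trans
      (sub_eq_zero.2 hbt.symm))
    refine ⟨Submodule.Quotient.mk s, ?_⟩
    refine (Submodule.Quotient.eq _).2 ?_
    have : dualTensorMap f.hom s = t - b := hs
    change dualTensorMap f.hom s - t ∈ _
    rw [this]
    simpa using hb
  · rintro ⟨s, rfl⟩
    induction s using NakayamaObj.induction_on with
    | pure e l =>
      change NakayamaObj.pure e (lin g (lin f l)) = 0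
      rw [(hfg _).2 ⟨l, rfl⟩]
      exact NakayamaObj.pure_zero_right _
    | add s t hs ht =>
      refine (congrArg (lin ((nakayama k A).map g)) (map_add (lin ((nakayama k A).map f)) s t)).trans
        ((map_add (lin ((nakayama k A).map g)) _ _).trans ?_)
      exact (congrArg₂ (fun x y => x + y) hs ht).trans (add_zero _)

/-- The inclusion of a coordinate of the free module. -/
def single {n : ℕ} (i : Fin n) : regular k A ⟶ free k A n :=
  homOf (LinearMap.single A (fun _ => A) i)

/-- The coordinates of the free module. -/
def proj {n : ℕ} (i : Fin n) : free k A n ⟶ regular k A := homOf (LinearMap.proj i)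

theorem single_proj {n : ℕ} (i j : Fin n) :
    single (k := k) (A := A) i ≫ proj j = if i = j then 𝟙 _ else 0 := by
  refine ext fun (x : A) => ?_
  change Pi.single (M := fun _ => A) i x j = _
  split_ifs with h
  · subst h
    exact Pi.single_eq_same _ _
  · exact Pi.single_eq_of_ne (Ne.symm h) _

theorem sum_proj_single (n : ℕ) : ∑ i, proj (k := k) (A := A) i ≫ single i = 𝟙 (free k A n) := by
  refine ext fun (x : Fin n → A) => ?_
  refine (lin_sum _ _ _).trans ?_
  exact LinearMap.sum_single_apply (φ := fun _ : Fin n => A) x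

/-- H(A) is a cogenerator. If `x` is killed by every M ⟶ H(A), then the morphism A ⟶ M with 1 ↦ x
pairs to zero with all of Hom(M, H(A)), so it vanishes. A basis of this Hom space gives an embedding
into H of a free module. -/
theorem exists_mono_nakayama (M : FinDimMod k A) :
    ∃ (P : FinDimMod k A) (_ : Projective P) (i : M ⟶ (nakayama k A).obj P), Mono i := by
  let b := Module.finBasis k (M ⟶ (nakayama k A).obj (regular k A))
  refine ⟨free k A _, inferInstance, ∑ i, b i ≫ (nakayama k A).map (single i), ?_⟩
  rw [mono_iff]
  refine (injective_iff_map_eq_zero _).2 fun x hx => ?_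
  have h1 (j) : lin (b j) x = 0 := by
    have h2 : (∑ i, b i ≫ (nakayama k A).map (single i)) ≫ (nakayama k A).map (proj j) = b j := by
      rw [Preadditive.sum_comp, Finset.sum_eq_single j]
      · rw [Category.assoc, ← Functor.map_comp, single_proj, if_pos rfl]
        simp
      · intro i _ hi
        rw [Category.assoc, ← Functor.map_comp, single_proj, if_neg hi]
        simp
      · simp
    rw [← h2, lin_comp, hx, map_zero]
  let g : regular k A ⟶ M := homOf (LinearMap.toSpanSingleton A M.obj x)
  have h3 (φ : M ⟶ (nakayama k A).obj (regular k A)) : g ≫ φ = 0 := by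
    have h4 : lin φ x = 0 := by
      rw [← b.sum_repr φ, lin_sum]
      refine Finset.sum_eq_zero fun i _ => ?_
      rw [lin_smul, h1, smul_zero]
    refine ext fun (a : A) => ?_
    exact (map_smul (lin φ) a x).trans ((congrArg (fun y => a • y) h4).trans (smul_zero a))
  have hg : g = 0 := by
    rw [← Module.forall_dual_apply_eq_zero_iff k]
    intro l
    have D := nakayamaDuality k A
    obtain ⟨φ, rfl⟩ := (D.equiv M (regular k A) inferInstance).surjective l
    have := D.comp_left (P := regular k A) inferInstance g φ (𝟙 _)
    rw [Category.id_comp, h3, map_zero] at this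
    exact this.symm
  refine Eq.trans ?_ (congrArg (fun e => lin e (1 : A)) hg)
  exact (one_smul A x).symm

end FinDimMod

end

end SerreCoapp

namespace SerreCoapp

open Limits TensorProduct

noncomputable section

open scoped ModuleCat

/-! ### Objects presented by a projective object -/

section Presented

variable {C : Type*} [Category* C] [Preadditive C]

/-- Morphisms out of `X` are detected by morphisms from `Q`. -/
def IsGenerated (Q X : C) : Prop :=
  ∀ ⦃N : C⦄ (h : X ⟶ N), (∀ f : Q ⟶ X, f ≫ h = 0) → h = 0

/-- `Hom(X, N)` is the group of `End Q`-linear maps `Hom(Q, X) → Hom(Q, N)`, for all `N`. -/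
structure IsPresented (Q X : C) : Prop where
  gen : IsGenerated Q X
  extend : ∀ ⦃N : C⦄ (φ : (Q ⟶ X) →+ (Q ⟶ N)),
    (∀ (b : Q ⟶ Q) (f : Q ⟶ X), φ (b ≫ f) = b ≫ φ f) → ∃ h : X ⟶ N, ∀ f, φ f = f ≫ h

variable {Q : C}

theorem IsGenerated.of_epi {X Y : C} (hX : IsGenerated Q X) (v : X ⟶ Y) [Epi v] :
    IsGenerated Q Y := fun N h w => by
  rw [← cancel_epi v, comp_zero]
  exact hX _ fun f => by rw [← Category.assoc, w]

theorem IsPresented.of_retract {X Y : C} (hX : IsPresented Q X) (i : Y ⟶ X) (r : X ⟶ Y)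
    (hir : i ≫ r = 𝟙 Y) : IsPresented Q Y where
  gen N h w := by
    have : r ≫ h = 0 := hX.gen _ fun f => by rw [← Category.assoc, w]
    rw [← Category.id_comp h, ← hir, Category.assoc, this, comp_zero]
  extend N φ hφ := by
    obtain ⟨h, hh⟩ := hX.extend (φ.comp (AddMonoidHom.mk' (fun f => f ≫ r)
      fun _ _ => Preadditive.add_comp _ _ _ _ _ _)) fun b f => by simp [hφ]
    refine ⟨i ≫ h, fun f => ?_⟩
    have := hh (f ≫ i)
    simpa [hir] using this

/-- Pull a B-linear map on Hom(Q, Z) back to Hom(Q, Y) and represent it there. The result kills `u`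
because X is generated, so it descends to Z; projectivity of Q lifts every Q ⟶ Z to Y, which shows
that the descended map works. -/
theorem IsPresented.of_cokernel [Projective Q] {X Y Z : C} (hX : IsGenerated Q X)
    (hY : IsPresented Q Y) (u : X ⟶ Y) (v : Y ⟶ Z) [Epi v] (huv : u ≫ v = 0)
    (H : ∀ ⦃N : C⦄ (h : Y ⟶ N), u ≫ h = 0 → ∃ h' : Z ⟶ N, v ≫ h' = h) : IsPresented Q Z where
  gen := hY.gen.of_epi v
  extend N φ hφ := by
    obtain ⟨h, hh⟩ := hY.extend (φ.comp (AddMonoidHom.mk' (fun f => f ≫ v)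
      fun _ _ => Preadditive.add_comp _ _ _ _ _ _)) fun b f => by simp [hφ]
    obtain ⟨h', rfl⟩ := H h (hX _ fun f => by
      have := hh (f ≫ u)
      rw [← Category.assoc, ← this]
      simp [huv])
    refine ⟨h', fun f => ?_⟩
    have := hh (Projective.factorThru f v)
    simpa using this

variable (Q) in
theorem IsPresented.self : IsPresented Q Q where
  gen N h w := by simpa using w (𝟙 Q)
  extend N φ hφ := ⟨φ (𝟙 Q), fun f => by simpa using hφ f (𝟙 Q)⟩

/-- A finite sum of presented objects is presented. -/
theorem IsPresented.of_sum {ι : Type*} [Fintype ι] {X : ι → C} (hX : ∀ i, IsPresented Q (X i))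
    {S : C} (p : ∀ i, S ⟶ X i) (s : ∀ i, X i ⟶ S) (h : ∑ i, p i ≫ s i = 𝟙 S) :
    IsPresented Q S where
  gen N g w := by
    rw [← Category.id_comp g, ← h, Preadditive.sum_comp]
    refine Finset.sum_eq_zero fun i _ => ?_
    rw [Category.assoc, (hX i).gen (s i ≫ g) fun f => by rw [← Category.assoc, w], comp_zero]
  extend N φ hφ := by
    have h1 (i : ι) := (hX i).extend (φ.comp (AddMonoidHom.mk' (fun f => f ≫ s i)
      fun _ _ => Preadditive.add_comp _ _ _ _ _ _)) fun b f => by simp [hφ]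
    choose g hg using h1
    refine ⟨∑ i, p i ≫ g i, fun f => ?_⟩
    conv_lhs => rw [← Category.comp_id f, ← h, Preadditive.comp_sum, map_sum]
    rw [Preadditive.comp_sum]
    refine Finset.sum_congr rfl fun i _ => ?_
    rw [← Category.assoc, ← Category.assoc, ← hg i]
    rfl

theorem IsPresented.biproduct [HasFiniteBiproducts C] {n : ℕ} {X : Fin n → C}
    (hX : ∀ i, IsPresented Q (X i)) : IsPresented Q (⨁ X) :=
  IsPresented.of_sum hX (biproduct.π X) (biproduct.ι X) biproduct.total

theorem IsPresented.of_iso {X Y : C} (hX : IsPresented Q X) (e : X ≅ Y) : IsPresented Q Y :=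
  hX.of_retract e.inv e.hom e.inv_hom_id

/-- A natural `End Q`-linear isomorphism `Hom(Q, F -) ≅ Hom(Q, G -)` between functors with
presented values comes from an isomorphism `F ≅ G`. -/
theorem IsPresented.nonempty_iso {D : Type*} [Category* D] {F G : D ⥤ C}
    (hF : ∀ M, IsPresented Q (F.obj M)) (hG : ∀ M, IsPresented Q (G.obj M))
    (ρ : ∀ M, (Q ⟶ F.obj M) ≃+ (Q ⟶ G.obj M))
    (hρ : ∀ (M : D) (b : Q ⟶ Q) (f : Q ⟶ F.obj M), ρ M (b ≫ f) = b ≫ ρ M f)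
    (nat : ∀ {M N : D} (g : M ⟶ N) (f : Q ⟶ F.obj M), ρ N (f ≫ F.map g) = ρ M f ≫ G.map g) :
    Nonempty (F ≅ G) := by
  have h1 (M) := (hF M).extend (ρ M : (Q ⟶ F.obj M) →+ (Q ⟶ G.obj M)) (hρ M)
  have h2 (M) := (hG M).extend ((ρ M).symm : (Q ⟶ G.obj M) →+ (Q ⟶ F.obj M)) fun b f => by
    change (ρ M).symm (b ≫ f) = b ≫ (ρ M).symm f
    rw [AddEquiv.symm_apply_eq, hρ, AddEquiv.apply_symm_apply]
  choose a ha using h1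
  choose b hb using h2
  replace ha (M f) : ρ M f = f ≫ a M := ha M f
  replace hb (M f) : (ρ M).symm f = f ≫ b M := hb M f
  refine ⟨NatIso.ofComponents (fun M => ⟨a M, b M, ?_, ?_⟩) fun {M N} g => ?_⟩
  · refine sub_eq_zero.1 ((hF M).gen _ fun f => ?_)
    rw [Preadditive.comp_sub, ← Category.assoc, ← ha, ← hb]
    simp
  · refine sub_eq_zero.1 ((hG M).gen _ fun f => ?_)
    rw [Preadditive.comp_sub, ← Category.assoc, ← hb, ← ha]
    simp
  · refine sub_eq_zero.1 ((hF M).gen _ fun f => ?_)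
    rw [Preadditive.comp_sub, ← Category.assoc, ← Category.assoc, ← ha, ← ha, nat, sub_self]

end Presented

end

end SerreCoapp

namespace SerreCoapp

open Limits TensorProduct

noncomputable section

open scoped ModuleCat

/-! ### Projective resolutions with a given beginning -/

section Resolution

variable {C : Type*} [Category* C] [Abelian C]

section

variable {X : C} (R : ProjectiveResolution X)

/-- The augmentation of a projective resolution. -/
def augmentation : R.complex.X 0 ⟶ X := R.π.f 0

@[simp]
theorem d_augmentation : R.complex.d 1 0 ≫ augmentation R = 0 := R.complex_d_comp_π_f_zero

instance : Epi (augmentation R) := inferInstanceAs (Epi (R.π.f 0))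

theorem exact_augmentation : (ShortComplex.mk _ _ (d_augmentation R)).Exact := R.exact₀

end

section

variable {X P : C} (K : ChainComplex C ℕ) (f : K.X 0 ⟶ P) (p : P ⟶ X)
  (hf : K.d 1 0 ≫ f = 0) (hfp : f ≫ p = 0)

/-- A complex extended on the right, mapping to a complex concentrated in degree `0`. -/
def augmentToSingle : ChainComplex.augment K f hf ⟶ (ChainComplex.single₀ C).obj X :=
  (ChainComplex.toSingle₀Equiv (ChainComplex.augment K f hf) X).symm ⟨p, hfp⟩

theorem augmentToSingle_f_zero : (augmentToSingle K f p hf hfp).f 0 = p :=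
  ChainComplex.toSingle₀Equiv_symm_apply_f_zero (C := ChainComplex.augment K f hf) p hfp

theorem exactAt_augment (h₁ : (ShortComplex.mk _ _ hf).Exact)
    (hK : ∀ n, (ShortComplex.mk _ _ (K.d_comp_d (n + 2) (n + 1) n)).Exact) (n : ℕ) :
    (ChainComplex.augment K f hf).ExactAt (n + 1) := by
  rw [HomologicalComplex.exactAt_iff' _ (n + 1 + 1) (n + 1) n (by simp) (by simp)]
  match n with
  | 0 => exact h₁
  | n + 1 => exact hK n

theorem quasiIso_augmentToSingle (h₀ : (ShortComplex.mk _ _ hfp).Exact) [Epi p]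
    (h₁ : (ShortComplex.mk _ _ hf).Exact)
    (hK : ∀ n, (ShortComplex.mk _ _ (K.d_comp_d (n + 2) (n + 1) n)).Exact) :
    QuasiIso (augmentToSingle K f p hf hfp) := by
  refine ⟨fun n => ?_⟩
  cases n with
  | zero =>
    rw [ChainComplex.quasiIsoAt₀_iff, ShortComplex.quasiIso_iff_of_zeros']
    · refine (ShortComplex.exact_and_epi_g_iff_of_iso ?_).2 ⟨h₀, ‹Epi p›⟩
      refine ShortComplex.isoMk (Iso.refl _) (Iso.refl _) (Iso.refl _) ?_ ?_
      · exact (Category.id_comp _).trans (Category.comp_id _).symm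
      · refine (Category.id_comp _).trans (Eq.trans ?_ (Category.comp_id _).symm)
        exact (augmentToSingle_f_zero K f p hf hfp).symm
    all_goals rfl
  | succ n =>
    rw [quasiIsoAt_iff_exactAt']
    · exact exactAt_augment K f hf h₁ hK n
    · exact ChainComplex.exactAt_succ_single_obj _ _

end

/-- A projective resolution beginning with a given epimorphism. -/
def resolutionOfEpi [EnoughProjectives C] {X P : C} [Projective P] (p : P ⟶ X) [Epi p] :
    ProjectiveResolution X :=
  let R := ProjectiveResolution.of (kernel p)
  have h₁ : R.complex.d 1 0 ≫ augmentation R ≫ kernel.ι p = 0 := by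
    rw [← Category.assoc, d_augmentation, zero_comp]
  have h₀ : (augmentation R ≫ kernel.ι p) ≫ p = 0 := by
    rw [Category.assoc, kernel.condition, comp_zero]
  { complex := ChainComplex.augment R.complex (augmentation R ≫ kernel.ι p) h₁
    π := augmentToSingle _ _ p h₁ h₀
    projective := fun n => by
      cases n with
      | zero => exact ‹Projective P›
      | succ n => exact R.projective n
    quasiIso := by
      refine quasiIso_augmentToSingle _ _ _ _ _ ?_ ?_ R.exact_succ
      · rw [ShortComplex.exact_iff_epi_kernel_lift]
        have : kernel.lift p (augmentation R ≫ kernel.ι p) h₀ = augmentation R := by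
          rw [← cancel_mono (kernel.ι p), kernel.lift_ι]
        exact (congrArg Epi this).mpr inferInstance
      · exact (ShortComplex.exact_iff_of_epi_of_isIso_of_mono
          (S₁ := ShortComplex.mk _ _ (d_augmentation R)) (S₂ := ShortComplex.mk _ _ h₁)
          { τ₁ := 𝟙 _, τ₂ := 𝟙 _, τ₃ := kernel.ι p }).1 (exact_augmentation R) }

theorem exists_opcycles_cokernel (K : ChainComplex C ℕ) {Z Y : C} (e : Z ≅ K.opcycles 0)
    (t : K.opcycles 0 ⟶ Y) : ∃ q : K.X 0 ⟶ Z, Epi q ∧ K.d 1 0 ≫ q = 0 ∧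
      (∀ ⦃N : C⦄ (h : K.X 0 ⟶ N), K.d 1 0 ≫ h = 0 → ∃ h', q ≫ h' = h) ∧
      q ≫ e.hom ≫ t = K.pOpcycles 0 ≫ t :=
  ⟨K.pOpcycles 0 ≫ e.inv, epi_comp _ _, by simp, fun N h w =>
    ⟨e.hom ≫ K.descOpcycles h 1 (by simp) w, by simp⟩, by simp⟩

/-- The zeroth left derived functor is computed as a cokernel. -/
theorem exists_leftDerivedZero_cokernel [EnoughProjectives C]
    (F : C ⥤ C) [F.Additive] {X : C} (R : ProjectiveResolution X) :
    ∃ q : F.obj (R.complex.X 0) ⟶ (F.leftDerived 0).obj X, Epi q ∧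
      F.map (R.complex.d 1 0) ≫ q = 0 ∧
      (∀ ⦃N : C⦄ (h : F.obj (R.complex.X 0) ⟶ N), F.map (R.complex.d 1 0) ≫ h = 0 →
        ∃ h', q ≫ h' = h) ∧
      q ≫ F.fromLeftDerivedZero.app X = F.map (augmentation R) := by
  obtain ⟨q, h1, h2, h3, h4⟩ := exists_opcycles_cokernel
    ((F.mapHomologicalComplex (ComplexShape.down ℕ)).obj R.complex)
    (R.isoLeftDerivedObj F 0 ≪≫ ChainComplex.isoHomologyι₀ _) (R.fromLeftDerivedZero' F)
  refine ⟨q, h1, h2, h3, ?_⟩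
  rw [R.fromLeftDerivedZero_eq F]
  refine Eq.trans ?_ (h4.trans (R.pOpcycles_comp_fromLeftDerivedZero' F))
  exact congrArg (fun t => q ≫ t) (Category.assoc _ _ _).symm

end Resolution

end

end SerreCoapp

namespace SerreCoapp

open Limits TensorProduct

noncomputable section

open scoped ModuleCat

variable {k A : Type u} [Field k] [Ring A] [Algebra k A]

/-! ### The trace and partial coapproximation -/

theorem projective_biproduct {C : Type*} [Category* C] [Preadditive C] [HasFiniteBiproducts C]
    {n : ℕ} (X : Fin n → C) [∀ i, Projective (X i)] : Projective (⨁ X) where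
  factors {E Y} f e _ := ⟨biproduct.desc fun i => Projective.factorThru (biproduct.ι X i ≫ f) e, by
    ext i
    simp⟩

namespace FinDimMod

/-- The inclusion of the trace. -/
def traceIncl (Q : FinDimMod k A) : traceFunctor Q ⟶ 𝟭 (FinDimMod k A) where
  app M := homOf (trace Q M).subtype

instance (Q M : FinDimMod k A) : Mono ((traceIncl Q).app M) :=
  (mono_iff _).2 (trace Q M).injective_subtype

theorem exists_trace_lift {Q M : FinDimMod k A} (f : Q ⟶ M) :
    ∃ f' : Q ⟶ (traceFunctor Q).obj M, f' ≫ (traceIncl Q).app M = f :=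
  ⟨homOf ((lin f).codRestrict (trace Q M) fun x => Submodule.mem_iSup_of_mem f ⟨x, rfl⟩), rfl⟩

/-- Every Q ⟶ M factors through the trace, so a kernel containing the images of all these
factorizations is the whole trace. -/
theorem isGenerated_trace (Q M : FinDimMod k A) : IsGenerated Q ((traceFunctor Q).obj M) := by
  intro N h w
  have key : trace Q M ≤ (LinearMap.ker (lin h)).map (trace Q M).subtype := by
    refine iSup_le fun f => ?_
    rintro _ ⟨x, rfl⟩
    obtain ⟨f', rfl⟩ := exists_trace_lift f
    exact ⟨lin f' x, congrArg (fun e => lin e x) (w f'), rfl⟩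
  refine ext fun (x : trace Q M) => ?_
  obtain ⟨y, hy, hyx⟩ := key x.2
  have : y = x := Subtype.ext hyx
  exact this ▸ hy

theorem isIso_traceIncl {Q X : FinDimMod k A} (hX : IsGenerated Q X) :
    IsIso ((traceIncl Q).app X) := by
  have : Epi ((traceIncl Q).app X) := Preadditive.epi_of_cancel_zero _ fun h w => hX h fun f => by
    obtain ⟨f', rfl⟩ := exists_trace_lift f
    rw [Category.assoc, w, comp_zero]
  exact isIso_of_mono_of_epi _

theorem exists_epi_of_isGenerated {Q X : FinDimMod k A} (hX : IsGenerated Q X) :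
    ∃ (n : ℕ) (p : (⨁ fun _ : Fin n => Q) ⟶ X), Epi p := by
  let b := Module.finBasis k (Q ⟶ X)
  refine ⟨_, biproduct.desc fun i => b i, Preadditive.epi_of_cancel_zero _ fun h w => hX h fun f => ?_⟩
  have hb (i) : b i ≫ h = 0 := by
    rw [← biproduct.ι_desc (fun i => b i) i, Category.assoc, w, comp_zero]
  rw [← b.sum_repr f, Preadditive.sum_comp]
  exact Finset.sum_eq_zero fun i _ => by rw [Linear.smul_comp, hb, smul_zero]

variable [Module.Finite k A]

/-- The canonical morphism from the partial coapproximation. -/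
def coappCounit (Q : FinDimMod k A) : coapp Q ⟶ 𝟭 (FinDimMod k A) :=
  (traceFunctor Q).fromLeftDerivedZero ≫ traceIncl Q

theorem exists_coapp_cokernel (Q : FinDimMod k A) {X : FinDimMod k A}
    (R : ProjectiveResolution X) :
    ∃ q : (traceFunctor Q).obj (R.complex.X 0) ⟶ (coapp Q).obj X, Epi q ∧
      (traceFunctor Q).map (R.complex.d 1 0) ≫ q = 0 ∧
      (∀ ⦃N : FinDimMod k A⦄ (h : (traceFunctor Q).obj (R.complex.X 0) ⟶ N),
        (traceFunctor Q).map (R.complex.d 1 0) ≫ h = 0 → ∃ h', q ≫ h' = h) ∧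
      q ≫ (coappCounit Q).app X = (traceIncl Q).app _ ≫ augmentation R := by
  obtain ⟨q, h1, h2, h3, h4⟩ := exists_leftDerivedZero_cokernel (traceFunctor Q) R
  refine ⟨q, h1, h2, h3, ?_⟩
  refine (Category.assoc q _ _).symm.trans ((congrArg (fun t => t ≫ (traceIncl Q).app X) h4).trans ?_)
  exact (traceIncl Q).naturality (augmentation R)

/-- `Hom(Q, -)` inverts the canonical morphism `Coapp_Q M ⟶ M`. -/
theorem coappCounit_bijective (Q : FinDimMod k A) [Projective Q] (M : FinDimMod k A) :
    Function.Bijective fun f : Q ⟶ (coapp Q).obj M => f ≫ (coappCounit Q).app M := by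
  let R := ProjectiveResolution.of M
  obtain ⟨q, h1, h2, h3, h4⟩ := exists_coapp_cokernel Q R
  constructor
  -- Lift `f` to the trace of the term P₀ of the resolution. The lift dies in M, so it comes from
  -- P₁, and being a map from Q it factors through the trace of P₁, which `q` kills.
  · have key (f : Q ⟶ (coapp Q).obj M) (hf : f ≫ (coappCounit Q).app M = 0) : f = 0 := by
      obtain ⟨f, rfl⟩ : ∃ f', f' ≫ q = f := ⟨_, Projective.factorThru_comp f q⟩
      have h5 : (f ≫ (traceIncl Q).app _) ≫ augmentation R = 0 := by
        exact (Category.assoc _ _ _).trans ((congrArg (fun t => f ≫ t) h4.symm).trans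
          ((Category.assoc _ _ _).symm.trans hf))
      let g := (exact_augmentation R).liftFromProjective _ h5
      have hg : g ≫ R.complex.d 1 0 = f ≫ (traceIncl Q).app _ :=
        (exact_augmentation R).liftFromProjective_comp _ h5
      obtain ⟨g', hg'⟩ := exists_trace_lift g
      have : f = g' ≫ (traceFunctor Q).map (R.complex.d 1 0) := by
        rw [← cancel_mono ((traceIncl Q).app _), ← hg, ← hg', Category.assoc, Category.assoc]
        exact congrArg (fun t => g' ≫ t) ((traceIncl Q).naturality (R.complex.d 1 0)).symm
      rw [this, Category.assoc, h2, comp_zero]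
    intro f g hfg
    refine sub_eq_zero.1 (key _ ?_)
    rw [Preadditive.sub_comp]
    exact sub_eq_zero.2 hfg
  · intro f
    obtain ⟨f', hf'⟩ := exists_trace_lift (Projective.factorThru f (augmentation R))
    refine ⟨f' ≫ q, ?_⟩
    change (f' ≫ q) ≫ _ = _
    rw [Category.assoc, h4, ← Category.assoc, hf']
    exact Projective.factorThru_comp _ _

theorem isGenerated_coapp (Q M : FinDimMod k A) : IsGenerated Q ((coapp Q).obj M) := by
  obtain ⟨q, h1, -⟩ := exists_coapp_cokernel Q (ProjectiveResolution.of M)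
  exact (isGenerated_trace Q _).of_epi q

/-- A generated module admits a resolution starting with some Q^n, which is its own trace. The
coapproximation is then the cokernel of a map from a generated module to Q^n. -/
theorem isPresented_coapp (Q : FinDimMod k A) [Projective Q] {M : FinDimMod k A}
    (hM : IsGenerated Q M) : IsPresented Q ((coapp Q).obj M) := by
  obtain ⟨n, p, hp⟩ := exists_epi_of_isGenerated hM
  have : Projective (⨁ fun _ : Fin n => Q) := projective_biproduct _
  let R := resolutionOfEpi p
  obtain ⟨q, h1, h2, h3, -⟩ := exists_coapp_cokernel Q R
  have hQ : IsPresented Q (⨁ fun _ : Fin n => Q) := .biproduct fun _ => .self Q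
  have := isIso_traceIncl hQ.gen
  let e : (traceFunctor Q).obj (⨁ fun _ : Fin n => Q) ≅ ⨁ fun _ : Fin n => Q :=
    asIso ((traceIncl Q).app (⨁ fun _ : Fin n => Q))
  have hR : IsPresented Q ((traceFunctor Q).obj (R.complex.X 0)) :=
    hQ.of_iso e.symm
  exact hR.of_cokernel (isGenerated_trace Q _) _ q h2 fun N h w => h3 h w

/-- `Hom(Q, -)` inverts the canonical morphism from the square of the coapproximation. -/
def coappSqEquiv (Q : FinDimMod k A) [Projective Q] (M : FinDimMod k A) :
    (Q ⟶ (coapp Q ⋙ coapp Q).obj M) ≃+ (Q ⟶ M) :=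
  AddEquiv.ofBijective (AddMonoidHom.mk'
      (fun f => (f ≫ (coappCounit Q).app ((coapp Q).obj M)) ≫ (coappCounit Q).app M)
      fun f g => by rw [Preadditive.add_comp, Preadditive.add_comp])
    ((coappCounit_bijective Q M).comp (coappCounit_bijective Q _))

theorem coappSqEquiv_comp (Q : FinDimMod k A) [Projective Q] {M : FinDimMod k A} (b : Q ⟶ Q)
    (f : Q ⟶ (coapp Q ⋙ coapp Q).obj M) :
    coappSqEquiv Q M (b ≫ f) = b ≫ coappSqEquiv Q M f := by
  change ((b ≫ f) ≫ _) ≫ _ = b ≫ (f ≫ _) ≫ _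
  simp only [Category.assoc]

theorem coappSqEquiv_naturality (Q : FinDimMod k A) [Projective Q] {M N : FinDimMod k A}
    (g : M ⟶ N) (f : Q ⟶ (coapp Q ⋙ coapp Q).obj M) :
    coappSqEquiv Q N (f ≫ (coapp Q ⋙ coapp Q).map g) = coappSqEquiv Q M f ≫ g := by
  have h1 := (coappCounit Q).naturality g
  have h2 := (coappCounit Q).naturality ((coapp Q).map g)
  change ((f ≫ (coapp Q).map ((coapp Q).map g)) ≫ _) ≫ _ = ((f ≫ _) ≫ _) ≫ g
  rw [Category.assoc f, h2, Category.assoc, Category.assoc, Category.assoc, Category.assoc]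
  exact congrArg (fun t => f ≫ (coappCounit Q).app _ ≫ t) h1

theorem isPresented_coappSq (Q : FinDimMod k A) [Projective Q] (M : FinDimMod k A) :
    IsPresented Q ((coapp Q ⋙ coapp Q).obj M) := isPresented_coapp Q (isGenerated_coapp Q M)

end FinDimMod

end

end SerreCoapp

namespace SerreCoapp

open Limits TensorProduct

noncomputable section

open scoped ModuleCat

variable {k A : Type u} [Field k] [Ring A] [Algebra k A]

/-! ### Linear duality between right and left modules -/

section Duality

open MulOpposite

/-- The dual of a right module, as a left module. -/
def OppositeDual (k A : Type u) [Field k] [Ring A] [Algebra k A] (M : ModuleCat.{u} Aᵐᵒᵖ) :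
    Type u := Module.Dual k M

namespace OppositeDual

variable (M : ModuleCat.{u} Aᵐᵒᵖ)

instance : AddCommGroup (OppositeDual k A M) := inferInstanceAs (AddCommGroup (Module.Dual k M))

instance : Module k (OppositeDual k A M) := inferInstanceAs (Module k (Module.Dual k M))

/-- The left action `(a f)(x) = f (x a)`. -/
instance : Module A (OppositeDual k A M) where
  smul a f := (show Module.Dual k M from f) ∘ₗ Algebra.lsmul k k M (op a)
  one_smul f := LinearMap.ext fun x => congrArg (show Module.Dual k M from f) (one_smul Aᵐᵒᵖ x)
  mul_smul a b f := LinearMap.ext fun x =>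
    congrArg (show Module.Dual k M from f) (mul_smul (op b) (op a) x)
  smul_zero _ := rfl
  smul_add _ _ _ := rfl
  add_smul a b f := LinearMap.ext fun x =>
    (congrArg (show Module.Dual k M from f) (add_smul (op a) (op b) x)).trans
      ((show Module.Dual k M from f).map_add _ _)
  zero_smul f := LinearMap.ext fun x =>
    (congrArg (show Module.Dual k M from f) (zero_smul Aᵐᵒᵖ x)).trans
      ((show Module.Dual k M from f).map_zero)

instance : IsScalarTower k A (OppositeDual k A M) where
  smul_assoc c a f := LinearMap.ext fun x =>
    (congrArg (show Module.Dual k M from f) (smul_assoc c (op a) x)).trans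
      ((show Module.Dual k M from f).map_smul c _)

end OppositeDual

namespace FinDimMod

/-- The dual of a finite dimensional right module. -/
def dualObj (M : FinDimMod k Aᵐᵒᵖ) : FinDimMod k A :=
  ⟨ModuleCat.of A (OppositeDual k A M.obj), @isFinDim_of k A _ _ _ (OppositeDual k A M.obj) _ _ _ _
    (inferInstanceAs (Module.Finite k (Module.Dual k M.obj)))⟩

variable {M N L : FinDimMod k Aᵐᵒᵖ}

/-- The functional underlying an element of the dual module. -/
def toDual (f : (dualObj M).obj) : Module.Dual k M.obj := f

/-- A functional as an element of the dual module. -/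
def ofDual (f : Module.Dual k M.obj) : (dualObj M).obj := f

theorem dual_ext {f g : (dualObj M).obj} (h : ∀ x, toDual f x = toDual g x) : f = g :=
  LinearMap.ext h

theorem toDual_add (f g : (dualObj M).obj) (x : M.obj) :
    toDual (f + g) x = toDual f x + toDual g x := rfl

theorem toDual_smul (a : A) (f : (dualObj M).obj) (x : M.obj) :
    toDual (a • f) x = toDual f (op a • x) := rfl

theorem toDual_smul' (c : k) (f : (dualObj M).obj) (x : M.obj) :
    toDual (c • f) x = c * toDual f x := map_smul (toDual f) c x

/-- The dual of a morphism. -/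
def dualMap (f : M ⟶ N) : dualObj N ⟶ dualObj M := homOf
  { toFun := fun l => ofDual (toDual l ∘ₗ (lin f).restrictScalars k)
    map_add' := fun _ _ => rfl
    map_smul' := fun a l => dual_ext fun x =>
      congrArg (toDual l) ((map_smul (lin f) (op a) x).symm) }

theorem dualMap_sum {ι : Type*} (s : Finset ι) (f : ι → (M ⟶ N)) :
    dualMap (∑ i ∈ s, f i) = ∑ i ∈ s, dualMap (f i) :=
  map_sum (⟨⟨dualMap, ext fun l => dual_ext fun _ => map_zero (toDual l)⟩, fun _ _ => ext fun l =>
    dual_ext fun _ => map_add (toDual l) _ _⟩ : (M ⟶ N) →+ (dualObj N ⟶ dualObj M)) f s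

theorem dualMap_surjective {f : M ⟶ N} (hf : Function.Injective (lin f)) :
    Function.Surjective (lin (dualMap f)) := fun l =>
  LinearMap.dualMap_surjective_of_injective (f := (lin f).restrictScalars k) hf (toDual l)

theorem dualMap_exact {f : L ⟶ M} {g : M ⟶ N} (h : Function.Exact (lin f) (lin g)) :
    Function.Exact (lin (dualMap g)) (lin (dualMap f)) := by
  intro l
  constructor
  · intro hl
    have : toDual l ∈ LinearMap.range ((lin g).restrictScalars k).dualMap := by
      rw [LinearMap.range_dualMap_eq_dualAnnihilator_ker, Submodule.mem_dualAnnihilator]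
      intro x hx
      obtain ⟨y, rfl⟩ := (h x).1 hx
      exact congrArg (fun l => toDual l y) hl
    exact this
  · rintro ⟨l, rfl⟩
    exact dual_ext fun x => (congrArg (toDual l) ((h _).2 ⟨x, rfl⟩)).trans (map_zero (toDual l))

theorem projective_of_dualBasis {P : FinDimMod k A} (b : DualBasis P) : Projective P where
  factors {E X} g e _ := by
    have he (i : Fin b.card) := surjective_of_epi e (lin g (b.elem i))
    choose y hy using he
    refine ⟨∑ i, rankOne (b.coord i) (y i), ext fun x => ?_⟩
    rw [lin_comp, lin_sum, map_sum]
    conv_rhs => rw [← b.sum_smul x, map_sum]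
    refine Finset.sum_congr rfl fun i _ => ?_
    rw [map_smul, ← hy]
    exact map_smul (lin e) _ _

variable [Module.Finite k A]

instance : Module.Finite k Aᵐᵒᵖ := Module.Finite.equiv (opLinearEquiv k : A ≃ₗ[k] Aᵐᵒᵖ)

/-- The dual of a projective right module is injective. -/
theorem injective_dualObj (M : FinDimMod k Aᵐᵒᵖ) [Projective M] : Injective (dualObj M) where
  factors {U V} g i _ := by
    obtain ⟨b⟩ := nonempty_dualBasis M
    have hi := (mono_iff i).1 inferInstance
    -- A map into the dual of M is determined by its values on the dual basis elements. Extend these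
    -- functionals along `i` and reassemble them as h(v)(x) = ∑ γ_j(co_j(x) v).
    let β (j) : Module.Dual k U.obj :=
      { toFun := fun u => toDual (lin g u) (b.elem j)
        map_add' := fun _ _ => by rw [map_add, toDual_add]
        map_smul' := fun c u => by
          have : lin g (c • u) = c • lin g u := map_smul (linHom _ _ g) c u
          rw [this, toDual_smul', RingHom.id_apply, smul_eq_mul] }
    have hβ (j) := LinearMap.dualMap_surjective_of_injective (f := (lin i).restrictScalars k) hi (β j)
    choose γ hγ using hβ
    have hγ' (j u) : γ j (lin i u) = toDual (lin g u) (b.elem j) := LinearMap.congr_fun (hγ j) u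
    let co (j) (x : M.obj) : A := (b.coord j x).unop
    have co_add (j x y) : co j (x + y) = co j x + co j y := congrArg unop (map_add (b.coord j) x y)
    have co_op (j a x) : co j (op a • x) = co j x * a :=
      congrArg unop (map_smul (b.coord j) (op a) x)
    have co_smul (j) (c : k) (x) : co j (c • x) = c • co j x := by
      rw [Algebra.smul_def, Algebra.commutes, ← co_op]
      rfl
    have smul_k (c : k) (a : A) (v : V.obj) : (c • a) • v = c • a • v := smul_assoc c a v
    let h : V ⟶ dualObj M := homOf
      { toFun := fun v => ofDual
          { toFun := fun x => ∑ j, γ j (co j x • v)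
            map_add' := fun x y => by simp only [co_add, add_smul, map_add, Finset.sum_add_distrib]
            map_smul' := fun c x => by
              simp only [co_smul, smul_k, map_smul, RingHom.id_apply, Finset.smul_sum] }
        map_add' := fun v w => dual_ext fun x => by
          change ∑ j, γ j (co j x • (v + w)) = ∑ j, γ j (co j x • v) + ∑ j, γ j (co j x • w)
          rw [← Finset.sum_add_distrib]
          exact Finset.sum_congr rfl fun j _ => by rw [smul_add, map_add]
        map_smul' := fun a v => dual_ext fun x => by
          change ∑ j, γ j (co j x • a • v) = ∑ j, γ j (co j (op a • x) • v)
          exact Finset.sum_congr rfl fun j _ => by rw [co_op, mul_smul] }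
    refine ⟨h, ext fun u => dual_ext fun x => ?_⟩
    refine (Finset.sum_congr rfl fun j _ => ?_ :
      _ = ∑ j, toDual (lin g u) (b.coord j x • b.elem j)).trans ?_
    · refine (congrArg (γ j) (map_smul (lin i) (co j x) u).symm).trans ((hγ' j _).trans ?_)
      rw [map_smul, toDual_smul]
      rfl
    · rw [← map_sum, b.sum_smul]

/-- The dual of an injective right module is projective. -/
theorem projective_dualObj (M : FinDimMod k Aᵐᵒᵖ) [Injective M] : Projective (dualObj M) := by
  let f := Module.finBasis k (Module.Dual k M.obj)
  let n := Module.finrank k (Module.Dual k M.obj)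
  let J : FinDimMod k Aᵐᵒᵖ := ⟨ModuleCat.of Aᵐᵒᵖ (Fin n → DualBimodule k Aᵐᵒᵖ),
    isFinDim_of k Aᵐᵒᵖ (Fin n → DualBimodule k Aᵐᵒᵖ)⟩
  let orb (x : M.obj) : Aᵐᵒᵖ →ₗ[k] M.obj := (LinearMap.toSpanSingleton Aᵐᵒᵖ M.obj x).restrictScalars k
  -- The embedding of M into copies of the dual of the algebra: x ↦ (s ↦ f_j(s x)), for a basis f_j
  -- of M^*.
  let i : M ⟶ J := homOf
    { toFun := fun x j => (f j ∘ₗ orb x : Module.Dual k Aᵐᵒᵖ)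
      map_add' := fun x y => funext fun j => LinearMap.ext fun r => by
        change f j (r • (x + y)) = f j (r • x) + f j (r • y)
        rw [smul_add, map_add]
      map_smul' := fun r x => funext fun j => LinearMap.ext fun s => by
        change f j (s • r • x) = f j ((s * r) • x)
        rw [mul_smul] }
  have hi : Mono i := by
    rw [mono_iff]
    refine (injective_iff_map_eq_zero _).2 fun x hx => ?_
    rw [← Module.forall_dual_apply_eq_zero_iff k]
    intro l
    have hf (j) : f j x = 0 := by
      have := LinearMap.congr_fun (show f j ∘ₗ orb x = 0 from congrFun hx j) 1
      exact (congrArg (f j) (one_smul Aᵐᵒᵖ x).symm).trans this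
    rw [← f.sum_repr l, LinearMap.sum_apply]
    exact Finset.sum_eq_zero fun j _ => by rw [LinearMap.smul_apply, hf, smul_zero]
  let r := Injective.factorThru (𝟙 M) i
  have hr (x) : lin r (lin i x) = x :=
    congrArg (fun g => lin g x) (Injective.comp_factorThru (𝟙 M) i)
  let s (j : Fin n) : DualBimodule k Aᵐᵒᵖ →ₗ[Aᵐᵒᵖ] M.obj :=
    lin r ∘ₗ LinearMap.single Aᵐᵒᵖ (fun _ => DualBimodule k Aᵐᵒᵖ) j
  let e := Module.evalEquiv k Aᵐᵒᵖ
  -- The components of the retraction onto M transpose, by biduality of the finite-dimensional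
  -- algebra, to maps from M^* to the algebra. These are the coordinates dual to the `f j`.
  let c (j : Fin n) (ξ : Module.Dual k M.obj) : Aᵐᵒᵖ :=
    e.symm (ξ ∘ₗ (s j).restrictScalars k)
  have hc (j ξ) (l : Module.Dual k Aᵐᵒᵖ) : l (c j ξ) = ξ (s j l) :=
    LinearMap.congr_fun (e.apply_symm_apply (ξ ∘ₗ (s j).restrictScalars k)) l
  refine projective_of_dualBasis (P := dualObj M) ⟨n, fun j => ofDual (f j), fun j =>
    { toFun := fun ξ => unop (c j (toDual ξ))
      map_add' := fun ξ η => congrArg unop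
        (show c j (toDual ξ + toDual η) = c j (toDual ξ) + c j (toDual η) from
          (congrArg e.symm (LinearMap.add_comp _ _ _)).trans (map_add e.symm _ _))
      map_smul' := fun a ξ => ?_ }, fun ξ => dual_ext fun x => ?_⟩
  · refine op_injective (e.injective (LinearMap.ext fun l => ?_))
    let l' : DualBimodule k Aᵐᵒᵖ := l
    have h1 : op a • s j l' = s j (op a • l') := (map_smul (s j) (op a) l').symm
    refine (hc j (toDual (a • ξ)) l).trans ((congrArg (toDual ξ) h1).trans ?_)
    exact (hc j (toDual ξ) (op a • l')).symm
  · have h1 (j) : toDual (unop (c j (toDual ξ)) • ofDual (f j) : (dualObj M).obj) x =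
        toDual ξ (s j (lin i x j)) := hc j (toDual ξ) (f j ∘ₗ orb x)
    have h2 : ∑ j, s j (lin i x j) = x := by
      refine Eq.trans ?_ (hr x)
      refine (map_sum (lin r) _ _).symm.trans ?_
      exact congrArg (lin r) (LinearMap.sum_single_apply (φ := fun _ : Fin n => DualBimodule k Aᵐᵒᵖ) _)
    refine (LinearMap.sum_apply _ _ _).trans ((Finset.sum_congr rfl fun j _ => h1 j).trans ?_)
    rw [← map_sum, h2]

end FinDimMod

end Duality

end

end SerreCoapp

namespace SerreCoapp

open Limits TensorProduct

noncomputable section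

open scoped ModuleCat

variable {k A : Type u} [Field k] [Ring A] [Algebra k A]

/-! ### Projective-injective modules are presented by `Q` -/

section

variable {C : Type*} [Category* C]

theorem injective_biproduct [Preadditive C] [HasFiniteBiproducts C]
    {n : ℕ} (X : Fin n → C) [∀ i, Injective (X i)] : Injective (⨁ X) where
  factors {E Y} f e _ := ⟨biproduct.lift fun i => Injective.factorThru (f ≫ biproduct.π X i) e, by
    ext i
    simp⟩

end

namespace FinDimMod

theorem finrank_lt_of_mono {M N : FinDimMod k A} (i : M ⟶ N) [Mono i] (h : ¬ Epi i) :
    Module.finrank k M.obj < Module.finrank k N.obj := by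
  have hi : Function.Injective (linHom M N i) := (mono_iff i).1 inferInstance
  refine lt_of_le_of_ne (LinearMap.finrank_le_finrank_of_injective hi) fun he => h ?_
  exact epi_of_surjective i ((LinearMap.injective_iff_surjective_of_finrank_eq_finrank he).1 hi)

theorem finrank_lt_of_iso_biprod {M Y Z : FinDimMod k A} (e : M ≅ Y ⊞ Z) (hZ : ¬ IsZero Z) :
    Module.finrank k Y.obj < Module.finrank k M.obj := by
  refine finrank_lt_of_mono (biprod.inl ≫ e.inv) fun _ => hZ ?_
  have : e.hom ≫ (biprod.snd : Y ⊞ Z ⟶ Z) = 0 := by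
    rw [← cancel_epi (biprod.inl ≫ e.inv)]
    simp
  rw [IsZero.iff_id_eq_zero, ← biprod.inr_snd (X := Y),
    ← Category.id_comp (biprod.snd : Y ⊞ Z ⟶ Z), ← e.inv_hom_id, Category.assoc, this]
  simp

theorem isPresented_of_isZero {C : Type*} [Category* C] [Preadditive C] (Q : C) {X : C}
    (hX : IsZero X) : IsPresented Q X where
  gen _ h _ := hX.eq_of_src h 0
  extend _ φ _ := ⟨0, fun f => by rw [hX.eq_of_tgt f 0, map_zero, zero_comp]⟩

variable {Q : FinDimMod k A}

theorem _root_.SerreCoapp.IsBasicProjInj.projective (hQ : IsBasicProjInj Q) : Projective Q := by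
  obtain ⟨n, N, hN, -, -, ⟨e⟩⟩ := hQ
  have (i : Fin n) : Projective (N i) := (hN i).2.1
  have := projective_biproduct N
  exact Projective.of_iso e.symm this

theorem _root_.SerreCoapp.IsBasicProjInj.injective (hQ : IsBasicProjInj Q) : Injective Q := by
  obtain ⟨n, N, hN, -, -, ⟨e⟩⟩ := hQ
  have (i : Fin n) : Injective (N i) := (hN i).2.2
  have := injective_biproduct N
  exact Injective.of_iso e.symm this

/-- Induction on dimension: an indecomposable M is a summand of Q, and a decomposable one splits
into smaller projective-injective modules. -/
theorem _root_.SerreCoapp.IsBasicProjInj.isPresented (hQ : IsBasicProjInj Q) (M : FinDimMod k A)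
    (hM : IsProjInj M) : IsPresented Q M := by
  induction h : Module.finrank k M.obj using Nat.strong_induction_on generalizing M with
  | _ n ih =>
  by_cases h0 : IsZero M
  · exact isPresented_of_isZero Q h0
  by_cases hi : Indecomposable M
  · obtain ⟨n, N, hN, -, hall, ⟨e⟩⟩ := hQ
    obtain ⟨i, ⟨e'⟩⟩ := hall M hi hM
    refine (IsPresented.self Q).of_retract (e'.hom ≫ biproduct.ι N i ≫ e.inv)
      (e.hom ≫ biproduct.π N i ≫ e'.inv) ?_
    simp
  · obtain ⟨Y, Z, e, hY, hZ⟩ : ∃ Y Z, ∃ _ : M ≅ Y ⊞ Z, ¬ IsZero Y ∧ ¬ IsZero Z := by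
      by_contra! hc
      exact hi ⟨h0, fun Y Z e => or_iff_not_imp_left.2 fun hY => by
        by_contra hZ
        exact hZ (hc Y Z e hY)⟩
    have := hM.1
    have := hM.2
    have pY : IsPresented Q Y := ih _ (h ▸ finrank_lt_of_iso_biprod e hZ) Y
      ⟨(Retract.mk (biprod.inl ≫ e.inv) (e.hom ≫ biprod.fst) (by simp)).projective,
        (Retract.mk (biprod.inl ≫ e.inv) (e.hom ≫ biprod.fst) (by simp)).injective⟩ rfl
    have pZ : IsPresented Q Z :=
      ih _ (h ▸ finrank_lt_of_iso_biprod (e ≪≫ biprod.braiding Y Z) hY) Z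
      ⟨(Retract.mk (biprod.inr ≫ e.inv) (e.hom ≫ biprod.snd) (by simp)).projective,
        (Retract.mk (biprod.inr ≫ e.inv) (e.hom ≫ biprod.snd) (by simp)).injective⟩ rfl
    refine IsPresented.of_sum (ι := Bool) (X := fun b => bif b then Y else Z)
      (by rintro (_ | _) <;> assumption)
      (fun b => match b with | true => e.hom ≫ biprod.fst | false => e.hom ≫ biprod.snd)
      (fun b => match b with | true => biprod.inl ≫ e.inv | false => biprod.inr ≫ e.inv) ?_
    rw [Fintype.sum_bool]
    have key := congrArg (fun t => e.hom ≫ t ≫ e.inv) (biprod.total (X := Y) (Y := Z))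
    simp only [Preadditive.add_comp, Preadditive.comp_add, Category.assoc, Category.id_comp,
      Iso.hom_inv_id] at key
    exact (congrArg₂ (fun x y => x + y) (Category.assoc _ _ _) (Category.assoc _ _ _)).trans key

/-! ### The values of the Nakayama functor are presented by `Q` -/

/-- The module of `n`-tuples. -/
def tuples (M : FinDimMod k A) (n : ℕ) : FinDimMod k A :=
  ⟨ModuleCat.of A (Fin n → M.obj), isFinDim_of k A (Fin n → M.obj)⟩

/-- The inclusion of a coordinate. -/
def tuplesSingle (M : FinDimMod k A) {n : ℕ} (i : Fin n) : M ⟶ tuples M n :=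
  homOf (LinearMap.single A (fun _ => M.obj) i)

/-- The projection to a coordinate. -/
def tuplesProj (M : FinDimMod k A) {n : ℕ} (i : Fin n) : tuples M n ⟶ M :=
  homOf (LinearMap.proj i)

theorem sum_tuplesProj_single (M : FinDimMod k A) (n : ℕ) :
    ∑ i, tuplesProj M i ≫ tuplesSingle M i = 𝟙 (tuples M n) := by
  refine ext fun (x : Fin n → M.obj) => ?_
  refine (lin_sum _ _ _).trans ?_
  exact LinearMap.sum_single_apply (φ := fun _ : Fin n => M.obj) x

theorem isPresented_dual_tuples {M : FinDimMod k Aᵐᵒᵖ} (hM : IsPresented Q (dualObj M)) (n : ℕ) :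
    IsPresented Q (dualObj (tuples M n)) := by
  refine IsPresented.of_sum (fun _ => hM) (fun i => dualMap (tuplesSingle M i))
    (fun i => dualMap (tuplesProj M i)) ?_
  have := congrArg dualMap (sum_tuplesProj_single M n)
  rw [dualMap_sum] at this
  exact this

/-- The linear combinations of a basis with coefficients in the endomorphism ring. -/
def basisCombination (X : FinDimMod k Aᵐᵒᵖ) :
    (Fin (Module.finrank k X.obj) → (X ⟶ X)) →ₗ[k] X.obj where
  toFun e := ∑ i, lin (e i) (Module.finBasis k X.obj i)
  map_add' e e' := by simp only [Pi.add_apply, lin_add, Finset.sum_add_distrib]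
  map_smul' c e := by simp only [Pi.smul_apply, lin_smul, Finset.smul_sum, RingHom.id_apply]

/-- The map `X^n ⟶ X^m` of right modules given by a basis of the relations over the endomorphism
ring between the elements of a basis of `X`. -/
def basisRelations (X : FinDimMod k Aᵐᵒᵖ) : tuples X (Module.finrank k X.obj) ⟶
    tuples X (Module.finrank k (LinearMap.ker (basisCombination X))) := homOf
  (LinearMap.pi fun j => ∑ i,
    lin ((Module.finBasis k (LinearMap.ker (basisCombination X)) j).1 i) ∘ₗ LinearMap.proj i)

theorem basisRelations_apply (X : FinDimMod k Aᵐᵒᵖ) (y : Fin (Module.finrank k X.obj) → X.obj) (j) :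
    lin (basisRelations X) y j =
      ∑ i, lin ((Module.finBasis k (LinearMap.ker (basisCombination X)) j).1 i) (y i) :=
  LinearMap.sum_apply _ _ _

variable [Module.Finite k A]

/-- The map `A ⟶ X^n` of right modules given by a basis of `X`. -/
def basisOrbit (X : FinDimMod k Aᵐᵒᵖ) :
    regular k Aᵐᵒᵖ ⟶ tuples X (Module.finrank k X.obj) := homOf
  (LinearMap.pi fun i => LinearMap.toSpanSingleton Aᵐᵒᵖ X.obj (Module.finBasis k X.obj i))

theorem basisOrbit_injective (X : FinDimMod k Aᵐᵒᵖ) (h : Function.Injective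
    (Module.toModuleEnd (Module.End Aᵐᵒᵖ X.obj) (S := Aᵐᵒᵖ) X.obj)) :
    Function.Injective (lin (basisOrbit X)) := by
  intro (r : Aᵐᵒᵖ) (s : Aᵐᵒᵖ) hrs
  refine h (LinearMap.ext fun x => ?_)
  change r • x = s • x
  have hrs' (i) : r • Module.finBasis k X.obj i = s • Module.finBasis k X.obj i := congrFun hrs i
  have : Algebra.lsmul k k X.obj r = Algebra.lsmul k k X.obj s :=
    (Module.finBasis k X.obj).ext hrs'
  exact LinearMap.congr_fun this x

/-- A tuple `y` satisfying every relation over End X between the basis vectors defines a k-linear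
map b_i ↦ y_i that commutes with End X. By the double centraliser property it is the action of an
element of the algebra. -/
theorem basisOrbit_exact (X : FinDimMod k Aᵐᵒᵖ) (h : Function.Surjective
    (Module.toModuleEnd (Module.End Aᵐᵒᵖ X.obj) (S := Aᵐᵒᵖ) X.obj)) :
    Function.Exact (lin (basisOrbit X)) (lin (basisRelations X)) := by
  let b := Module.finBasis k X.obj
  intro (y : Fin (Module.finrank k X.obj) → X.obj)
  constructor
  · intro hy
    have hrel (e : Fin (Module.finrank k X.obj) → (X ⟶ X)) (he : ∑ i, lin (e i) (b i) = 0) :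
        ∑ i, lin (e i) (y i) = 0 := by
      let r := Module.finBasis k (LinearMap.ker (basisCombination X))
      have h1 (j) : ∑ i, lin ((r j).1 i) (y i) = 0 :=
        (basisRelations_apply X y j).symm.trans (congrFun hy j)
      have h2 := congrArg Subtype.val (r.sum_repr ⟨e, he⟩)
      simp only [Submodule.coe_sum, Submodule.coe_smul] at h2
      rw [← h2]
      simp only [Finset.sum_apply, Pi.smul_apply, lin_sum, lin_smul]
      rw [Finset.sum_comm]
      refine Finset.sum_eq_zero fun j _ => ?_
      rw [← Finset.smul_sum, h1, smul_zero]
    let θ : X.obj →ₗ[k] X.obj := b.constr k y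
    have hθ (i) : θ (b i) = y i := b.constr_basis k y i
    have hlin (e : X ⟶ X) : θ ∘ₗ linHom X X e = linHom X X e ∘ₗ θ := by
      refine b.ext fun i => ?_
      -- The relation expressing `e` applied to b_i as a k-combination of the basis, with scalars
      -- viewed as endomorphisms.
      let f (j) : X ⟶ X := Pi.single (M := fun _ => X ⟶ X) i e j - b.repr (lin e (b i)) j • 𝟙 X
      have hf (z : Fin (Module.finrank k X.obj) → X.obj) :
          ∑ j, lin (f j) (z j) = lin e (z i) - ∑ j, b.repr (lin e (b i)) j • z j := by
        refine (Finset.sum_sub_distrib (fun j => lin (Pi.single (M := fun _ => X ⟶ X) i e j) (z j))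
          _).trans ?_
        congr 1
        rw [Finset.sum_eq_single i (fun j _ hj => by rw [Pi.single_eq_of_ne hj]; rfl) (by simp),
          Pi.single_eq_same]
      have h3 := hrel f (by rw [hf, b.sum_repr, sub_self])
      rw [hf, sub_eq_zero] at h3
      change θ (lin e (b i)) = lin e (θ (b i))
      rw [hθ, h3]
      conv_lhs => rw [← b.sum_repr (lin e (b i)), map_sum]
      exact Finset.sum_congr rfl fun j _ => by rw [map_smul, hθ]
    obtain ⟨r, hr⟩ := h
      { toFun := θ
        map_add' := map_add θ
        map_smul' := fun e x => LinearMap.congr_fun (hlin (homOf e)) x }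
    exact ⟨r, funext fun i => (LinearMap.congr_fun hr (b i)).trans (hθ i)⟩
  · rintro ⟨(r : Aᵐᵒᵖ), rfl⟩
    refine funext fun j => (basisRelations_apply X _ j).trans ?_
    have h1 := (Module.finBasis k (LinearMap.ker (basisCombination X)) j).2
    have h2 : ∑ i, lin ((Module.finBasis k (LinearMap.ker (basisCombination X)) j).1 i)
      (b i) = 0 := h1
    refine Eq.trans ?_ ((congrArg (fun x => r • x) h2).trans (smul_zero r))
    rw [Finset.smul_sum]
    exact Finset.sum_congr rfl fun i _ => map_smul (lin _) r (b i)

theorem smul_regular_op (c : k) (r : Aᵐᵒᵖ) :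
    (c • (show (regular k Aᵐᵒᵖ).obj from r)) = MulOpposite.op (c • r.unop) := by
  rw [Algebra.smul_def, Algebra.commutes]
  rfl

/-- Right multiplications. -/
def rightMulHom : (regular k Aᵐᵒᵖ).obj →ₗ[k] ((regular k A).obj →ₗ[A] A) where
  toFun (r : Aᵐᵒᵖ) := NakayamaObj.mulRight (M := ModuleCat.of A A) LinearMap.id r.unop
  map_add' (r : Aᵐᵒᵖ) (s : Aᵐᵒᵖ) := LinearMap.ext fun (x : A) => mul_add x r.unop s.unop
  map_smul' c (r : Aᵐᵒᵖ) := LinearMap.ext fun (x : A) =>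
    (congrArg (fun r : Aᵐᵒᵖ => x * r.unop) (smul_regular_op c r)).trans
      (mul_smul_comm c x r.unop)

/-- The morphism from `A^* ⊗_A A` to the dual of the right regular module. -/
def nakayamaRegularHom : (nakayama k A).obj (regular k A) ⟶ dualObj (regular k Aᵐᵒᵖ) := homOf
  { toFun := fun t => ofDual (M := regular k Aᵐᵒᵖ)
      (NakayamaObj.ev (k := k) (regular k A).obj t ∘ₗ rightMulHom)
    map_add' := fun s t => LinearMap.ext fun r => ev_add _ s t (rightMulHom r)
    map_smul' := fun a t => LinearMap.ext fun (r : Aᵐᵒᵖ) => by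
      refine (ev_smul (regular k A) a t (rightMulHom (k := k) r)).trans ?_
      exact congrArg (ev (regular k A) t) (LinearMap.ext fun (x : A) => mul_assoc x r.unop a) }

/-- A functional on the right regular module, as a functional on the algebra. -/
def regularFunctional (l : (dualObj (regular k Aᵐᵒᵖ)).obj) : Module.Dual k A where
  toFun a := toDual l (MulOpposite.op a)
  map_add' a b := map_add (toDual l) (MulOpposite.op a) (MulOpposite.op b)
  map_smul' c a := (congrArg (toDual l) (smul_regular_op c (MulOpposite.op a)).symm).trans
    (map_smul (toDual l) c _)

/-- The morphism from the dual of the right regular module to `A^* ⊗_A A`. -/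
def nakayamaRegularInv : dualObj (regular k Aᵐᵒᵖ) ⟶ (nakayama k A).obj (regular k A) := homOf
  { toFun := fun l => NakayamaObj.pure (M := (regular k A).obj) (regularFunctional l) (1 : A)
    map_add' := fun l l' => NakayamaObj.pure_add_left (M := (regular k A).obj)
      (regularFunctional l) (regularFunctional l') (1 : A)
    map_smul' := fun _ _ => rfl }

theorem nakayamaRegularInv_apply (l : (dualObj (regular k Aᵐᵒᵖ)).obj) :
    lin nakayamaRegularInv l =
      NakayamaObj.pure (M := (regular k A).obj) (regularFunctional l) (1 : A) := rfl

theorem nakayamaRegularHom_inv :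
    nakayamaRegularHom (k := k) (A := A) ≫ nakayamaRegularInv = 𝟙 _ := by
  refine nakayama_ext fun f (a : A) => ?_
  have h : regularFunctional (lin nakayamaRegularHom (NakayamaObj.pure f a)) =
      f ∘ₗ LinearMap.mulLeft k a := rfl
  refine (lin_comp _ _ _).trans ((nakayamaRegularInv_apply _).trans ?_)
  refine (congrArg (fun g => NakayamaObj.pure (M := (regular k A).obj) g (1 : A)) h).trans ?_
  refine (NakayamaObj.pure_mulLeft (M := (regular k A).obj) f a (1 : A)).trans ?_
  exact congrArg (NakayamaObj.pure (M := (regular k A).obj) f) (mul_one a)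

/-- Dualising the exact sequence 0 → A → X^n → X^m of right modules presents A^* by copies of X^*,
which is projective-injective and hence presented by Q. -/
theorem isPresented_nakayama_regular (hQ : IsBasicProjInj Q) (hdc : HasDoubleCentraliser k Aᵐᵒᵖ) :
    IsPresented Q ((nakayama k A).obj (regular k A)) := by
  obtain ⟨X, ⟨hX, hX'⟩, hinj, hsurj⟩ := hdc
  have hX : IsPresented Q (dualObj X) :=
    hQ.isPresented _ ⟨projective_dualObj X, injective_dualObj X⟩
  have := hQ.projective
  have h1 := dualMap_exact (basisOrbit_exact X hsurj)
  have h2 := dualMap_surjective (basisOrbit_injective X hinj)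
  have := epi_of_surjective _ h2
  have h3 : IsPresented Q (dualObj (regular k Aᵐᵒᵖ)) :=
    IsPresented.of_cokernel (isPresented_dual_tuples hX _).gen (isPresented_dual_tuples hX _)
      (dualMap (basisRelations X)) (dualMap (basisOrbit X))
      (ext fun l => (h1 _).2 ⟨l, rfl⟩) fun N h w => exists_desc h1 h2 h w
  exact h3.of_retract _ _ nakayamaRegularHom_inv

/-- If the opposite algebra has the double centraliser property, the values of the Nakayama
functor are presented by a basic projective-injective module. -/
theorem isPresented_nakayama (hQ : IsBasicProjInj Q) (hdc : HasDoubleCentraliser k Aᵐᵒᵖ)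
    (M : FinDimMod k A) : IsPresented Q ((nakayama k A).obj M) := by
  have hfree (n : ℕ) : IsPresented Q ((nakayama k A).obj (free k A n)) := by
    refine IsPresented.of_sum (fun _ : Fin n => isPresented_nakayama_regular hQ hdc)
      (fun i => (nakayama k A).map (proj i)) (fun i => (nakayama k A).map (single i)) ?_
    simp only [← Functor.map_comp, ← Functor.map_sum, sum_proj_single]
    exact (nakayama k A).map_id _
  obtain ⟨m, n, f, g, hfg, hg⟩ := exists_presentation M
  have := hQ.projective
  have h1 := nakayama_map_exact hfg hg
  have h2 := nakayama_map_surjective hg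
  have := epi_of_surjective _ h2
  exact IsPresented.of_cokernel (hfree m).gen (hfree n) ((nakayama k A).map f)
    ((nakayama k A).map g) (ext fun l => (h1 _).2 ⟨l, rfl⟩) fun N h w => exists_desc h1 h2 h w

end FinDimMod

end

end SerreCoapp

namespace SerreCoapp

open Limits TensorProduct

noncomputable section

open scoped ModuleCat

variable {k A : Type u} [Field k] [Ring A] [Algebra k A]

/-! ### Morphisms to a good projective-injective module -/

theorem isSemisimpleModule_socle (R M : Type*) [Ring R] [AddCommGroup M] [Module R M] :
    IsSemisimpleModule R (socle R M) := by
  rw [socle, sSup_eq_iSup]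
  exact isSemisimpleModule_biSup_of_isSemisimpleModule_submodule fun S (hS : IsSimpleModule R S) =>
    inferInstance

namespace FinDimMod

variable {Q : FinDimMod k A}

/-- Nonzero morphisms to a good projective module are detected by its endomorphisms. -/
theorem exists_comp_ne_zero [Projective Q] (hgood : IsGood Q) {K : FinDimMod k A} (f : K ⟶ Q)
    (hf : f ≠ 0) : ∃ g : Q ⟶ K, g ≫ f ≠ 0 := by
  obtain ⟨e⟩ := hgood
  have : IsArtinian A Q.obj := isArtinian_of_tower k inferInstance
  have hr : LinearMap.range (lin f) ≠ ⊥ := fun h => hf (ext fun x =>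
    LinearMap.congr_fun (LinearMap.range_eq_bot.1 h) x)
  obtain ⟨S, hS, hSf⟩ := (eq_bot_or_exists_atom_le (LinearMap.range (lin f))).resolve_left hr
  have hsimple : IsSimpleModule A S := isSimpleModule_iff_isAtom.2 hS
  have hsoc : S ≤ socle A Q.obj := le_sSup hsimple
  have := isSemisimpleModule_socle A Q.obj
  obtain ⟨r, hr⟩ := IsSemisimpleModule.extension_property (Submodule.inclusion hsoc)
    (Submodule.inclusion_injective hsoc) LinearMap.id
  -- Q surjects onto its head, hence onto its socle by goodness, hence onto the simple submodule S,
  -- a direct summand of the semisimple socle. By projectivity this surjection lifts to the preimage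
  -- of S under `f`.
  let p : Q.obj →ₗ[A] S := r ∘ₗ e.symm.toLinearMap ∘ₗ (Module.jacobson A Q.obj).mkQ
  have hp : Function.Surjective p := by
    have h1 : Function.Surjective r := fun x => ⟨_, LinearMap.congr_fun hr x⟩
    exact h1.comp (e.symm.surjective.comp (Submodule.mkQ_surjective _))
  let K' := ofSubmodule (S.comap (lin f))
  let f' : K' ⟶ ofSubmodule S := homOf ((lin f).restrict fun x hx => hx)
  have hf' : Function.Surjective (lin f') := by
    rintro ⟨y, hy⟩
    obtain ⟨x, rfl⟩ := hSf hy
    exact ⟨(⟨x, hy⟩ : S.comap (lin f)), rfl⟩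
  have := epi_of_surjective f' hf'
  let p' : Q ⟶ ofSubmodule S := homOf p
  let i : K' ⟶ K := homOf (Submodule.subtype _)
  let j : ofSubmodule S ⟶ Q := homOf S.subtype
  have hij : i ≫ f = f' ≫ j := rfl
  refine ⟨Projective.factorThru p' f' ≫ i, fun h => ?_⟩
  rw [Category.assoc, hij, ← Category.assoc, Projective.factorThru_comp] at h
  obtain ⟨y, hy, hy0⟩ := Submodule.exists_mem_ne_zero_of_ne_bot hS.1
  obtain ⟨x, hx⟩ := hp ⟨y, hy⟩
  have h2 : (p x : Q.obj) = 0 := congrArg (fun g => lin g x) h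
  rw [hx] at h2
  exact hy0 h2

variable [Projective Q] [Injective Q] (hgood : IsGood Q)

include hgood

/-- Every `End Q`-linear map `Hom(Q, M) → Hom(Q, Q)` comes from a morphism `M ⟶ Q`. -/
theorem exists_hom_of_linear {M : FinDimMod k A} (φ : (Q ⟶ M) →+ (Q ⟶ Q))
    (hφ : ∀ (b : Q ⟶ Q) (f : Q ⟶ M), φ (b ≫ f) = b ≫ φ f) : ∃ h : M ⟶ Q, ∀ f, φ f = f ≫ h := by
  let g := Module.finBasis k (Q ⟶ M)
  let G : (⨁ fun _ : Fin (Module.finrank k (Q ⟶ M)) => Q) ⟶ M := biproduct.desc fun i => g i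
  let Φ : (⨁ fun _ : Fin (Module.finrank k (Q ⟶ M)) => Q) ⟶ Q := biproduct.desc fun i => φ (g i)
  have key (u : Q ⟶ ⨁ fun _ : Fin (Module.finrank k (Q ⟶ M)) => Q) : φ (u ≫ G) = u ≫ Φ := by
    simp only [G, Φ, biproduct.desc_eq, Preadditive.comp_sum, map_sum]
    exact Finset.sum_congr rfl fun i _ => by simp only [← Category.assoc, hφ]
  -- Any Q ⟶ ker G becomes zero after `Φ` by B-linearity, and goodness of Q says that such maps
  -- detect nonzero morphisms into Q.
  have hker : kernel.ι G ≫ Φ = 0 := by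
    by_contra hne
    obtain ⟨u, hu⟩ := exists_comp_ne_zero hgood _ hne
    refine hu ?_
    rw [← Category.assoc, ← key, Category.assoc, kernel.condition, comp_zero, map_zero]
  -- `Φ` factors through the image of `G`; injectivity of Q extends the factorization to all of M.
  obtain ⟨h, hh⟩ : ∃ h, G ≫ h = Φ := ⟨_, (ShortComplex.exact_kernel G).comp_descToInjective Φ hker⟩
  refine ⟨h, fun f => ?_⟩
  have hg (i) : g i ≫ h = φ (g i) := by
    rw [← biproduct.ι_desc (fun i => g i) i, Category.assoc]
    refine (congrArg (fun t => biproduct.ι _ i ≫ t) hh).trans ?_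
    exact (biproduct.ι_desc _ _).trans (by rw [biproduct.ι_desc])
  have hφk (c : k) (f : Q ⟶ M) : φ (c • f) = c • φ f := by
    have := hφ (c • 𝟙 Q) f
    simpa [Linear.smul_comp] using this
  rw [← g.sum_repr f, map_sum, Preadditive.sum_comp]
  exact Finset.sum_congr rfl fun i _ => by rw [hφk, Linear.smul_comp, hg]

end FinDimMod

end

end SerreCoapp

namespace SerreCoapp

open Limits TensorProduct

noncomputable section

open scoped ModuleCat

/-! ### The functor `Hom(Q, -)` and symmetric endomorphism algebras -/

section Coyoneda

variable {C : Type*} [Category* C] [Preadditive C]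

/-- Natural `End Q`-linear isomorphisms `Hom(Q, M) ≅ Hom(Q, F M)`. -/
structure CoyonedaIso (Q : C) (F : C ⥤ C) where
  equiv (M : C) : (Q ⟶ M) ≃+ (Q ⟶ F.obj M)
  comp_left {M : C} (b : Q ⟶ Q) (f : Q ⟶ M) : equiv M (b ≫ f) = b ≫ equiv M f
  comp_right {M N : C} (f : Q ⟶ M) (g : M ⟶ N) : equiv N (f ≫ g) = equiv M f ≫ F.map g

theorem CoyonedaIso.nonempty_iff {Q : C} {F : C ⥤ C} : Nonempty (CoyonedaIso Q F) ↔
    Nonempty (preadditiveCoyonedaObj Q ≅ F ⋙ preadditiveCoyonedaObj Q) := by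
  constructor
  · rintro ⟨e⟩
    let l (M : C) : (Q ⟶ M) ≃ₗ[(End Q)ᵐᵒᵖ] (Q ⟶ F.obj M) :=
      { e.equiv M with map_smul' := fun b f => e.comp_left b.unop f }
    exact ⟨NatIso.ofComponents (fun M => (l M).toModuleIso)
      fun {M N} g => ModuleCat.hom_ext (LinearMap.ext fun f => e.comp_right f g)⟩
  · rintro ⟨η⟩
    exact ⟨{
      equiv := fun M => (η.app M).toLinearEquiv.toAddEquiv
      comp_left := fun {M} b f => map_smul (η.app M).toLinearEquiv (MulOpposite.op (show End Q from b)) f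
      comp_right := fun {M N} f g =>
        congrArg (fun t => t.hom f) (η.hom.naturality g) }⟩

end Coyoneda

section Symmetric

variable {k : Type*} [Field k] {C : Type*} [Category* C] [Abelian C] [Linear k C]

/-- `End Q` is symmetric if `Hom(Q, -)` is isomorphic to its composition with a functor satisfying
Nakayama duality. -/
theorem NakayamaDuality.isSymmetricAlgebra {F : C ⥤ C} (D : NakayamaDuality k F) {Q : C}
    [hQ : Projective Q] (e : CoyonedaIso Q F) : IsSymmetricAlgebra k (End Q) := by
  have hsmul (c : k) (f : Q ⟶ Q) : e.equiv Q (c • f) = c • e.equiv Q f := by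
    have := e.comp_left (c • 𝟙 Q) f
    simpa [Linear.smul_comp] using this
  let φ : (Q ⟶ Q) ≃ₗ[k] Module.Dual k (Q ⟶ Q) :=
    LinearEquiv.trans { e.equiv Q with map_smul' := hsmul } (D.equiv Q Q hQ)
  have hφ (x y) : φ x y = D.equiv Q Q hQ (e.equiv Q x) y := rfl
  refine ⟨φ, fun a x b y => ?_⟩
  change φ (b ≫ (x ≫ a)) y = φ x (a ≫ (y ≫ b))
  rw [hφ, hφ, e.comp_left, e.comp_right, D.comp_left hQ, D.comp_right hQ hQ]

/-- The form of a symmetric endomorphism algebra. -/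
theorem IsSymmetricAlgebra.exists_form {Q : C} (h : IsSymmetricAlgebra k (End Q)) :
    ∃ (φ : (Q ⟶ Q) ≃ₗ[k] Module.Dual k (Q ⟶ Q)) (t : Module.Dual k (Q ⟶ Q)),
      (∀ x y, φ x y = t (x ≫ y)) ∧ ∀ x y : Q ⟶ Q, t (x ≫ y) = t (y ≫ x) := by
  obtain ⟨φ, hφ⟩ := h
  have h1 (x y : Q ⟶ Q) : φ x y = φ (𝟙 Q) (x ≫ y) := by
    have := hφ x 1 1 y
    rwa [mul_one, mul_one, one_mul] at this
  have h2 (x y : Q ⟶ Q) : φ x y = φ (𝟙 Q) (y ≫ x) := by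
    have := hφ 1 1 x y
    rwa [mul_one, one_mul, mul_one] at this
  exact ⟨φ, φ (𝟙 Q), h1, fun x y => (h1 x y).symm.trans (h2 x y)⟩

/-- The form `Hom(Q, M) × Hom(M, Q) → k` given by a functional on `End Q`. -/
def compForm {Q : C} (t : Module.Dual k (Q ⟶ Q)) (M : C) :
    (M ⟶ Q) →ₗ[k] Module.Dual k (Q ⟶ M) :=
  LinearMap.mk₂ k (fun g f => t (f ≫ g)) (fun _ _ _ => by simp) (fun _ _ _ => by simp)
    (fun _ _ _ => by simp) (fun _ _ _ => by simp)

theorem compForm_apply {Q : C} (t : Module.Dual k (Q ⟶ Q)) {M : C} (g : M ⟶ Q) (f : Q ⟶ M) :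
    compForm t M g f = t (f ≫ g) := rfl

/-- The form `t` on B is nondegenerate, so `h₁` gives injectivity. For surjectivity, a functional l
on Hom(Q, M) is converted by `t` into a B-linear map Hom(Q, M) → B, which `h₂` represents by a
morphism M ⟶ Q. -/
theorem compForm_bijective {Q : C} (φ : (Q ⟶ Q) ≃ₗ[k] Module.Dual k (Q ⟶ Q))
    (t : Module.Dual k (Q ⟶ Q)) (hφ : ∀ x y, φ x y = t (x ≫ y))
    (ht : ∀ x y : Q ⟶ Q, t (x ≫ y) = t (y ≫ x)) {M : C}
    (h₁ : ∀ f : M ⟶ Q, f ≠ 0 → ∃ g : Q ⟶ M, g ≫ f ≠ 0)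
    (h₂ : ∀ ψ : (Q ⟶ M) →+ (Q ⟶ Q), (∀ (b : Q ⟶ Q) (f : Q ⟶ M), ψ (b ≫ f) = b ≫ ψ f) →
      ∃ h : M ⟶ Q, ∀ f, ψ f = f ≫ h) : Function.Bijective (compForm t M) := by
  constructor
  · refine (injective_iff_map_eq_zero _).2 fun g hg => ?_
    by_contra hne
    obtain ⟨f, hf⟩ := h₁ g hne
    refine hf (φ.injective (LinearMap.ext fun y => ?_))
    rw [hφ, ht, ← Category.assoc, ← compForm_apply, hg, map_zero]
    rfl
  · intro l
    let ψ (f : Q ⟶ M) : Q ⟶ Q := φ.symm (l ∘ₗ Linear.rightComp k Q f)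
    have hψ (f : Q ⟶ M) (y : Q ⟶ Q) : φ (ψ f) y = l (y ≫ f) :=
      LinearMap.congr_fun (φ.apply_symm_apply (l ∘ₗ Linear.rightComp k Q f)) y
    obtain ⟨h, hh⟩ := h₂ (AddMonoidHom.mk' ψ fun f g => φ.injective (LinearMap.ext fun y => by
        rw [map_add, LinearMap.add_apply, hψ, hψ, hψ, Preadditive.comp_add, map_add]))
      fun b f => φ.injective (LinearMap.ext fun y => by
        change φ (ψ (b ≫ f)) y = φ (b ≫ ψ f) y
        rw [hψ, hφ, Category.assoc, ht, Category.assoc, ← hφ, hψ, Category.assoc])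
    replace hh (f) : ψ f = f ≫ h := hh f
    refine ⟨h, LinearMap.ext fun f => ?_⟩
    rw [compForm_apply, ← hh, ← Category.comp_id (ψ f), ← hφ, hψ, Category.id_comp]

/-- Evaluation against a functional on a symmetric algebra, as an isomorphism. -/
def compFormEquiv [∀ X Y : C, Module.Finite k (X ⟶ Y)] {Q : C} (t : Module.Dual k (Q ⟶ Q)) {M : C}
    (h : Function.Bijective (compForm t M)) : (Q ⟶ M) ≃ₗ[k] Module.Dual k (M ⟶ Q) :=
  (Module.evalEquiv k (Q ⟶ M)).trans (LinearEquiv.ofBijective (compForm t M) h).dualMap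

variable {F : C ⥤ C} [F.Additive] (D : NakayamaDuality k F) {Q : C} [hQ : Projective Q]

/-- The pairing of `Hom(Q, F M)` and `Hom(M, Q)` into `Hom(Q, F Q) ≅ Hom(Q, Q)^*`. -/
def nakayamaPairing (hF : ∀ {X Y : C} (c : k) (f : X ⟶ Y), F.map (c • f) = c • F.map f) (M : C) :
    (Q ⟶ F.obj M) →ₗ[k] Module.Dual k (M ⟶ Q) :=
  LinearMap.mk₂ k (fun α g => D.equiv Q Q hQ (α ≫ F.map g) (𝟙 Q))
    (fun _ _ _ => by simp) (fun _ _ _ => by simp)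
    (fun _ _ _ => by simp) (fun _ _ _ => by simp [hF])

variable (hF : ∀ {X Y : C} (c : k) (f : X ⟶ Y), F.map (c • f) = c • F.map f)

theorem nakayamaPairing_apply {M : C} (α : Q ⟶ F.obj M) (g : M ⟶ Q) :
    nakayamaPairing D hF M α g = D.equiv Q Q hQ (α ≫ F.map g) (𝟙 Q) := rfl

theorem nakayamaPairing_comp {M N : C} (α : Q ⟶ F.obj M) (g : M ⟶ N) (v : N ⟶ Q) :
    nakayamaPairing D hF N (α ≫ F.map g) v = nakayamaPairing D hF M α (g ≫ v) := by
  rw [nakayamaPairing_apply, nakayamaPairing_apply, F.map_comp, Category.assoc]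

theorem nakayamaPairing_comp_left {M : C} (b : Q ⟶ Q) (α : Q ⟶ F.obj M) (g : M ⟶ Q) :
    nakayamaPairing D hF M (b ≫ α) g = nakayamaPairing D hF M α (g ≫ b) := by
  rw [nakayamaPairing_apply, nakayamaPairing_apply, F.map_comp, Category.assoc, D.comp_left hQ,
    ← Category.assoc, D.comp_right hQ hQ, Category.id_comp, Category.comp_id]

/-- For projective P the pairing is the given duality, rewritten by naturality in P. -/
theorem nakayamaPairing_bijective_of_projective (P : C) [hP : Projective P] :
    Function.Bijective (nakayamaPairing D hF (Q := Q) P) := by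
  have : nakayamaPairing D hF (Q := Q) P = (D.equiv Q P hP).toLinearMap :=
    LinearMap.ext fun α => LinearMap.ext fun g => by
      rw [nakayamaPairing_apply, D.comp_right hP hQ, Category.comp_id]
      rfl
  rw [this]
  exact (D.equiv Q P hP).bijective

/-- The duality passes from P₁ and P₀ to their cokernel. A morphism Q ⟶ F P₀ pairing to zero with
Hom(M, Q) defines a functional on Hom(P₀, Q) that comes from one on Hom(P₁, Q), so the morphism
factors through F P₁ and dies in F M. No separate exactness of F at P₀ is needed. -/
theorem nakayamaPairing_bijective {P₁ P₀ M : C} [Projective P₁] [Projective P₀] (f : P₁ ⟶ P₀)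
    (g : P₀ ⟶ M) [Epi g] [Epi (F.map g)] (w : f ≫ g = 0)
    (desc : ∀ v : P₀ ⟶ Q, f ≫ v = 0 → ∃ u : M ⟶ Q, g ≫ u = v) :
    Function.Bijective (nakayamaPairing D hF (Q := Q) M) := by
  constructor
  · refine (injective_iff_map_eq_zero _).2 fun α hα => ?_
    obtain ⟨α, rfl⟩ : ∃ α', α' ≫ F.map g = α := ⟨_, Projective.factorThru_comp α (F.map g)⟩
    have h1 : nakayamaPairing D hF P₀ α ∈ LinearMap.range (Linear.leftComp k Q f).dualMap := by
      rw [LinearMap.range_dualMap_eq_dualAnnihilator_ker, Submodule.mem_dualAnnihilator]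
      intro v hv
      obtain ⟨u, rfl⟩ := desc v hv
      rw [← nakayamaPairing_comp, hα]
      rfl
    obtain ⟨l, hl⟩ := h1
    obtain ⟨β, rfl⟩ := (nakayamaPairing_bijective_of_projective D hF (Q := Q) P₁).2 l
    have h2 : β ≫ F.map f = α := by
      refine (nakayamaPairing_bijective_of_projective D hF P₀).1 (LinearMap.ext fun v => ?_)
      rw [nakayamaPairing_comp, ← hl]
      rfl
    rw [← h2, Category.assoc, ← F.map_comp, w, F.map_zero, comp_zero]
  · intro l
    have h1 : Function.Injective (Linear.leftComp k Q g) := fun u v huv => by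
      rwa [← cancel_epi g]
    obtain ⟨l', rfl⟩ := LinearMap.dualMap_surjective_of_injective h1 l
    obtain ⟨α, rfl⟩ := (nakayamaPairing_bijective_of_projective D hF (Q := Q) P₀).2 l'
    exact ⟨α ≫ F.map g, LinearMap.ext fun u => nakayamaPairing_comp D hF α g u⟩

/-- Symmetry of `End Q` provides natural isomorphisms `Hom(Q, M) ≅ Hom(Q, F M)`. -/
def coyonedaIsoOfForm [∀ X Y : C, Module.Finite k (X ⟶ Y)] (t : Module.Dual k (Q ⟶ Q))
    (ht : ∀ x y : Q ⟶ Q, t (x ≫ y) = t (y ≫ x)) (h₁ : ∀ M, Function.Bijective (compForm t M))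
    (h₂ : ∀ M, Function.Bijective (nakayamaPairing D hF (Q := Q) M)) : CoyonedaIso Q F :=
  -- Hom(Q, M) ≅ Hom(M, Q)^* by the form and Hom(Q, F M) ≅ Hom(M, Q)^* by the pairing; the
  -- isomorphism compares the two, so both naturalities can be tested against morphisms into Q.
  let T (M : C) := LinearEquiv.ofBijective _ (h₂ M)
  have hT (M : C) (f : Q ⟶ M) (g : M ⟶ Q) :
      nakayamaPairing D hF M ((T M).symm (compFormEquiv t (h₁ M) f)) g = t (f ≫ g) :=
    LinearMap.congr_fun ((T M).apply_symm_apply _) g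
  { equiv := fun M => ((compFormEquiv t (h₁ M)).trans (T M).symm).toAddEquiv
    comp_left := fun {M} b f => (h₂ M).1 (LinearMap.ext fun g => by
      change nakayamaPairing D hF M ((T M).symm (compFormEquiv t (h₁ M) (b ≫ f))) g =
        nakayamaPairing D hF M (b ≫ (T M).symm (compFormEquiv t (h₁ M) f)) g
      rw [hT, nakayamaPairing_comp_left, hT, Category.assoc, ht, Category.assoc])
    comp_right := fun {M N} f m => (h₂ N).1 (LinearMap.ext fun g => by
      change nakayamaPairing D hF N ((T N).symm (compFormEquiv t (h₁ N) (f ≫ m))) g =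
        nakayamaPairing D hF N ((T M).symm (compFormEquiv t (h₁ M) f) ≫ F.map m) g
      rw [hT, nakayamaPairing_comp, hT, Category.assoc]) }

end Symmetric

end

end SerreCoapp

namespace SerreCoapp

open Limits TensorProduct

noncomputable section

open scoped ModuleCat

variable {k A : Type u} [Field k] [Ring A] [Algebra k A] [Module.Finite k A]

/-! ### Comparison of the Nakayama functor and the squared coapproximation -/

namespace FinDimMod

theorem nakayama_map_smul {M N : FinDimMod k A} (c : k) (f : M ⟶ N) :
    (nakayama k A).map (c • f) = c • (nakayama k A).map f := by
  refine nakayama_ext fun g m => ?_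
  refine Eq.trans ?_ (lin_smul c ((nakayama k A).map f) (NakayamaObj.pure g m)).symm
  have h1 : NakayamaObj.pure (k := k) g (algebraMap k A c • lin f m) =
      algebraMap k A c • NakayamaObj.pure g (lin f m) := by
    rw [← NakayamaObj.pure_mulLeft, NakayamaObj.smul_pure]
    congr 1
    exact LinearMap.ext fun a => congrArg g (Algebra.commutes c a)
  exact h1

variable {Q : FinDimMod k A}

/-- If `End Q` is symmetric, then `Hom(Q, -)` and `Hom(Q, H -)` are isomorphic. -/
theorem nonempty_coyonedaIso_nakayama [Projective Q] [Injective Q] (hgood : IsGood Q)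
    (h : IsSymmetricAlgebra k (End Q)) : Nonempty (CoyonedaIso Q (nakayama k A)) := by
  obtain ⟨φ, t, hφ, ht⟩ := h.exists_form
  refine ⟨coyonedaIsoOfForm (nakayamaDuality k A) nakayama_map_smul t ht
    (fun M => compForm_bijective φ t hφ ht (fun f => exists_comp_ne_zero hgood f)
      (exists_hom_of_linear hgood)) fun M => ?_⟩
  obtain ⟨m, n, f, g, hfg, hg⟩ := exists_presentation M
  have := epi_of_surjective g hg
  have := epi_of_surjective _ (nakayama_map_surjective hg)
  exact nakayamaPairing_bijective (nakayamaDuality k A) nakayama_map_smul f g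
    (ext fun x => (hfg _).2 ⟨x, rfl⟩) fun v hv => exists_desc hfg hg v hv

/-- The Nakayama functor is the square of the partial coapproximation if and only if they agree
after applying `Hom(Q, -)`. -/
theorem nonempty_coyonedaIso_iff (hQ : IsBasicProjInj Q) (hdc : HasDoubleCentraliser k Aᵐᵒᵖ) :
    Nonempty (CoyonedaIso Q (nakayama k A)) ↔ Nonempty (nakayama k A ≅ coapp Q ⋙ coapp Q) := by
  have := hQ.projective
  constructor
  · rintro ⟨e⟩
    -- V Coapp² ≅ V ≅ V H, lifted to the functors themselves since both have presented values.
    obtain ⟨i⟩ := IsPresented.nonempty_iso (isPresented_coappSq Q) (isPresented_nakayama hQ hdc)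
      (fun M => (coappSqEquiv Q M).trans (e.equiv M))
      (fun M b f => (congrArg (e.equiv M) (coappSqEquiv_comp Q b f)).trans (e.comp_left b _))
      (fun {M N} g f => (congrArg (e.equiv N) (coappSqEquiv_naturality Q g f)).trans
        (e.comp_right _ g))
    exact ⟨i.symm⟩
  · rintro ⟨i⟩
    exact ⟨{
      equiv := fun M => (coappSqEquiv Q M).symm.trans
        { toFun := fun f => f ≫ i.inv.app M
          invFun := fun f => f ≫ i.hom.app M
          left_inv := fun f => by simp
          right_inv := fun f => by simp
          map_add' := fun f g => Preadditive.add_comp _ _ _ _ _ _ }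
      comp_left := fun {M} b f => by
        have : (coappSqEquiv Q M).symm (b ≫ f) = b ≫ (coappSqEquiv Q M).symm f := by
          rw [AddEquiv.symm_apply_eq, coappSqEquiv_comp, AddEquiv.apply_symm_apply]
        exact (congrArg (fun t => t ≫ i.inv.app M) this).trans (Category.assoc _ _ _)
      comp_right := fun {M N} f g => by
        have : (coappSqEquiv Q N).symm (f ≫ g) =
            (coappSqEquiv Q M).symm f ≫ (coapp Q ⋙ coapp Q).map g := by
          rw [AddEquiv.symm_apply_eq, coappSqEquiv_naturality, AddEquiv.apply_symm_apply]
        refine (congrArg (fun t => t ≫ i.inv.app N) this).trans ((Category.assoc _ _ _).trans ?_)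
        refine (congrArg (fun t => (coappSqEquiv Q M).symm f ≫ t) (i.inv.naturality g)).trans ?_
        exact (Category.assoc _ _ _).symm }⟩

end FinDimMod

end

end SerreCoapp

/-! ### The equivalences and the Serre functor. -/

theorem mainTheorem4 {k A : Type u} [Field k] [IsAlgClosed k] [Ring A] [Algebra k A]
    [Module.Finite k A] [HasDerivedCategory.{w} (SerreCoapp.FinDimMod k A)]
    (hA : SerreCoapp.HasFiniteGlobalDimension k A)
    (Q : SerreCoapp.FinDimMod k A) (hQ : SerreCoapp.IsBasicProjInj Q)
    (hgood : SerreCoapp.IsGood Q)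
    (hdc : SerreCoapp.HasDoubleCentraliser k A)
    (hdc' : SerreCoapp.HasDoubleCentraliser k Aᵐᵒᵖ) :
    List.TFAE
      [Nonempty (preadditiveCoyonedaObj Q ≅ SerreCoapp.nakayama k A ⋙ preadditiveCoyonedaObj Q),
       Nonempty (SerreCoapp.nakayama k A ≅ SerreCoapp.coapp Q ⋙ SerreCoapp.coapp Q),
       SerreCoapp.IsSymmetricAlgebra k (End Q)] ∧
    (SerreCoapp.IsSymmetricAlgebra k (End Q) →
      (∃ S : DerivedCategory.Bounded (SerreCoapp.FinDimMod k A) ⥤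
          DerivedCategory.Bounded (SerreCoapp.FinDimMod k A),
        SerreCoapp.IsLeftDerived (SerreCoapp.coapp Q ⋙ SerreCoapp.coapp Q) S) ∧
      ∀ S : DerivedCategory.Bounded (SerreCoapp.FinDimMod k A) ⥤
          DerivedCategory.Bounded (SerreCoapp.FinDimMod k A),
        SerreCoapp.IsLeftDerived (SerreCoapp.coapp Q ⋙ SerreCoapp.coapp Q) S →
          SerreCoapp.IsSerreFunctor k S) := by
  have := hQ.projective
  have := hQ.injective
  have h12 := SerreCoapp.FinDimMod.nonempty_coyonedaIso_iff hQ hdc'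
  have h31 := SerreCoapp.FinDimMod.nonempty_coyonedaIso_nakayama hgood
  rw [← SerreCoapp.CoyonedaIso.nonempty_iff]
  refine ⟨?_, fun hs => ?_⟩
  · tfae_have 1 ↔ 2 := h12
    tfae_have 3 → 1 := h31
    tfae_have 1 → 3 := fun ⟨e⟩ => (SerreCoapp.FinDimMod.nakayamaDuality k A).isSymmetricAlgebra e
    tfae_finish
  -- The duality is available for H; the isomorphism `e` transfers the derived functor to Coapp².
  · obtain ⟨e⟩ := h12.1 (h31 hs)
    obtain ⟨n, hn⟩ := hA
    exact (SerreCoapp.FinDimMod.nakayamaDuality k A).isLeftDerived_isSerreFunctor n hn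
      SerreCoapp.FinDimMod.exists_mono_nakayama e
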